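/- All vector spaces are over $\mathbb{C}$; $\mathbb{D}=\{z\in\mathbb{C} : |z|<1\}$. **Setting.** Let $H(\mathbb{D})$ be the space of complex-valued harmonic functions on $\mathbb{D}$ with the topology of locally uniform convergence of all derivatives, $H'(\mathbb{D})$ its topological dual, and $H'(\mathbb{D})_0=\{T\in H'(\mathbb{D}) : T(1)=0\}$. For $a\in\mathbb{D}$ and $k\ge 1$ let $\partial_z^k\delta_a,\ \partial_{\bar z}^k\delta_a\in H'(\mathbb{D})_0$ be the functionals $u\mapsto(-1)^k(\partial_z^k u)(a)$ and $u\mapsto(-1)^k(\partial_{\bar z}^k u)(a)$, where $\partial_z=\frac12(\partial_x-i\partial_y)$ and $\partial_{\bar z}=\frac12(\partial_x+i\partial_y)$. For a vector space $V$ let $P(V)=\bigoplus_{n\ge0}\mathrm{Sym}^nV$; for a symmetric bilinear form $B$ on $V$ let $\partial_B$ be the operator on $P(V)$ with $$\partial_B(f_1\cdots f_n)=\sum_{i<j}B(f_i,f_j)\prod_{k\ne i,j}f_k .$$ Let $\mathbb{CE}_2^{\mathrm{emb}}(n)$ be the set of $n$-tuples of injective holomorphic maps $\mathbb{D}\to\mathbb{D}$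 with nowhere vanishing derivative and pairwise disjoint images; these sets form a symmetric operad under composition. Let $C_c^\infty(\mathbb{D})_0=\{f\in C_c^\infty(\mathbb{D}) : \int f=0\}$, let $\Delta=-(\partial_x^2+\partial_y^2)$, and for $\phi\in\mathbb{CE}_2^{\mathrm{emb}}(1)$ let $W_\phi f=|\phi'\circ\phi^{-1}|^{-2}\,(f\circ\phi^{-1})$ on $\phi(\mathbb{D})$ and $W_\phi f=0$ elsewhere; extend $W_\phi$ multiplicatively to $P(C_c^\infty(\mathbb{D})_0)$. Let $F_{CL}(\mathbb{D})_0$ be the quotient of $P(C_c^\infty(\mathbb{D})_0)$ by the span of all elements $$-f_1\cdots f_n\,\Delta h+\sum_{i}\Big(\int_{\mathbb{D}} f_i h\Big)\,f_1\cdots\widehat{f_i}\cdots f_n ,\qquad n\ge0,\ f_i\in C_c^\infty(\mathbb{D})_0,\ h\in C_c^\infty(\mathbb{D}).$$ On $H'(\mathbb{D})_0$ let $(W^{\mathrm{cl}}_\phi T)(u)=T(u\circ\phi)$, and extend $W^{\mathrm{cl}}_\phi$ multiplicatively to $P(H'(\mathbb{D})_0)$. For a function $K$ of two variables write $\partial_K(f,g)=\int_{\mathbb{D}\times\mathbb{D}}K(z,w)f(z)g(w)\,d^2z\,d^2w$.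 Let $G(z,w)=-\frac1{2\pi}\log|z-w|$ and $$H_\phi(z,w)=\log|\phi(z)-\phi(w)|-\log|z-w|-\tfrac12\log|\phi'(z)|-\tfrac12\log|\phi'(w)| .$$ **Theorem.** The map $\tau:C_c^\infty(\mathbb{D})_0\to H'(\mathbb{D})_0$, $\tau(f)(u)=\int_{\mathbb{D}}fu$, is surjective with kernel $\Delta C_c^\infty(\mathbb{D})$, and $\tau(W_\phi f)=W^{\mathrm{cl}}_\phi\tau(f)$ for all $\phi\in\mathbb{CE}_2^{\mathrm{emb}}(1)$. The following structures are well defined: * the $\mathbb{CE}_2^{\mathrm{emb}}$-algebra structure on $F_{CL}(\mathbb{D})_0$ given by $([F_1],\dots,[F_n])\mapsto[W_{\phi_1}(F_1)\cdots W_{\phi_n}(F_n)]$ for $(\phi_1,\dots,\phi_n)\in\mathbb{CE}_2^{\mathrm{emb}}(n)$; * the linear isomorphism $\Psi:F_{CL}(\mathbb{D})_0\to P(H'(\mathbb{D})_0)$, $\Psi([F])=P(\tau)(\exp(\partial_G)F)$; * the normalized $\mathbb{CE}_2^{\mathrm{emb}}$-algebra structure $\rho^{NH}$ on $P(H'(\mathbb{D})_0)$,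 obtained by transporting the structure of $F_{CL}(\mathbb{D})_0$ along $\Psi$ and then along $\mathcal{N}^{-1}$, where $\mathcal{N}(T_1\cdots T_n)=(4\pi)^{n/2}i^n\,T_1\cdots T_n$; explicitly, $\mathcal{N}(\rho^{NH}(y_1,\dots,y_n))=\rho(\mathcal{N}y_1,\dots,\mathcal{N}y_n)$, where $\rho$ is the structure transported along $\Psi$; * for each $\phi\in\mathbb{CE}_2^{\mathrm{emb}}(1)$, the (normalized) symmetric bilinear form $\partial_\phi$ on $H'(\mathbb{D})_0$ with $\partial_\phi(\tau(f),\tau(g))=(-4\pi)\cdot\big(-\tfrac1{2\pi}\big)\,\partial_{H_\phi}(f,g)=2\,\partial_{H_\phi}(f,g)$. They have the following properties. 1. $H'(\mathbb{D})_0$ consists of all the sums $$\sum_{n\ge0}a_n\frac1{(n+1)!}\partial_z^{n+1}\delta_0+b_n\frac1{(n+1)!}\partial_{\bar z}^{n+1}\delta_0$$ for which there are $C>0$ and $0<r<1$ with $\|t_{n+1}\|_{L^2(S^1)}<C\,r^{n+1}$ for all $n\ge0$, where $t_{n+1}(z)=(-1)^{n+1}\big(a_nz^{n+1}+b_n\bar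 z^{n+1}\big)$ is the harmonic polynomial that corresponds to the $n$-th term and $S^1$ carries $d\theta/2\pi$. That is: for sequences $(a_n),(b_n)$ of complex numbers the growth condition holds if and only if there is a $T\in H'(\mathbb{D})_0$ such that the series, evaluated at each $u\in H(\mathbb{D})$, converges (unconditionally) to $T(u)$; and every $T\in H'(\mathbb{D})_0$ has exactly one such expansion, and it satisfies the growth condition. 2. For $\phi\in\mathbb{CE}_2^{\mathrm{emb}}(1)$, $a,b\in\mathbb{D}$ and $n,m\ge0$, $$W^{\mathrm{cl}}_\phi(\partial_z\delta_a)=\phi'(a)\,\partial_z\delta_{\phi(a)},\qquad \partial_\phi(\partial_z\delta_a,\partial_z\delta_b)=\frac{\phi'(a)\phi'(b)}{(\phi(a)-\phi(b))^2}-\frac1{(a-b)^2},$$ $$\partial_\phi(\partial_{\bar z}\delta_a,\partial_{\bar z}\delta_b)=\overline{\frac{\phi'(a)\phi'(b)}{(\phi(a)-\phi(b))^2}}-\frac1{(\bar a-\bar b)^2},\qquad \partial_\phi(\partial_z^{n+1}\delta_a,\partial_{\bar z}^{m+1}\delta_b)=0,$$ where for $a=b$ the right-hand sides of the second and third formulas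 are replaced by their limits as $(z,w)\to(a,a)$ with $z\ne w$; and $\rho^{NH}_\phi=W^{\mathrm{cl}}_\phi\circ\exp(\partial_\phi)$. 3. For $(\phi,\psi)\in\mathbb{CE}_2^{\mathrm{emb}}(2)$ and $a,b\in\mathbb{D}$, $$\rho^{NH}_{\phi,\psi}(\partial_z\delta_a,\partial_z\delta_b)=\phi'(a)\psi'(b)\,\partial_z\delta_{\phi(a)}\cdot\partial_z\delta_{\psi(b)}+\frac{\phi'(a)\psi'(b)}{(\phi(a)-\psi(b))^2}.$$ -/

import Mathlib

open scoped Distributions ContDiff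

namespace ConfDisk

/-! ### Operators on symmetric algebras

`P(M) = ⨁ₙ Symⁿ M` is `SymmetricAlgebra ℂ M`. -/

section Sym

variable {M : Type*} [AddCommMonoid M] [Module ℂ M]

theorem exists_symDeriv (l : M →ₗ[ℂ] ℂ) :
    ∃ d : SymmetricAlgebra ℂ M →ₗ[ℂ] SymmetricAlgebra ℂ M, d 1 = 0 ∧
      ∀ f x, d (SymmetricAlgebra.ι ℂ M f * x) = l f • x + SymmetricAlgebra.ι ℂ M f * d x := by
  let S := SymmetricAlgebra ℂ M
  let g : M →ₗ[ℂ] TrivSqZeroExt S S :=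
    (TrivSqZeroExt.inlAlgHom ℂ S S).toLinearMap ∘ₗ SymmetricAlgebra.ι ℂ M +
      ((TrivSqZeroExt.inrHom S S).restrictScalars ℂ) ∘ₗ (Algebra.linearMap ℂ S) ∘ₗ l
  let Φ : S →ₐ[ℂ] TrivSqZeroExt S S := SymmetricAlgebra.lift g
  have hfst : ∀ x, (Φ x).fst = x := by
    intro x
    have : (TrivSqZeroExt.fstHom ℂ S S).comp Φ = AlgHom.id ℂ S := by
      apply SymmetricAlgebra.algHom_ext
      ext f
      simp [Φ, g, S]
    exact congrArg (fun h => h x) this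
  refine ⟨(TrivSqZeroExt.sndHom S S).restrictScalars ℂ ∘ₗ Φ.toLinearMap, ?_, ?_⟩
  · simp
  · intro f x
    have h1 : Φ (SymmetricAlgebra.ι ℂ M f) = g f := SymmetricAlgebra.lift_ι_apply g f
    have h2 : (g f).fst = SymmetricAlgebra.ι ℂ M f := by simp [g]
    have h3 : (g f).snd = algebraMap ℂ S (l f) := by simp [g]
    simp only [LinearMap.comp_apply, AlgHom.toLinearMap_apply, LinearMap.coe_restrictScalars,
      TrivSqZeroExt.sndHom_apply, map_mul, TrivSqZeroExt.snd_mul, h1, h2, h3, hfst]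
    rw [smul_eq_mul, Algebra.smul_def, add_comm]; rfl

theorem exists_contraction_rec (B : LinearMap.BilinForm ℂ M) (hB : ∀ f g, B f g = B g f) :
    ∃ (d : M → SymmetricAlgebra ℂ M →ₗ[ℂ] SymmetricAlgebra ℂ M)
      (D : SymmetricAlgebra ℂ M →ₗ[ℂ] SymmetricAlgebra ℂ M), (∀ g, d g 1 = 0) ∧ D 1 = 0 ∧
      (∀ g f x, d g (SymmetricAlgebra.ι ℂ M f * x) = B g f • x + SymmetricAlgebra.ι ℂ M f * d g x) ∧
      ∀ f x, D (SymmetricAlgebra.ι ℂ M f * x) = SymmetricAlgebra.ι ℂ M f * D x + d f x := by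
  let S := SymmetricAlgebra ℂ M
  have hd := fun g => exists_symDeriv (B g)
  choose d hd1 hd2 using hd
  have dlin : ∀ (D1 D2 : S →ₗ[ℂ] S), D1 1 = D2 1 →
      (∀ f x, D1 x = D2 x → D1 (SymmetricAlgebra.ι ℂ M f * x) = D2 (SymmetricAlgebra.ι ℂ M f * x)) →
      D1 = D2 := by
    intro D1 D2 h1 h2
    have key : ∀ a x : S, D1 x = D2 x → D1 (a * x) = D2 (a * x) := by
      intro a
      induction a using SymmetricAlgebra.induction with
      | algebraMap r => intro x hx; rw [← Algebra.smul_def, map_smul, map_smul, hx]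
      | ι f => exact h2 f
      | mul a b ha hb => intro x hx; rw [mul_assoc]; exact ha _ (hb _ hx)
      | add a b ha hb => intro x hx; simp [add_mul, ha x hx, hb x hx]
    ext x
    simpa using key x 1 h1
  have dadd : ∀ f g, d (f + g) = d f + d g := by
    intro f g
    apply dlin
    · simp [hd1]
    · intro h x hx
      simp only [LinearMap.add_apply, hd2, map_add, add_smul] at hx ⊢
      rw [hx]; ring
  have dsmul : ∀ (c : ℂ) f, d (c • f) = c • d f := by
    intro c f
    apply dlin
    · simp [hd1]
    · intro h x hx
      simp only [LinearMap.smul_apply, hd2, map_smul, smul_eq_mul, smul_add] at hx ⊢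
      rw [hx, mul_smul, mul_smul_comm]
  let L : M →ₗ[ℂ] Module.End ℂ (S × S) :=
    { toFun := fun f => LinearMap.prod
        (LinearMap.mulLeft ℂ (SymmetricAlgebra.ι ℂ M f) ∘ₗ LinearMap.fst ℂ S S)
        (LinearMap.mulLeft ℂ (SymmetricAlgebra.ι ℂ M f) ∘ₗ LinearMap.snd ℂ S S +
          d f ∘ₗ LinearMap.fst ℂ S S)
      map_add' := by
        intro f g; refine LinearMap.ext fun x => ?_
        simp [dadd, add_mul]; abel
      map_smul' := by
        intro c f; refine LinearMap.ext fun x => ?_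
        simp [dsmul] }
  have hL : ∀ f x, L f x = (SymmetricAlgebra.ι ℂ M f * x.1, SymmetricAlgebra.ι ℂ M f * x.2 + d f x.1) :=
    fun f x => rfl
  have hcomm : ∀ a ∈ Set.range L, ∀ b ∈ Set.range L, a * b = b * a := by
    rintro _ ⟨f, rfl⟩ _ ⟨g, rfl⟩
    refine LinearMap.ext fun x => ?_
    simp only [Module.End.mul_apply, hL, hd2, hB f g]
    ext
    · simp only; ring
    · simp only; ring
  have hmc := Algebra.isMulCommutative_adjoin ℂ hcomm
  let _ : CommRing (Algebra.adjoin ℂ (Set.range L)) :=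
    { (inferInstance : Ring (Algebra.adjoin ℂ (Set.range L))) with
      mul_comm := fun a b => hmc.is_comm.comm a b }
  let L' : M →ₗ[ℂ] Algebra.adjoin ℂ (Set.range L) :=
    L.codRestrict (Subalgebra.toSubmodule (Algebra.adjoin ℂ (Set.range L)))
      (fun f => Algebra.subset_adjoin ⟨f, rfl⟩)
  let Λ' : S →ₐ[ℂ] Algebra.adjoin ℂ (Set.range L) := SymmetricAlgebra.lift L'
  let Λ : S →ₐ[ℂ] Module.End ℂ (S × S) := (Algebra.adjoin ℂ (Set.range L)).val.comp Λ'
  have hΛ : ∀ f, Λ (SymmetricAlgebra.ι ℂ M f) = L f := by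
    intro f
    have := SymmetricAlgebra.lift_ι_apply L' f
    exact congrArg Subtype.val this
  have hfst : ∀ x y : S, ∀ z : S × S, z.1 = y → (Λ x z).1 = x * y := by
    intro x
    induction x using SymmetricAlgebra.induction with
    | algebraMap r => rintro y z rfl; rw [AlgHom.commutes, ← Algebra.smul_def]; rfl
    | ι f => rintro y z rfl; simp [hΛ, hL]
    | mul a b ha hb =>
      rintro y z rfl
      rw [map_mul, Module.End.mul_apply, ha _ _ (hb _ _ rfl), mul_assoc]
    | add a b ha hb => rintro y z rfl; simp [ha _ z rfl, hb _ z rfl, add_mul]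
  refine ⟨d, LinearMap.snd ℂ S S ∘ₗ LinearMap.applyₗ ((1 : S), (0 : S)) ∘ₗ Λ.toLinearMap,
    hd1, by simp, hd2, ?_⟩
  intro f x
  simp [hΛ, hL, hfst x 1 (1, 0) rfl]

theorem exists_contraction (B : LinearMap.BilinForm ℂ M) (hB : ∀ f g, B f g = B g f) :
    ∃ D : SymmetricAlgebra ℂ M →ₗ[ℂ] SymmetricAlgebra ℂ M, ∀ (n : ℕ) (f : Fin n → M),
      D (∏ i, SymmetricAlgebra.ι ℂ M (f i)) =
        ∑ p : Fin n × Fin n with p.1 < p.2, B (f p.1) (f p.2) •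
          ∏ k with k ≠ p.1 ∧ k ≠ p.2, SymmetricAlgebra.ι ℂ M (f k) := by
  obtain ⟨d, D, hd1, hD1, hd, hD⟩ := exists_contraction_rec B hB
  refine ⟨D, ?_⟩
  have key : ∀ (n : ℕ) (f : Fin n → M) (g : M), d g (∏ i, SymmetricAlgebra.ι ℂ M (f i)) =
      ∑ j, B g (f j) • ∏ k with k ≠ j, SymmetricAlgebra.ι ℂ M (f k) := by
    intro n
    induction n with
    | zero => intro f g; simp [hd1]
    | succ n ih =>
      intro f g
      rw [Fin.prod_univ_succ, hd, ih, Fin.sum_univ_succ, Finset.mul_sum]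
      simp only [Finset.prod_filter, Fin.prod_univ_succ]
      simp [Fin.succ_ne_zero, (Fin.succ_ne_zero _).symm]
  intro n
  induction n with
  | zero => intro f; simp [hD1]
  | succ n ih =>
    intro f
    rw [Fin.prod_univ_succ, hD, ih, key]
    simp only [Finset.sum_filter, Finset.prod_filter, Fintype.sum_prod_type, Fin.prod_univ_succ, Fin.sum_univ_succ, Finset.mul_sum]
    simp [Fin.succ_ne_zero, (Fin.succ_ne_zero _).symm]
    rw [add_comm]

/-- For a symmetric bilinear form `B` on `M`, the operator `∂_B` on `P(M)` with
`∂_B(f₁ ⋯ fₙ) = ∑_{i<j} B(fᵢ, fⱼ) f₁ ⋯ f̂ᵢ ⋯ f̂ⱼ ⋯ fₙ`. -/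
noncomputable def contraction (B : LinearMap.BilinForm ℂ M) (hB : ∀ f g, B f g = B g f) :
    SymmetricAlgebra ℂ M →ₗ[ℂ] SymmetricAlgebra ℂ M :=
  (exists_contraction B hB).choose

theorem contraction_prod (B : LinearMap.BilinForm ℂ M) (hB : ∀ f g, B f g = B g f) (n : ℕ)
    (f : Fin n → M) : contraction B hB (∏ i, SymmetricAlgebra.ι ℂ M (f i)) =
      ∑ p : Fin n × Fin n with p.1 < p.2, B (f p.1) (f p.2) •
        ∏ k with k ≠ p.1 ∧ k ≠ p.2, SymmetricAlgebra.ι ℂ M (f k) :=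
  (exists_contraction B hB).choose_spec n f

/-- `exp(D) x = ∑ₖ Dᵏ x / k!`, for an operator `D` such as `∂_B` all of whose orbits `Dᵏ x` are
eventually zero. -/
noncomputable def expOp (D : SymmetricAlgebra ℂ M →ₗ[ℂ] SymmetricAlgebra ℂ M)
    (x : SymmetricAlgebra ℂ M) : SymmetricAlgebra ℂ M :=
  ∑ᶠ k : ℕ, ((k.factorial : ℂ)⁻¹) • (D ^ k) x

/-- The algebra homomorphism `P(M) → P(N)`, `f₁ ⋯ fₙ ↦ L(f₁) ⋯ L(fₙ)`. -/
noncomputable def symMap {N : Type*} [AddCommMonoid N] [Module ℂ N] (L : M →ₗ[ℂ] N) :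
    SymmetricAlgebra ℂ M →ₐ[ℂ] SymmetricAlgebra ℂ N :=
  SymmetricAlgebra.lift (SymmetricAlgebra.ι ℂ N ∘ₗ L)

end Sym

/-! ### Test functions on the disc -/

open Set Metric MeasureTheory

/-- The open unit disc `𝔻 ⊂ ℂ`. -/
def disc : TopologicalSpace.Opens ℂ := ⟨ball 0 1, isOpen_ball⟩

/-- `C_c^∞(𝔻)` (complex-valued). -/
abbrev Test : Type := 𝓓(disc, ℂ)

theorem Test.integrable (f : Test) : Integrable (fun z => f z) :=
  f.continuous.integrable_of_hasCompactSupport f.hasCompactSupport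

theorem Test.eq_zero_of_notMem (f : Test) {z : ℂ} (hz : z ∉ disc) : f z = 0 :=
  image_eq_zero_of_notMem_tsupport fun h => hz (f.tsupport_subset h)

/-- `C_c^∞(𝔻)₀`: the test functions of integral zero. -/
def Test₀ : Submodule ℂ Test where
  carrier := {f | ∫ z, f z = 0}
  zero_mem' := by simp
  add_mem' := by
    intro f g hf hg
    simp only [mem_ofPred_eq] at *
    simp [integral_add f.integrable g.integrable, hf, hg]
  smul_mem' := by
    intro c f hf
    simp only [mem_ofPred_eq] at *
    simp [integral_const_mul, hf]

open LineDeriv in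
theorem integral_lineDeriv_test (f : Test) (v : ℂ) : ∫ z, (∂_{v} f : Test) z = 0 := by
  have happ : ∀ z, (∂_{v} f : Test) z = lineDeriv ℝ f z v := fun z =>
    TestFunction.lineDerivCLM_apply_of_le (by simp)
  have h := integral_bilinear_hasLineDerivAt_right_eq_neg_left_of_integrable
    (μ := (volume : Measure ℂ)) (f := fun _ : ℂ => (1 : ℂ)) (f' := fun _ => 0) (g := fun z => f z)
    (g' := fun z => (∂_{v} f : Test) z) (v := v) (B := ContinuousLinearMap.mul ℝ ℂ)
    (by simp) (by simpa using Test.integrable (∂_{v} f)) (by simpa using Test.integrable f)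
    (fun x _ => by simpa using (hasFDerivAt_const (1 : ℂ) x).hasLineDerivAt v)
    (fun x _ => by
      rw [happ]
      exact ((f.contDiff.differentiable (by simp)).differentiableAt
        (x := x)).lineDifferentiableAt.hasLineDerivAt)
  simpa using h

open LineDeriv in
/-- The Laplacian `Δ = -(∂_x² + ∂_y²) : C_c^∞(𝔻) → C_c^∞(𝔻)₀`. -/
noncomputable def lap : Test →ₗ[ℂ] Test₀ where
  toFun h := ⟨-(∂_{(1 : ℂ)} (∂_{(1 : ℂ)} h) + ∂_{Complex.I} (∂_{Complex.I} h)), by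
    change ∫ z, (-(∂_{(1 : ℂ)} (∂_{(1 : ℂ)} h) + ∂_{Complex.I} (∂_{Complex.I} h)) : Test) z = 0
    simp only [FunLike.coe_neg, FunLike.coe_add, Pi.neg_apply, Pi.add_apply]
    rw [integral_neg, integral_add (Test.integrable _) (Test.integrable _),
      integral_lineDeriv_test, integral_lineDeriv_test]
    simp⟩
  map_add' f g := by
    ext1
    simp only [lineDerivOp_add, Submodule.coe_add]
    abel
  map_smul' c f := by
    ext1
    simp only [lineDerivOp_smul, RingHom.id_apply, Submodule.coe_smul, smul_neg, smul_add]

/-! ### Harmonic functions and harmonic distributions on the disc -/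

/-- `H(𝔻)`: the (complex-valued) harmonic functions on `𝔻`, each one represented by its
extension by zero to `ℂ`. -/
def Harm : Submodule ℂ (ℂ → ℂ) where
  carrier := {u | InnerProductSpace.HarmonicOnNhd u disc ∧ ∀ z ∉ disc, u z = 0}
  zero_mem' := ⟨fun z _ => InnerProductSpace.harmonicAt_const 0, fun _ _ => rfl⟩
  add_mem' := by
    rintro u v ⟨hu, hu'⟩ ⟨hv, hv'⟩
    exact ⟨hu.add hv, fun z hz => by simp [hu' z hz, hv' z hz]⟩
  smul_mem' := by
    rintro c u ⟨hu, hu'⟩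
    refine ⟨?_, fun z hz => by simp [hu' z hz]⟩
    exact hu.comp_CLM ((ContinuousLinearMap.mul ℝ ℂ) c)

open ComplexConjugate in
theorem harmonicAt_iff_re_im {u : ℂ → ℂ} {z : ℂ} : InnerProductSpace.HarmonicAt u z ↔
    InnerProductSpace.HarmonicAt (fun w => (u w).re) z ∧
      InnerProductSpace.HarmonicAt (fun w => (u w).im) z := by
  constructor
  · intro h
    exact ⟨h.comp_CLM Complex.reCLM, h.comp_CLM Complex.imCLM⟩
  · rintro ⟨h1, h2⟩
    have h3 := (h1.comp_CLM Complex.ofRealCLM).add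
      (h2.comp_CLM ((ContinuousLinearMap.mul ℝ ℂ Complex.I).comp Complex.ofRealCLM))
    convert! h3 using 1
    ext w
    simp [mul_comm Complex.I]

theorem contDiffAt_harm (u : Harm) {z : ℂ} (hz : z ∈ disc) : ContDiffAt ℝ ∞ (u : ℂ → ℂ) z := by
  obtain ⟨h1, h2⟩ := harmonicAt_iff_re_im.1 (u.2.1 z hz)
  have h3 : ContDiffAt ℝ ∞ (fun w => ((u.1 w).re : ℂ) + ((u.1 w).im : ℂ) * Complex.I) z :=
    (Complex.ofRealCLM.contDiff.contDiffAt.comp z (HarmonicAt.analyticAt h1).contDiffAt).add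
      ((Complex.ofRealCLM.contDiff.contDiffAt.comp z (HarmonicAt.analyticAt h2).contDiffAt).mul contDiffAt_const)
  simpa [Complex.re_add_im] using h3

theorem contDiffOn_harm (u : Harm) : ContDiffOn ℝ ∞ (u : ℂ → ℂ) disc :=
  fun _ hz => (contDiffAt_harm u hz).contDiffWithinAt

/-- The constant function `1_𝔻`. -/
noncomputable def Harm.one : Harm :=
  ⟨(disc : Set ℂ).indicator fun _ => 1, by
    refine ⟨fun z hz => ?_, fun z hz => indicator_of_notMem hz _⟩
    refine (InnerProductSpace.harmonicAt_congr_nhds ?_).2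
      (InnerProductSpace.harmonicAt_const (1 : ℂ))
    filter_upwards [disc.isOpen.mem_nhds hz] with w hw
    exact indicator_of_mem hw _⟩

/-- `T : H(𝔻) → ℂ` is continuous for the topology of locally uniform convergence of all
derivatives: `|T u| ≤ C p_{K,m}(u)` for some compact `K ⊂ 𝔻` and some order `m`. -/
def IsContinuousFunctional (T : Module.Dual ℂ Harm) : Prop :=
  ∃ K : Set ℂ, IsCompact K ∧ K ⊆ disc ∧ ∃ (m : ℕ) (C : ℝ), 0 ≤ C ∧ ∀ (u : Harm) (b : ℝ), 0 ≤ b →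
    (∀ k ≤ m, ∀ z ∈ K, ‖iteratedFDeriv ℝ k (u : ℂ → ℂ) z‖ ≤ b) → ‖T u‖ ≤ C * b

/-- `H'(𝔻)`: the topological dual of `H(𝔻)`. -/
def HarmDual : Submodule ℂ (Module.Dual ℂ Harm) where
  carrier := {T | IsContinuousFunctional T}
  zero_mem' := ⟨∅, isCompact_empty, empty_subset _, 0, 0, le_rfl, by simp⟩
  add_mem' := by
    rintro S T ⟨K, hK, hKd, m, C, hC, h⟩ ⟨K', hK', hKd', m', C', hC', h'⟩
    refine ⟨K ∪ K', hK.union hK', union_subset hKd hKd', max m m', C + C', by positivity, ?_⟩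
    intro u b hb hu
    have h1 := h u b hb fun k hk z hz => hu k (hk.trans (le_max_left _ _)) z (Or.inl hz)
    have h2 := h' u b hb fun k hk z hz => hu k (hk.trans (le_max_right _ _)) z (Or.inr hz)
    calc ‖(S + T) u‖ ≤ ‖S u‖ + ‖T u‖ := norm_add_le _ _
      _ ≤ (C + C') * b := by linarith
  smul_mem' := by
    rintro c T ⟨K, hK, hKd, m, C, hC, h⟩
    refine ⟨K, hK, hKd, m, ‖c‖ * C, by positivity, ?_⟩
    intro u b hb hu
    calc ‖(c • T) u‖ = ‖c‖ * ‖T u‖ := by simp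
      _ ≤ ‖c‖ * (C * b) := by gcongr; exact h u b hb hu
      _ = ‖c‖ * C * b := by ring

/-- `H'(𝔻)₀ = {T ∈ H'(𝔻) | T(1_𝔻) = 0}`. -/
def HarmDual₀ : Submodule ℂ HarmDual where
  carrier := {T | T.1 Harm.one = 0}
  zero_mem' := rfl
  add_mem' := by
    intro S T hS hT
    simp only [mem_ofPred_eq] at *
    simp [hS, hT]
  smul_mem' := by
    intro c T hT
    simp only [mem_ofPred_eq] at *
    simp [hT]

noncomputable instance : CoeFun HarmDual₀ fun _ => Harm → ℂ := ⟨fun T => T.1.1⟩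

/-- The map `C_c^∞(𝔻)₀ → H'(𝔻)₀`, `f ↦ (u ↦ ∫_𝔻 f u)`. -/
noncomputable def toDist : Test₀ →ₗ[ℂ] HarmDual₀ :=
  have hint : ∀ (f : Test) (u : Harm), Integrable fun z => f z * u.1 z := by
    intro f u
    refine (Continuous.integrable_of_hasCompactSupport ?_ f.hasCompactSupport.mul_right)
    rw [continuous_iff_continuousAt]
    intro z
    by_cases hz : z ∈ tsupport f
    · exact f.continuous.continuousAt.mul (contDiffAt_harm u (f.tsupport_subset hz)).continuousAt
    · have h0 : (fun z => f z * u.1 z) =ᶠ[nhds z] fun _ => 0 := by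
        filter_upwards [notMem_tsupport_iff_eventuallyEq.1 hz] with w hw
        simp [hw]
      exact continuousAt_const.congr h0.symm
  have hcont : ∀ (f : Test) (T : Module.Dual ℂ Harm), (∀ u, T u = ∫ z, f z * u.1 z) →
      IsContinuousFunctional T := by
    intro f T hT
    refine ⟨tsupport f, f.hasCompactSupport, f.tsupport_subset, 0, ∫ z, ‖f z‖,
      integral_nonneg fun _ => norm_nonneg _, ?_⟩
    intro u b hb hu
    rw [hT, ← integral_mul_const]
    refine norm_integral_le_of_norm_le (f.integrable.norm.mul_const b) (.of_forall fun z => ?_)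
    rw [norm_mul]
    by_cases hz : z ∈ tsupport f
    · gcongr
      simpa using hu 0 le_rfl z hz
    · simp [image_eq_zero_of_notMem_tsupport hz]
  { toFun := fun f => ⟨⟨
      { toFun := fun u => ∫ z, f.1 z * u.1 z
        map_add' := fun u v => by
          simp only [Submodule.coe_add, Pi.add_apply, mul_add]
          exact integral_add (hint _ _) (hint _ _)
        map_smul' := fun c u => by
          simp only [Submodule.coe_smul, Pi.smul_apply, smul_eq_mul, RingHom.id_apply,
            ← integral_const_mul]
          congr 1; ext z; ring }, hcont f.1 _ fun _ => rfl⟩, by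
      change ∫ z, f.1 z * Harm.one.1 z = 0
      rw [← (show ∫ z, f.1 z = 0 from f.2)]
      congr 1; ext z
      by_cases hz : z ∈ disc
      · have : Harm.one.1 z = 1 := indicator_of_mem hz (fun _ => (1 : ℂ))
        rw [this, mul_one]
      · rw [f.1.eq_zero_of_notMem hz, zero_mul]⟩
    map_add' := fun f g => by
      ext u
      change ∫ z, (f.1 + g.1) z * u.1 z = (∫ z, f.1 z * u.1 z) + ∫ z, g.1 z * u.1 z
      rw [← integral_add (hint _ _) (hint _ _)]
      congr 1; ext z; simp [add_mul]
    map_smul' := fun c f => by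
      ext u
      change ∫ z, (c • f.1) z * u.1 z = c * ∫ z, f.1 z * u.1 z
      rw [← integral_const_mul]
      congr 1; ext z; simp [mul_assoc] }

/-! ### Wirtinger derivatives of the Dirac distribution -/

/-- `∂_z = (∂_x - i ∂_y) / 2`. -/
noncomputable def dz (u : ℂ → ℂ) (z : ℂ) : ℂ :=
  (1 / 2) * (fderiv ℝ u z 1 - Complex.I * fderiv ℝ u z Complex.I)

/-- `∂_z̄ = (∂_x + i ∂_y) / 2`. -/
noncomputable def dzbar (u : ℂ → ℂ) (z : ℂ) : ℂ :=
  (1 / 2) * (fderiv ℝ u z 1 + Complex.I * fderiv ℝ u z Complex.I)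

/-- Auxiliary: `(∂_x + c ∂_y) / 2`. -/
noncomputable def wirt (c : ℂ) (u : ℂ → ℂ) (z : ℂ) : ℂ :=
  (1 / 2) * (fderiv ℝ u z 1 + c * fderiv ℝ u z Complex.I)

theorem dz_eq_wirt : dz = wirt (-Complex.I) := by
  funext u z; simp [dz, wirt, sub_eq_add_neg]

theorem dzbar_eq_wirt : dzbar = wirt Complex.I := rfl

/-- Auxiliary: the linear form with which `wirt` is built from the derivative. -/
noncomputable def wirtCLM (c : ℂ) : (ℂ →L[ℝ] ℂ) →L[ℝ] ℂ :=
  (1 / 2 : ℝ) • (ContinuousLinearMap.apply ℝ ℂ (1 : ℂ) +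
    (ContinuousLinearMap.mul ℝ ℂ c).comp (ContinuousLinearMap.apply ℝ ℂ Complex.I))

theorem wirt_eq (c : ℂ) (u : ℂ → ℂ) : wirt c u = wirtCLM c ∘ fderiv ℝ u := by
  funext z
  simp [wirt, wirtCLM, mul_add]

theorem contDiffAt_wirt {c : ℂ} {u : ℂ → ℂ} {z : ℂ} (hu : ContDiffAt ℝ ∞ u z) :
    ContDiffAt ℝ ∞ (wirt c u) z := by
  rw [wirt_eq]
  exact (wirtCLM c).contDiff.contDiffAt.comp z (hu.fderiv_right (m := ∞) (by simp))

theorem contDiffAt_wirt_iter {c : ℂ} {u : ℂ → ℂ} {z : ℂ} (hu : ContDiffAt ℝ ∞ u z) (k : ℕ) :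
    ContDiffAt ℝ ∞ ((wirt c)^[k] u) z := by
  induction k with
  | zero => exact hu
  | succ k ih => rw [Function.iterate_succ_apply']; exact contDiffAt_wirt ih

theorem norm_iteratedFDeriv_wirt_iter {c : ℂ} {u : ℂ → ℂ} {z : ℂ} (hu : ContDiffAt ℝ ∞ u z)
    (k n : ℕ) : ‖iteratedFDeriv ℝ n ((wirt c)^[k] u) z‖ ≤
      ‖wirtCLM c‖ ^ k * ‖iteratedFDeriv ℝ (n + k) u z‖ := by
  induction k generalizing n with
  | zero => simp
  | succ k ih =>
    rw [Function.iterate_succ_apply', wirt_eq]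
    have h1 := (wirtCLM c).norm_iteratedFDeriv_comp_left (n := n) (N := ∞)
      ((contDiffAt_wirt_iter (c := c) hu k).fderiv_right (m := ∞) (by simp))
      (by exact_mod_cast le_top)
    rw [norm_iteratedFDeriv_fderiv] at h1
    calc _ ≤ _ := h1
      _ ≤ ‖wirtCLM c‖ * (‖wirtCLM c‖ ^ k * ‖iteratedFDeriv ℝ (n + 1 + k) u z‖) := by
        gcongr; exact ih (n + 1)
      _ = _ := by rw [pow_succ', add_right_comm, add_assoc, mul_assoc]

theorem wirt_iter_congr {c : ℂ} {u v : ℂ → ℂ} {z : ℂ} (h : u =ᶠ[nhds z] v) (k : ℕ) :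
    (wirt c)^[k] u =ᶠ[nhds z] (wirt c)^[k] v := by
  induction k with
  | zero => exact h
  | succ k ih =>
    simp only [Function.iterate_succ_apply', wirt_eq]
    filter_upwards [ih.fderiv (𝕜 := ℝ)] with w hw
    simp [hw]

/-- Auxiliary: `u ↦ (-1)^(n+1) ((wirt c)^(n+1) u)(a)` as an element of `H'(𝔻)₀`. -/
noncomputable def wirtDelta (c : ℂ) (n : ℕ) (a : disc) : HarmDual₀ :=
  ⟨⟨{ toFun := fun u => (-1) ^ (n + 1) * (wirt c)^[n + 1] u.1 a
      map_add' := by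
        intro u v
        have key : ∀ k, (wirt c)^[k] ((u + v : Harm) : ℂ → ℂ) =ᶠ[nhds (a : ℂ)]
            fun z => (wirt c)^[k] u.1 z + (wirt c)^[k] v.1 z := by
          intro k
          induction k with
          | zero => exact .rfl
          | succ k ih =>
            simp only [Function.iterate_succ_apply', wirt]
            filter_upwards [ih.fderiv (𝕜 := ℝ), disc.isOpen.mem_nhds a.2] with z hz hzd
            rw [wirt, hz, fderiv_fun_add
              ((contDiffAt_wirt_iter (contDiffAt_harm u hzd) k).differentiableAt (by simp))
              ((contDiffAt_wirt_iter (contDiffAt_harm v hzd) k).differentiableAt (by simp))]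
            simp only [add_apply]
            ring
        rw [(key (n + 1)).eq_of_nhds]
        ring
      map_smul' := by
        intro r u
        have key : ∀ k, (wirt c)^[k] ((r • u : Harm) : ℂ → ℂ) =ᶠ[nhds (a : ℂ)]
            fun z => r * (wirt c)^[k] u.1 z := by
          intro k
          induction k with
          | zero => exact .rfl
          | succ k ih =>
            simp only [Function.iterate_succ_apply', wirt]
            filter_upwards [ih.fderiv (𝕜 := ℝ), disc.isOpen.mem_nhds a.2] with z hz hzd
            rw [wirt, hz, fderiv_const_mul
              ((contDiffAt_wirt_iter (contDiffAt_harm u hzd) k).differentiableAt (by simp))]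
            simp only [smul_apply, smul_eq_mul]
            ring
        rw [(key (n + 1)).eq_of_nhds]
        simp only [RingHom.id_apply, smul_eq_mul]
        ring },
    ⟨{(a : ℂ)}, isCompact_singleton, by simp, n + 1, ‖wirtCLM c‖ ^ (n + 1), by positivity, by
      intro u b hb hu
      change ‖(-1) ^ (n + 1) * (wirt c)^[n + 1] u.1 a‖ ≤ _
      have h1 := norm_iteratedFDeriv_wirt_iter (c := c) (contDiffAt_harm u a.2) (n + 1) 0
      rw [norm_iteratedFDeriv_zero, zero_add] at h1
      simp only [norm_mul, norm_pow, norm_neg, norm_one, one_pow, one_mul]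
      refine h1.trans ?_
      gcongr
      exact hu (n + 1) le_rfl a rfl⟩⟩, by
    change (-1) ^ (n + 1) * (wirt c)^[n + 1] Harm.one.1 a = 0
    have h1 : Harm.one.1 =ᶠ[nhds (a : ℂ)] fun _ => 1 := by
      filter_upwards [disc.isOpen.mem_nhds a.2] with w hw
      exact indicator_of_mem hw (fun _ => (1 : ℂ))
    rw [(wirt_iter_congr h1 (n + 1)).eq_of_nhds]
    have h2 : ∀ k, (wirt c)^[k] (fun _ => 0) = fun _ => 0 := by
      intro k
      induction k with
      | zero => rfl
      | succ k ih => rw [Function.iterate_succ_apply', ih]; funext z; simp [wirt]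
    have h3 : wirt c (fun _ => 1) = fun _ => 0 := by funext z; simp [wirt]
    rw [Function.iterate_succ_apply, h3, h2]
    simp⟩

/-- The distribution `∂_z^(n+1) δ_a : u ↦ (-1)^(n+1) (∂_z^(n+1) u)(a)`. -/
noncomputable def dzDelta (n : ℕ) (a : disc) : HarmDual₀ :=
  ⟨⟨{ toFun := fun u => (-1) ^ (n + 1) * dz^[n + 1] u.1 a
      map_add' := by rw [dz_eq_wirt]; exact (wirtDelta (-Complex.I) n a).1.1.map_add
      map_smul' := by rw [dz_eq_wirt]; exact (wirtDelta (-Complex.I) n a).1.1.map_smul },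
    by simp only [dz_eq_wirt]; exact (wirtDelta (-Complex.I) n a).1.2⟩,
    by simp only [dz_eq_wirt]; exact (wirtDelta (-Complex.I) n a).2⟩

/-- The distribution `∂_z̄^(n+1) δ_a : u ↦ (-1)^(n+1) (∂_z̄^(n+1) u)(a)`. -/
noncomputable def dzbarDelta (n : ℕ) (a : disc) : HarmDual₀ :=
  ⟨⟨{ toFun := fun u => (-1) ^ (n + 1) * dzbar^[n + 1] u.1 a
      map_add' := (wirtDelta Complex.I n a).1.1.map_add
      map_smul' := (wirtDelta Complex.I n a).1.1.map_smul },
    (wirtDelta Complex.I n a).1.2⟩, (wirtDelta Complex.I n a).2⟩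

/-! ### Conformal open embeddings of the disc -/

/-- An element of `CE₂(1)`: an orientation-preserving conformal open embedding `𝔻 → 𝔻`, that is, an
injective holomorphic map with nowhere vanishing derivative. It is represented by its extension by
zero to `ℂ`. -/
structure DiscEmb where
  /-- the underlying map -/
  toFun : ℂ → ℂ
  differentiableOn' : DifferentiableOn ℂ toFun disc
  deriv_ne_zero' : ∀ z ∈ disc, deriv toFun z ≠ 0
  injOn' : InjOn toFun disc
  mapsTo' : MapsTo toFun disc disc
  eq_zero' : ∀ z ∉ disc, toFun z = 0

namespace DiscEmb

instance : CoeFun DiscEmb fun _ => ℂ → ℂ := ⟨toFun⟩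

/-- The image of a point of the disc. -/
def map (φ : DiscEmb) (a : disc) : disc := ⟨φ a, φ.mapsTo' a.2⟩

theorem analyticAt (φ : DiscEmb) {z : ℂ} (hz : z ∈ disc) : AnalyticAt ℂ φ z :=
  φ.differentiableOn'.analyticAt (disc.isOpen.mem_nhds hz)

theorem contDiffAt (φ : DiscEmb) {z : ℂ} (hz : z ∈ disc) : ContDiffAt ℝ ∞ φ z :=
  (φ.analyticAt hz).contDiffAt.restrict_scalars ℝ

/-- The identity of `𝔻`. -/
noncomputable def id : DiscEmb where
  toFun := (disc : Set ℂ).indicator fun z => z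
  differentiableOn' := differentiableOn_id.congr fun z hz => indicator_of_mem hz _
  deriv_ne_zero' := by
    intro z hz
    have h : (disc : Set ℂ).indicator (fun z => z) =ᶠ[nhds z] fun z => z := by
      filter_upwards [disc.isOpen.mem_nhds hz] with w hw
      exact indicator_of_mem hw _
    rw [h.deriv_eq]
    simp
  injOn' := by
    intro z hz w hw h
    rwa [indicator_of_mem hz, indicator_of_mem hw] at h
  mapsTo' := by
    intro z hz
    rwa [indicator_of_mem hz]
  eq_zero' := fun z hz => indicator_of_notMem hz _

/-- The composite `φ ∘ ψ`. -/
noncomputable def comp (φ ψ : DiscEmb) : DiscEmb where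
  toFun := (disc : Set ℂ).indicator fun z => φ (ψ z)
  differentiableOn' :=
    (φ.differentiableOn'.comp ψ.differentiableOn' ψ.mapsTo').congr
      fun z hz => indicator_of_mem hz _
  deriv_ne_zero' := by
    intro z hz
    have h : (disc : Set ℂ).indicator (fun z => φ (ψ z)) =ᶠ[nhds z] φ ∘ ψ := by
      filter_upwards [disc.isOpen.mem_nhds hz] with w hw
      exact indicator_of_mem hw _
    rw [h.deriv_eq, deriv_comp z (φ.analyticAt (ψ.mapsTo' hz)).differentiableAt
      (ψ.analyticAt hz).differentiableAt]
    exact mul_ne_zero (φ.deriv_ne_zero' _ (ψ.mapsTo' hz)) (ψ.deriv_ne_zero' _ hz)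
  injOn' := by
    intro z hz w hw h
    rw [indicator_of_mem hz, indicator_of_mem hw] at h
    exact ψ.injOn' hz hw (φ.injOn' (ψ.mapsTo' hz) (ψ.mapsTo' hw) h)
  mapsTo' := by
    intro z hz
    rw [indicator_of_mem hz]
    exact φ.mapsTo' (ψ.mapsTo' hz)
  eq_zero' := fun z hz => indicator_of_notMem hz _

theorem comp_apply (φ ψ : DiscEmb) {z : ℂ} (hz : z ∈ disc) : φ.comp ψ z = φ (ψ z) :=
  indicator_of_mem hz (fun z => φ (ψ z))

/-- The function `W_φ f`, equal to `Ω_φ(φ⁻¹(x))⁻² f(φ⁻¹(x))` for `x ∈ φ(𝔻)`, with `Ω_φ = |φ'|`, and to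
zero elsewhere. -/
noncomputable def pushFun (φ : DiscEmb) (f : ℂ → ℂ) (x : ℂ) : ℂ :=
  open Classical in
  if x ∈ φ '' disc then
    (((‖deriv φ (Function.invFunOn φ disc x)‖ ^ 2)⁻¹ : ℝ) : ℂ) * f (Function.invFunOn φ disc x)
  else 0

theorem invFunOn_apply (φ : DiscEmb) {z : ℂ} (hz : z ∈ disc) :
    Function.invFunOn φ disc (φ z) = z :=
  φ.injOn'.leftInvOn_invFunOn hz

theorem pushFun_apply (φ : DiscEmb) (f : ℂ → ℂ) {z : ℂ} (hz : z ∈ disc) :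
    φ.pushFun f (φ z) = (((‖deriv φ z‖ ^ 2)⁻¹ : ℝ) : ℂ) * f z := by
  rw [pushFun, if_pos (mem_image_of_mem _ hz), φ.invFunOn_apply hz]

theorem pushFun_eq_zero (φ : DiscEmb) (f : Test) {x : ℂ} (hx : x ∉ φ '' tsupport f) :
    φ.pushFun f x = 0 := by
  by_cases h : x ∈ φ '' disc
  · obtain ⟨z, hz, rfl⟩ := h
    rw [φ.pushFun_apply _ hz, image_eq_zero_of_notMem_tsupport fun h => hx ⟨z, h, rfl⟩, mul_zero]
  · rw [pushFun, if_neg h]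

theorem isCompact_image_tsupport (φ : DiscEmb) (f : Test) : IsCompact (φ '' tsupport f) :=
  f.hasCompactSupport.isCompact.image_of_continuousOn
    (φ.differentiableOn'.continuousOn.mono f.tsupport_subset)

theorem contDiff_pushFun (φ : DiscEmb) (f : Test) : ContDiff ℝ ∞ (φ.pushFun f) := by
  rw [contDiff_iff_contDiffAt]
  intro x
  by_cases hx : x ∈ φ '' tsupport f
  · obtain ⟨z, hz, rfl⟩ := hx
    have hzd : z ∈ disc := f.tsupport_subset hz
    have hc : ContDiffAt ℂ ∞ φ z := (φ.analyticAt hzd).contDiffAt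
    have hd : HasFDerivAt φ ((ContinuousLinearEquiv.unitsEquivAut ℂ
        (Units.mk0 _ (φ.deriv_ne_zero' z hzd)) : ℂ ≃L[ℂ] ℂ) : ℂ →L[ℂ] ℂ) z := by
      convert! (φ.analyticAt hzd).differentiableAt.hasDerivAt.hasFDerivAt using 1
    have hn : (∞ : ℕ∞ω) ≠ 0 := by simp
    set g := hc.localInverse hd hn with hg
    have hgz : g (φ z) = z := hc.localInverse_apply_image hd hn
    have hgc : ContDiffAt ℝ ∞ g (φ z) := (hc.to_localInverse hd hn).restrict_scalars ℝ
    have hright : ∀ᶠ y in nhds (φ z), φ (g y) = y :=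
      (hc.hasStrictFDerivAt' hd hn).eventually_right_inverse
    have hmem : ∀ᶠ y in nhds (φ z), g y ∈ disc :=
      hgc.continuousAt.eventually_mem (disc.isOpen.mem_nhds (by rw [hgz]; exact hzd))
    have heq : φ.pushFun f =ᶠ[nhds (φ z)]
        fun y => (((‖deriv φ (g y)‖ ^ 2)⁻¹ : ℝ) : ℂ) * f (g y) := by
      filter_upwards [hright, hmem] with y h1 h2
      conv_lhs => rw [← h1]
      exact φ.pushFun_apply _ h2
    refine ContDiffAt.congr_of_eventuallyEq ?_ heq
    have h1 : ContDiffAt ℝ ∞ (fun y => deriv φ (g y)) (φ z) := by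
      have : ContDiffAt ℝ ∞ (deriv φ) (g (φ z)) := by
        rw [hgz]
        exact (φ.analyticAt hzd).deriv.contDiffAt.restrict_scalars ℝ
      exact this.comp (φ z) hgc
    refine ContDiffAt.mul ?_ (f.contDiff.contDiffAt.comp (φ z) hgc)
    refine Complex.ofRealCLM.contDiff.contDiffAt.comp (φ z) ((h1.norm_sq ℝ).inv ?_)
    rw [hgz]
    exact pow_ne_zero _ (norm_ne_zero_iff.2 (φ.deriv_ne_zero' z hzd))
  · have h : φ.pushFun f =ᶠ[nhds x] fun _ => 0 := by
      filter_upwards [(φ.isCompact_image_tsupport f).isClosed.isOpen_compl.mem_nhds hx] with y hy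
      exact φ.pushFun_eq_zero f hy
    exact contDiffAt_const.congr_of_eventuallyEq h

/-- `W_φ : C_c^∞(𝔻) → C_c^∞(𝔻)`. -/
noncomputable def push (φ : DiscEmb) (f : Test) : Test where
  toFun := φ.pushFun f
  contDiff' := φ.contDiff_pushFun f
  hasCompactSupport' :=
    HasCompactSupport.intro (φ.isCompact_image_tsupport f) fun _ => φ.pushFun_eq_zero f
  tsupport_subset' := by
    refine (closure_minimal (fun x hx => ?_) (φ.isCompact_image_tsupport f).isClosed).trans
      ((image_mono f.tsupport_subset).trans φ.mapsTo'.image_subset)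
    by_contra h
    exact hx (φ.pushFun_eq_zero f h)

theorem abs_det_smulRight (c : ℂ) :
    |((ContinuousLinearMap.toSpanSingleton ℂ c : ℂ →L[ℂ] ℂ).restrictScalars ℝ).det| = ‖c‖ ^ 2 := by
  have h : (((ContinuousLinearMap.toSpanSingleton ℂ c : ℂ →L[ℂ] ℂ).restrictScalars ℝ :
      ℂ →L[ℝ] ℂ) : ℂ →ₗ[ℝ] ℂ) = LinearMap.mulLeft ℝ c := by
    ext <;> simp [mul_comm c]
  have h2 : LinearMap.det (LinearMap.mulLeft ℝ c) = Complex.normSq c :=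
    (Algebra.norm_apply ℝ c).symm.trans (Algebra.norm_complex_apply c)
  rw [ContinuousLinearMap.det, h, h2, ← Complex.normSq_eq_norm_sq]
  exact abs_of_nonneg (Complex.normSq_nonneg c)

theorem integral_push (φ : DiscEmb) (f : Test) : ∫ z, φ.push f z = ∫ z, f z := by
  have h1 : ∫ z, φ.push f z = ∫ z in φ '' disc, φ.push f z := by
    rw [setIntegral_eq_integral_of_forall_compl_eq_zero]
    intro x hx
    exact φ.pushFun_eq_zero f fun h => hx (image_mono f.tsupport_subset h)
  have h2 : ∫ z, f z = ∫ z in disc, f z := by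
    rw [setIntegral_eq_integral_of_forall_compl_eq_zero]
    intro x hx
    exact f.eq_zero_of_notMem hx
  rw [h1, h2, integral_image_eq_integral_abs_det_fderiv_smul volume disc.isOpen.measurableSet
    (fun z hz => ((φ.analyticAt hz).differentiableAt.hasDerivAt.hasFDerivAt.restrictScalars
      ℝ).hasFDerivWithinAt) φ.injOn']
  refine setIntegral_congr_fun disc.isOpen.measurableSet fun z hz => ?_
  have h3 : φ.push f (φ z) = (((‖deriv φ z‖ ^ 2)⁻¹ : ℝ) : ℂ) * f z := φ.pushFun_apply _ hz
  have h4 : (‖deriv φ z‖ : ℂ) ≠ 0 := by simpa using φ.deriv_ne_zero' z hz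
  simp only [h3]
  erw [abs_det_smulRight]
  simp only [Complex.real_smul]
  push_cast
  field_simp

/-- `W_φ : C_c^∞(𝔻)₀ → C_c^∞(𝔻)₀`. -/
noncomputable def push₀ (φ : DiscEmb) : Test₀ →ₗ[ℂ] Test₀ where
  toFun f := ⟨φ.push f, (φ.integral_push f).trans f.2⟩
  map_add' f g := by
    ext x
    change φ.pushFun (f.1 + g.1 : Test) x = φ.pushFun f.1 x + φ.pushFun g.1 x
    simp only [pushFun]
    split_ifs <;> simp [mul_add]
  map_smul' c f := by
    ext x
    change φ.pushFun (c • f.1 : Test) x = c * φ.pushFun f.1 x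
    simp only [pushFun]
    split_ifs
    · simp only [FunLike.coe_smul, Pi.smul_apply, smul_eq_mul]; ring
    · simp

/-- The pull-back of harmonic functions, `u ↦ u ∘ φ`. -/
noncomputable def pull (φ : DiscEmb) : Harm →ₗ[ℂ] Harm where
  toFun u := ⟨(disc : Set ℂ).indicator fun z => u.1 (φ z), by
    refine ⟨fun z hz => ?_, fun z hz => indicator_of_notMem hz _⟩
    have h : (disc : Set ℂ).indicator (fun z => u.1 (φ z)) =ᶠ[nhds z] fun z => u.1 (φ z) := by
      filter_upwards [disc.isOpen.mem_nhds hz] with w hw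
      exact indicator_of_mem hw _
    rw [InnerProductSpace.harmonicAt_congr_nhds h]
    have key : ∀ v : ℂ → ℝ, InnerProductSpace.HarmonicOnNhd v disc →
        InnerProductSpace.HarmonicAt (fun w => v (φ w)) z := by
      intro v hv
      obtain ⟨F, hF, hFv⟩ :=
        InnerProductSpace.HarmonicOnNhd.exists_analyticOnNhd_ball_re_eq (z := 0) (R := 1) hv
      have h1 : AnalyticAt ℂ (F ∘ φ) z := (hF _ (φ.mapsTo' hz)).comp (φ.analyticAt hz)
      refine (InnerProductSpace.harmonicAt_congr_nhds ?_).1 h1.harmonicAt_re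
      filter_upwards [disc.isOpen.mem_nhds hz] with w hw
      exact hFv (φ.mapsTo' hw)
    exact harmonicAt_iff_re_im.2
      ⟨key _ fun w hw => (harmonicAt_iff_re_im.1 (u.2.1 w hw)).1,
        key _ fun w hw => (harmonicAt_iff_re_im.1 (u.2.1 w hw)).2⟩⟩
  map_add' u v := by
    ext z
    exact congrFun (indicator_add (disc : Set ℂ) (fun z => u.1 (φ z)) fun z => v.1 (φ z)) z
  map_smul' c u := by
    ext z
    exact congrFun (indicator_const_smul (disc : Set ℂ) c fun z => u.1 (φ z)) z

theorem isContinuous_comp_pull (φ : DiscEmb) {T : Module.Dual ℂ Harm}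
    (hT : IsContinuousFunctional T) : IsContinuousFunctional (T ∘ₗ φ.pull) := by
  obtain ⟨K, hK, hKd, m, C, hC, h⟩ := hT
  have hud : UniqueDiffOn ℝ (disc : Set ℂ) := disc.isOpen.uniqueDiffOn
  have hφ : ContDiffOn ℝ ∞ φ disc := fun z hz => (φ.contDiffAt hz).contDiffWithinAt
  have hbd : ∀ i : ℕ, ∃ D, 0 ≤ D ∧ ∀ z ∈ K, ‖iteratedFDerivWithin ℝ i φ disc z‖ ≤ D := by
    intro i
    obtain ⟨D, hD⟩ := hK.exists_bound_of_continuousOn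
      ((hφ.continuousOn_iteratedFDerivWithin (m := i) (by exact_mod_cast le_top) hud).mono hKd)
    exact ⟨max D 0, le_max_right _ _, fun z hz => (hD z hz).trans (le_max_left _ _)⟩
  choose D hD0 hD using hbd
  set E : ℝ := 1 + ∑ i ∈ Finset.range (m + 1), D i with hE
  have hE1 : 1 ≤ E := by
    have := Finset.sum_nonneg (s := Finset.range (m + 1)) fun i _ => hD0 i
    linarith
  refine ⟨φ '' K, hK.image_of_continuousOn (φ.differentiableOn'.continuousOn.mono hKd),
    (image_mono hKd).trans φ.mapsTo'.image_subset, m, C * ((m.factorial : ℝ) * E ^ m),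
    by positivity, ?_⟩
  intro u b hb hu
  have h1 := h (φ.pull u) ((m.factorial : ℝ) * b * E ^ m) (by positivity) ?_
  · calc ‖(T ∘ₗ φ.pull) u‖ ≤ _ := h1
      _ = _ := by ring
  intro k hk z hz
  have hzd := hKd hz
  have heq : (φ.pull u : ℂ → ℂ) =ᶠ[nhds z] (u : ℂ → ℂ) ∘ φ := by
    filter_upwards [disc.isOpen.mem_nhds hzd] with w hw
    exact indicator_of_mem hw (fun z => u.1 (φ z))
  rw [(heq.iteratedFDeriv ℝ k).eq_of_nhds, ← iteratedFDerivWithin_of_isOpen k disc.isOpen hzd]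
  have h2 := norm_iteratedFDerivWithin_comp_le (n := k) (C := b) (D := E) (contDiffOn_harm u) hφ
    (by exact_mod_cast le_top) hud hud φ.mapsTo' hzd
    (fun i hi => by
      rw [iteratedFDerivWithin_of_isOpen i disc.isOpen (φ.mapsTo' hzd)]
      exact hu i (hi.trans hk) _ (mem_image_of_mem _ hz))
    (fun i hi hik => by
      refine (hD i z hz).trans (le_trans ?_ (le_self_pow₀ hE1 (by omega)))
      have := Finset.single_le_sum (f := D) (fun i _ => hD0 i)
        (Finset.mem_range.2 (by omega : i < m + 1))
      linarith)
  refine h2.trans ?_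
  have h3 : ((k.factorial : ℕ) : ℝ) ≤ m.factorial := by exact_mod_cast Nat.factorial_le hk
  have h4 : E ^ k ≤ E ^ m := pow_le_pow_right₀ hE1 hk
  gcongr

/-- The left action of `φ` on `H'(𝔻)₀`: `(φ.T)(u) = T(u ∘ φ)`. -/
noncomputable def act (φ : DiscEmb) : HarmDual₀ →ₗ[ℂ] HarmDual₀ where
  toFun T := ⟨⟨T.1.1 ∘ₗ φ.pull, φ.isContinuous_comp_pull T.1.2⟩, by
    have h : φ.pull Harm.one = Harm.one := by
      ext z
      change (disc : Set ℂ).indicator (fun z => (disc : Set ℂ).indicator (fun _ => 1) (φ z)) z =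
        (disc : Set ℂ).indicator (fun _ => 1) z
      by_cases hz : z ∈ (disc : Set ℂ)
      · rw [indicator_of_mem hz, indicator_of_mem hz, indicator_of_mem (φ.mapsTo' hz)]
      · rw [indicator_of_notMem hz, indicator_of_notMem hz]
    change T.1.1 (φ.pull Harm.one) = 0
    rw [h]
    exact T.2⟩
  map_add' _ _ := rfl
  map_smul' _ _ := rfl

end DiscEmb

/-! ### Kernels -/

/-- `∂_P(f, g) = ∫_{𝔻×𝔻} P(z, w) f(z) g(w) d²z d²w`. -/
noncomputable def kernelPairing (P : ℂ → ℂ → ℝ) (f g : Test) : ℂ :=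
  ∫ p in (disc : Set ℂ) ×ˢ (disc : Set ℂ), (P p.1 p.2 : ℂ) * f p.1 * g p.2

/-- The Green function `G(z, w) = -(2π)⁻¹ log |z - w|`. -/
noncomputable def green (z w : ℂ) : ℝ := -(2 * Real.pi)⁻¹ * Real.log ‖z - w‖

/-- `H_φ(z, w) = log |φ(z) - φ(w)| - log |z - w| - (1/2) log |φ'(z)| - (1/2) log |φ'(w)|`, for
`z ≠ w`. -/
noncomputable def cocycle (φ : DiscEmb) (z w : ℂ) : ℝ :=
  Real.log ‖φ z - φ w‖ - Real.log ‖z - w‖ - (1 / 2) * Real.log ‖deriv φ z‖ -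
    (1 / 2) * Real.log ‖deriv φ w‖

theorem integrableOn_log_norm : IntegrableOn (fun z : ℂ => Real.log ‖z‖) (ball 0 2) := by
  rw [integrableOn_fun_norm_addHaar volume (f := Real.log)]
  have h : (fun y : ℝ => y ^ (Module.finrank ℝ ℂ - 1) • Real.log y) = fun y => y * Real.log y := by
    funext y; simp
  rw [h]
  exact (Real.continuous_mul_log.continuousOn.integrableOn_compact isCompact_Icc).mono_set
    Ioo_subset_Icc_self

theorem integrableOn_green (f g : Test) : IntegrableOn
    (fun p : ℂ × ℂ => (green p.1 p.2 : ℂ) * f p.1 * g p.2) ((disc : Set ℂ) ×ˢ (disc : Set ℂ)) := by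
  let k : ℂ → ℂ := (ball (0 : ℂ) 2).indicator fun z => ((Real.log ‖z‖ : ℝ) : ℂ)
  have hk : Integrable k :=
    (integrable_indicator_iff measurableSet_ball).2 integrableOn_log_norm.ofReal
  have h1 : Integrable (fun p : ℂ × ℂ => f p.2 * k (p.1 - p.2)) :=
    (f.integrable).convolution_integrand (ContinuousLinearMap.mul ℝ ℂ) hk
  have h2 : Integrable (fun p : ℂ × ℂ => f p.1 * k (p.2 - p.1)) := h1.swap
  obtain ⟨C, hC⟩ := g.continuous.bounded_above_of_compact_support g.hasCompactSupport
  have h3 : Integrable (fun p : ℂ × ℂ => -(2 * Real.pi : ℂ)⁻¹ * (g p.2 * (f p.1 * k (p.2 - p.1)))) :=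
    (h2.bdd_mul (c := C) (g.continuous.comp continuous_snd).aestronglyMeasurable
      (.of_forall fun p => hC p.2)).const_mul _
  refine h3.integrableOn.congr_fun (fun p hp => ?_) (disc.isOpen.prod disc.isOpen).measurableSet
  have h4 : k (p.2 - p.1) = ((Real.log ‖p.2 - p.1‖ : ℝ) : ℂ) := by
    refine indicator_of_mem ?_ _
    have ha : ‖p.1‖ < 1 := mem_ball_zero_iff.1 hp.1
    have hb : ‖p.2‖ < 1 := mem_ball_zero_iff.1 hp.2
    rw [mem_ball_zero_iff]
    calc _ ≤ _ := norm_sub_le _ _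
      _ < 2 := by linarith
  simp only [h4, green, norm_sub_rev p.2 p.1]
  push_cast
  ring

/-- `∂_G` as a bilinear form on `C_c^∞(𝔻)₀`. -/
noncomputable def greenForm : LinearMap.BilinForm ℂ Test₀ :=
  LinearMap.mk₂ ℂ (fun f g => kernelPairing green f g)
    (by
      intro f f' g
      simp only [kernelPairing]
      rw [← integral_add (integrableOn_green _ _) (integrableOn_green _ _)]
      congr 1; funext p; simp; ring)
    (by
      intro c f g
      simp only [kernelPairing, smul_eq_mul]
      rw [← integral_const_mul]
      congr 1; funext p; simp; ring)
    (by
      intro f g g'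
      simp only [kernelPairing]
      rw [← integral_add (integrableOn_green _ _) (integrableOn_green _ _)]
      congr 1; funext p; simp; ring)
    (by
      intro c f g
      simp only [kernelPairing, smul_eq_mul]
      rw [← integral_const_mul]
      congr 1; funext p; simp; ring)

theorem greenForm_symm (f g : Test₀) : greenForm f g = greenForm g f := by
  change kernelPairing green f g = kernelPairing green g f
  rw [kernelPairing, kernelPairing, Measure.volume_eq_prod, ← Measure.prod_restrict,
    ← integral_prod_swap]
  congr 1; funext p
  simp only [Prod.fst_swap, Prod.snd_swap, green, norm_sub_rev p.2 p.1]
  ring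

/-! ### The operad of conformal open embeddings and its algebras -/

/-- `CE₂(n)`: conformal open embeddings `𝔻 ⊔ ⋯ ⊔ 𝔻 → 𝔻`, i.e. `n`-tuples of conformal open
embeddings `𝔻 → 𝔻` with pairwise disjoint images. -/
structure CE (n : ℕ) where
  /-- the embeddings of the `n` discs -/
  emb : Fin n → DiscEmb
  disjoint' : Pairwise fun i j => Disjoint (emb i '' disc) (emb j '' disc)

namespace CE

/-- A single embedding as an element of `CE₂(1)`. -/
def ofEmb (φ : DiscEmb) : CE 1 := ⟨fun _ => φ, fun i j h => absurd (Subsingleton.elim i j) h⟩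

/-- The action of a permutation: relabelling the discs. -/
def perm {n : ℕ} (φ : CE n) (σ : Equiv.Perm (Fin n)) : CE n :=
  ⟨fun i => φ.emb (σ i), fun _ _ h => φ.disjoint' (σ.injective.ne h)⟩

/-- The operadic composition: insert `ψ i` into the `i`-th disc of `φ`, for all `i`. (The partial
composition `φ ∘ᵢ ψ` is the case in which the other entries are the identity.) -/
noncomputable def comp {n : ℕ} (φ : CE n) {k : Fin n → ℕ} (ψ : ∀ i, CE (k i)) :
    CE (∑ i, k i) where
  emb j := (φ.emb (finSigmaFinEquiv.symm j).1).comp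
    ((ψ (finSigmaFinEquiv.symm j).1).emb (finSigmaFinEquiv.symm j).2)
  disjoint' := by
    intro j j' hjj
    have hne : finSigmaFinEquiv.symm j ≠ finSigmaFinEquiv.symm j' :=
      finSigmaFinEquiv.symm.injective.ne hjj
    generalize finSigmaFinEquiv.symm j = p at hne ⊢
    generalize finSigmaFinEquiv.symm j' = q at hne ⊢
    obtain ⟨i, l⟩ := p
    obtain ⟨i', l'⟩ := q
    rw [Set.disjoint_left]
    rintro _ ⟨z, hz, rfl⟩ ⟨w, hw, h⟩
    rw [DiscEmb.comp_apply _ _ hz, DiscEmb.comp_apply _ _ hw] at h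
    by_cases hi : i = i'
    · subst hi
      have hl : l ≠ l' := fun h => hne (by rw [h])
      have h2 := (φ.emb i).injOn' (((ψ i).emb l').mapsTo' hw) (((ψ i).emb l).mapsTo' hz) h
      exact Set.disjoint_left.1 ((ψ i).disjoint' hl) ⟨z, hz, rfl⟩ ⟨w, hw, h2⟩
    · exact Set.disjoint_left.1 (φ.disjoint' hi) ⟨_, ((ψ i).emb l).mapsTo' hz, rfl⟩
        ⟨_, ((ψ i').emb l').mapsTo' hw, h⟩

end CE

/-- A `CE₂`-algebra structure on a vector space `A`: a morphism of operads (with unit, composition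
and symmetric group actions) from `CE₂` to the endomorphism operad of `A`. -/
structure CEAlgebra (A : Type*) [AddCommGroup A] [Module ℂ A] where
  /-- the products `A^{⊗n} → A` -/
  ρ : ∀ {n : ℕ}, CE n → MultilinearMap ℂ (fun _ : Fin n => A) A
  map_id : ∀ x : Fin 1 → A, ρ (CE.ofEmb DiscEmb.id) x = x 0
  map_comp : ∀ {n : ℕ} (φ : CE n) {k : Fin n → ℕ} (ψ : ∀ i, CE (k i)) (x : Fin (∑ i, k i) → A),
    ρ (φ.comp ψ) x = ρ φ fun i => ρ (ψ i) fun l => x (finSigmaFinEquiv ⟨i, l⟩)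
  map_perm : ∀ {n : ℕ} (φ : CE n) (σ : Equiv.Perm (Fin n)) (x : Fin n → A),
    ρ (φ.perm σ) (fun i => x (σ i)) = ρ φ x

/-! ### The factorization algebra of the Laplacian on the disc -/

/-- The image of `Δ^BV : P(C_c^∞(𝔻)₀) ⊗ C_c^∞(𝔻) → P(C_c^∞(𝔻)₀)`,
`f₁ ⋯ fₙ ⊗ h ↦ - f₁ ⋯ fₙ · Δ h + ∑ᵢ (∫ fᵢ h) f₁ ⋯ f̂ᵢ ⋯ fₙ`. -/
noncomputable def bvImage : Submodule ℂ (SymmetricAlgebra ℂ Test₀) :=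
  Submodule.span ℂ {y | ∃ (n : ℕ) (f : Fin n → Test₀) (h : Test),
    y = -((∏ i, SymmetricAlgebra.ι ℂ Test₀ (f i)) * SymmetricAlgebra.ι ℂ Test₀ (lap h)) +
      ∑ i, (∫ z, (f i).1 z * h z) • ∏ k with k ≠ i, SymmetricAlgebra.ι ℂ Test₀ (f k)}

/-- `F_CL(𝔻)₀ = P(C_c^∞(𝔻)₀) / Im Δ^BV`. -/
abbrev FCL₀ : Type := SymmetricAlgebra ℂ Test₀ ⧸ bvImage

/-- `P(H'(𝔻)₀)`. -/
abbrev PH₀ : Type := SymmetricAlgebra ℂ HarmDual₀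

/-- The normalization `𝒩 : P(H'(𝔻)₀) → P(H'(𝔻)₀)`, `T₁ ⋯ Tₙ ↦ (4π)^{n/2} iⁿ T₁ ⋯ Tₙ`. -/
noncomputable def normalization : PH₀ →ₐ[ℂ] PH₀ :=
  symMap (((Real.sqrt (4 * Real.pi) : ℂ) * Complex.I) • LinearMap.id)

/-- `Q` is the `CE₂`-algebra structure of `F_CL(𝔻)₀`:
`F_CL(φ₁,…,φₙ)([F₁],…,[Fₙ]) = [W_{φ₁}(F₁) ⋯ W_{φₙ}(Fₙ)]`. -/
def IsObservableAlgebra (Q : CEAlgebra FCL₀) : Prop :=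
  ∀ {n : ℕ} (φ : CE n) (F : Fin n → SymmetricAlgebra ℂ Test₀),
    Q.ρ φ (fun i => bvImage.mkQ (F i)) = bvImage.mkQ (∏ i, symMap (φ.emb i).push₀ (F i))

/-- `Ψ : F_CL(𝔻)₀ ≃ P(H'(𝔻)₀)` is the isomorphism induced by `exp(∂_G)` and by `f ↦ ∫ f ·`. -/
def IsGreenIso (Ψ : FCL₀ ≃ₗ[ℂ] PH₀) : Prop :=
  ∀ F : SymmetricAlgebra ℂ Test₀,
    Ψ (bvImage.mkQ F) = symMap toDist (expOp (contraction greenForm greenForm_symm) F)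

/-- `A` is the normalized structure `ρ^{NH} = 𝒩⁻¹ ∘ Ψ ∘ F_CL(-) ∘ (Ψ⁻¹ ∘ 𝒩)^{⊗n}`: the algebra
structure of `F_CL(𝔻)₀` transported along `Ψ` and then along `𝒩`. -/
def IsNormalizedTransport (Q : CEAlgebra FCL₀) (Ψ : FCL₀ ≃ₗ[ℂ] PH₀) (A : CEAlgebra PH₀) : Prop :=
  ∀ {n : ℕ} (φ : CE n) (y : Fin n → PH₀),
    normalization (A.ρ φ y) = Ψ (Q.ρ φ fun i => Ψ.symm (normalization (y i)))

/-! ### Expansion of harmonic distributions at the origin -/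

/-- `T = ∑ₙ aₙ ∂_z^{n+1} δ₀ / (n+1)! + bₙ ∂_z̄^{n+1} δ₀ / (n+1)!`. -/
def HasExpansion (T : HarmDual₀) (a b : ℕ → ℂ) : Prop :=
  ∀ u : Harm, HasSum (fun n : ℕ =>
    a n * ((n + 1).factorial : ℂ)⁻¹ * dzDelta n ⟨0, by simp [disc]⟩ u +
      b n * ((n + 1).factorial : ℂ)⁻¹ * dzbarDelta n ⟨0, by simp [disc]⟩ u) (T u)

open ComplexConjugate in
/-- The harmonic polynomial of degree `n + 1` that represents
`a ∂_z^{n+1} δ₀ / (n+1)! + b ∂_z̄^{n+1} δ₀ / (n+1)!`. -/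
noncomputable def harmPoly (n : ℕ) (a b z : ℂ) : ℂ :=
  (-1) ^ (n + 1) * (a * z ^ (n + 1) + b * conj z ^ (n + 1))

/-- `‖t_{n+1}‖_{L²(S¹)} < C ρ^{n+1}` for some `0 < ρ < 1` and `C > 0`, where `t_{n+1}` is the
degree `n + 1` term and `S¹` has total mass one. -/
def GrowthCondition (a b : ℕ → ℂ) : Prop :=
  ∃ r C : ℝ, 0 < r ∧ r < 1 ∧ 0 < C ∧ ∀ n : ℕ,
    Real.sqrt (Real.circleAverage (fun z => ‖harmPoly n (a n) (b n) z‖ ^ 2) 0 1) < C * r ^ (n + 1)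

end ConfDisk

open ConfDisk
open scoped Topology ComplexConjugate

namespace ConfDisk

/-! ### Wick calculus on symmetric algebras -/

section Wick

variable {M N : Type*} [AddCommMonoid M] [Module ℂ M] [AddCommMonoid N] [Module ℂ N]

local notation "ιS" => SymmetricAlgebra.ι ℂ

/-! The Green function inverts the Laplacian: the logarithmic potential of `Δh` is `h`, so `∂_G(f,
Δh) = ∫ f h`. Hence `exp(∂_G)` turns the operator `x ↦ -x·Δh + ∑ᵢ (∫ xᵢ h) x₁⋯x̂ᵢ⋯xₙ` into
multiplication by `-Δh` (`wick_bvOp`). The quotient by its image thus becomes the quotient of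
`P(C_c^∞(𝔻)₀)` by the ideal generated by the Laplacians, which is `P` of the cokernel of `Δ`
(`bvImage_eq_ker`).

That cokernel is `H'(𝔻)₀`. A harmonic function is the sum of a holomorphic and an antiholomorphic
one, so by Taylor expansion a harmonic distribution is determined by its values on `z^k` and `z̄^k`.
Cauchy estimates make these values decay geometrically, and conversely `χ(z) ∑ Aₙ z^{-(n+1)}`, with
a rotation invariant cutoff `χ` on an annulus near the unit circle, is a test function with
prescribed decaying moments (`exists_test_moments`). This gives surjectivity of `toDist` and the
growth condition. If all moments of `f` vanish, expanding `log |z - w|` in `w` shows that the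
potential of `f` vanishes outside a smaller disc, so `f` is the Laplacian of a test function
(`ker_toDist`).

An embedding `φ` changes the Green function by a multiple of `2 log |(φ(z) - φ(w)) / (z - w)|`,
which extends harmonically in each variable across the diagonal. The change of `∂_G` under `W_φ`
therefore depends only on the classes in `H'(𝔻)₀`; after multiplication by `-4π` it is `∂_φ`
(`confForm`). Additivity of Wick exponentials gives `exp(∂_G) W_φ = W_φ exp(∂_φ / (-4π)) exp(∂_G)`,
and the normalization, whose scalar has square `-4π`, removes the factor. The explicit formulas come
from evaluating a distribution on this harmonic function in one variable and then in the other. For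
two disjoint discs the Green function itself is harmonic in both variables, and the same computation
gives the product of two derivatives of delta functions. -/

/-- This induction grows an element one generator at a time, matching the recursions `D (f * x) = …`
that characterize the operators below. The usual induction would need `p` to be stable under
products; it is applied instead to the statement that multiplication by `a` preserves `p`. -/
theorem sym_induction {p : SymmetricAlgebra ℂ M → Prop} (one : p 1)
    (add : ∀ x y, p x → p y → p (x + y)) (smul : ∀ (c : ℂ) x, p x → p (c • x))
    (ι_mul : ∀ f x, p x → p (ιS M f * x)) (x : SymmetricAlgebra ℂ M) : p x := by
  have key : ∀ a x : SymmetricAlgebra ℂ M, p x → p (a * x) := by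
    intro a
    induction a using SymmetricAlgebra.induction with
    | algebraMap r => intro x hx; rw [← Algebra.smul_def]; exact smul r x hx
    | ι f => exact ι_mul f
    | mul a b ha hb => intro x hx; rw [mul_assoc]; exact ha _ (hb _ hx)
    | add a b ha hb => intro x hx; rw [add_mul]; exact add _ _ (ha x hx) (hb x hx)
  simpa using key x 1 one

theorem sym_linearMap_ext {D₁ D₂ : SymmetricAlgebra ℂ M →ₗ[ℂ] N} (one : D₁ 1 = D₂ 1)
    (ι_mul : ∀ f x, D₁ x = D₂ x → D₁ (ιS M f * x) = D₂ (ιS M f * x)) : D₁ = D₂ := by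
  ext x
  induction x using sym_induction with
  | one => exact one
  | add x y hx hy => rw [map_add, map_add, hx, hy]
  | smul c x hx => rw [map_smul, map_smul, hx]
  | ι_mul f x hx => exact ι_mul f x hx

/-- Links the formulas on products `f₁⋯fₙ`, by which the contraction and the relations of the
quotient are given, to the recursive ones. -/
theorem mem_span_prod_ι (x : SymmetricAlgebra ℂ M) :
    x ∈ Submodule.span ℂ {y | ∃ (n : ℕ) (f : Fin n → M), y = ∏ i, ιS M (f i)} := by
  induction x using sym_induction with
  | one => exact Submodule.subset_span ⟨0, Fin.elim0, by simp⟩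
  | add x y hx hy => exact Submodule.add_mem _ hx hy
  | smul c x hx => exact Submodule.smul_mem _ c hx
  | ι_mul f x hx =>
    induction hx using Submodule.span_induction with
    | mem y hy =>
      obtain ⟨n, g, rfl⟩ := hy
      exact Submodule.subset_span ⟨n + 1, Fin.cons f g, by simp [Fin.prod_univ_succ]⟩
    | zero => simp
    | add x y _ _ hx hy => rw [mul_add]; exact Submodule.add_mem _ hx hy
    | smul c x _ hx => rw [mul_smul_comm]; exact Submodule.smul_mem _ c hx

/-- The derivation of `P(M)` that extends the linear form `l`. -/
noncomputable def symDeriv (l : M →ₗ[ℂ] ℂ) : SymmetricAlgebra ℂ M →ₗ[ℂ] SymmetricAlgebra ℂ M :=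
  (exists_symDeriv l).choose

@[simp] theorem symDeriv_one (l : M →ₗ[ℂ] ℂ) : symDeriv l 1 = 0 := (exists_symDeriv l).choose_spec.1

theorem symDeriv_ι_mul (l : M →ₗ[ℂ] ℂ) (f : M) (x : SymmetricAlgebra ℂ M) :
    symDeriv l (ιS M f * x) = l f • x + ιS M f * symDeriv l x := (exists_symDeriv l).choose_spec.2 f x

theorem symDeriv_ι (l : M →ₗ[ℂ] ℂ) (f : M) :
    symDeriv l (ιS M f) = algebraMap ℂ _ (l f) := by
  simpa [Algebra.algebraMap_eq_smul_one] using symDeriv_ι_mul l f 1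

theorem symDeriv_mul (l : M →ₗ[ℂ] ℂ) (x y : SymmetricAlgebra ℂ M) :
    symDeriv l (x * y) = symDeriv l x * y + x * symDeriv l y := by
  induction x using sym_induction with
  | one => simp
  | add x x' hx hx' => simp only [add_mul, map_add, hx, hx']; ring
  | smul c x hx => simp only [smul_mul_assoc, map_smul, hx, smul_add]
  | ι_mul f x hx =>
    rw [mul_assoc, symDeriv_ι_mul, hx, symDeriv_ι_mul, add_mul, smul_mul_assoc]; ring

theorem symDeriv_add (l l' : M →ₗ[ℂ] ℂ) : symDeriv (l + l') = symDeriv l + symDeriv l' := by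
  refine sym_linearMap_ext (by simp) fun f x hx => ?_
  simp only [LinearMap.add_apply, symDeriv_ι_mul, add_smul] at hx ⊢
  rw [hx]; ring

theorem symDeriv_zero : symDeriv (0 : M →ₗ[ℂ] ℂ) = 0 := by
  refine sym_linearMap_ext (by simp) fun f x hx => ?_
  simp [symDeriv_ι_mul, hx]

theorem symDeriv_comm (l l' : M →ₗ[ℂ] ℂ) (x : SymmetricAlgebra ℂ M) :
    symDeriv l (symDeriv l' x) = symDeriv l' (symDeriv l x) := by
  induction x using sym_induction with
  | one => simp
  | add x y hx hy => simp only [map_add, hx, hy]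
  | smul c x hx => simp only [map_smul, hx]
  | ι_mul f x hx => simp only [symDeriv_ι_mul, map_add, map_smul, hx]; ring

theorem symDeriv_prod_ι (l : M →ₗ[ℂ] ℂ) (n : ℕ) (f : Fin n → M) :
    symDeriv l (∏ i, ιS M (f i)) = ∑ j, l (f j) • ∏ k with k ≠ j, ιS M (f k) := by
  induction n with
  | zero => simp
  | succ n ih =>
    rw [Fin.prod_univ_succ, symDeriv_ι_mul, ih, Fin.sum_univ_succ, Finset.mul_sum]
    simp only [Finset.prod_filter, Fin.prod_univ_succ]
    simp [Fin.succ_ne_zero, (Fin.succ_ne_zero _).symm]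

theorem symMap_ι (L : M →ₗ[ℂ] N) (f : M) : symMap L (ιS M f) = ιS N (L f) :=
  SymmetricAlgebra.lift_ι_apply _ f

theorem symDeriv_symMap (L : M →ₗ[ℂ] N) (l : N →ₗ[ℂ] ℂ) (x : SymmetricAlgebra ℂ M) :
    symDeriv l (symMap L x) = symMap L (symDeriv (l ∘ₗ L) x) := by
  induction x using sym_induction with
  | one => simp
  | add x y hx hy => simp only [map_add, hx, hy]
  | smul c x hx => simp only [map_smul, hx]
  | ι_mul f x hx => simp [symDeriv_ι_mul, symMap_ι, hx]

theorem symMap_comp {K : Type*} [AddCommMonoid K] [Module ℂ K] (L : M →ₗ[ℂ] N) (L' : N →ₗ[ℂ] K)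
    (x : SymmetricAlgebra ℂ M) : symMap L' (symMap L x) = symMap (L' ∘ₗ L) x := by
  have : (symMap L').comp (symMap L) = symMap (L' ∘ₗ L) := by
    apply SymmetricAlgebra.algHom_ext
    ext f
    simp [symMap_ι]
  exact congrArg (fun h => h x) this

theorem symMap_id (x : SymmetricAlgebra ℂ M) : symMap (LinearMap.id : M →ₗ[ℂ] M) x = x := by
  have : symMap (LinearMap.id : M →ₗ[ℂ] M) = AlgHom.id ℂ _ := by
    apply SymmetricAlgebra.algHom_ext
    ext f
    simp [symMap_ι]
  exact congrArg (fun h => h x) this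

/-! ### Contractions and their exponentials -/

section Contraction

variable (B : LinearMap.BilinForm ℂ M) (hB : ∀ f g, B f g = B g f)

theorem contraction_one : contraction B hB 1 = 0 := by
  simpa using contraction_prod B hB 0 Fin.elim0

/-- Splitting the pairs `i < j` according to whether `i` is the first factor yields the commutator
`[∂_B, f] = B(f, ·)` acting as a derivation. This relation and `∂_B 1 = 0` are all that is used
about the contraction from here on. -/
theorem contraction_ι_mul (f : M) (x : SymmetricAlgebra ℂ M) :
    contraction B hB (ιS M f * x) = ιS M f * contraction B hB x + symDeriv (B f) x := by
  induction mem_span_prod_ι x using Submodule.span_induction with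
  | mem y hy =>
    obtain ⟨n, g, rfl⟩ := hy
    have h := contraction_prod B hB (n + 1) (Fin.cons f g)
    rw [Fin.prod_univ_succ] at h
    simp only [Fin.cons_zero, Fin.cons_succ] at h
    rw [h, contraction_prod, symDeriv_prod_ι]
    simp only [Finset.sum_filter, Finset.prod_filter, Fintype.sum_prod_type, Fin.prod_univ_succ,
      Fin.sum_univ_succ, Finset.mul_sum]
    simp [Fin.succ_ne_zero, (Fin.succ_ne_zero _).symm]
    rw [add_comm]
  | zero => simp
  | add x y _ _ hx hy => simp only [mul_add, map_add, hx, hy]; ring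
  | smul c x _ hx => simp only [mul_smul_comm, map_smul, hx, smul_add]

theorem symDeriv_contraction (l : M →ₗ[ℂ] ℂ) (x : SymmetricAlgebra ℂ M) :
    symDeriv l (contraction B hB x) = contraction B hB (symDeriv l x) := by
  induction x using sym_induction with
  | one => simp [contraction_one]
  | add x y hx hy => simp only [map_add, hx, hy]
  | smul c x hx => simp only [map_smul, hx]
  | ι_mul f x hx =>
    simp only [contraction_ι_mul, symDeriv_ι_mul, map_add, map_smul, hx, symDeriv_comm l]; ring

theorem symDeriv_contraction_pow (l : M →ₗ[ℂ] ℂ) (k : ℕ) (x : SymmetricAlgebra ℂ M) :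
    symDeriv l ((contraction B hB ^ k) x) = (contraction B hB ^ k) (symDeriv l x) := by
  induction k generalizing x with
  | zero => simp
  | succ k ih => rw [pow_succ, Module.End.mul_apply, ih, symDeriv_contraction, Module.End.mul_apply]

/-- The commutator `[∂_B, f]` is a derivation that itself commutes with `∂_B`, so the Leibniz
expansion of `[∂_B^{k+1}, f]` consists of `k + 1` equal terms. -/
theorem contraction_pow_ι_mul (f : M) (k : ℕ) (x : SymmetricAlgebra ℂ M) :
    (contraction B hB ^ (k + 1)) (ιS M f * x) = ιS M f * (contraction B hB ^ (k + 1)) x +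
      ((k + 1 : ℕ) : ℂ) • symDeriv (B f) ((contraction B hB ^ k) x) := by
  induction k with
  | zero => simp [contraction_ι_mul]
  | succ k ih =>
    have h : ∀ (j : ℕ) y, contraction B hB ((contraction B hB ^ j) y) =
        (contraction B hB ^ (j + 1)) y := fun j y => by rw [pow_succ', Module.End.mul_apply]
    rw [← h, ih, map_add, contraction_ι_mul, map_smul, ← symDeriv_contraction, h, h,
      Nat.cast_succ (k + 1), add_smul, one_smul, add_comm (_ • _), add_assoc]

/-- Local nilpotence makes the `finsum` in `expOp` a genuine finite sum; without it the default
value of `finsum` could intervene. -/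
theorem exists_contraction_pow_eq_zero (x : SymmetricAlgebra ℂ M) :
    ∃ n, ∀ k ≥ n, (contraction B hB ^ k) x = 0 := by
  induction x using sym_induction with
  | one =>
    refine ⟨1, fun k hk => ?_⟩
    obtain ⟨k, rfl⟩ := Nat.exists_eq_add_of_le' hk
    rw [pow_succ, Module.End.mul_apply, contraction_one, map_zero]
  | add x y hx hy =>
    obtain ⟨n, hn⟩ := hx
    obtain ⟨m, hm⟩ := hy
    exact ⟨max n m, fun k hk => by
      rw [map_add, hn k (le_of_max_le_left hk), hm k (le_of_max_le_right hk), add_zero]⟩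
  | smul c x hx =>
    obtain ⟨n, hn⟩ := hx
    exact ⟨n, fun k hk => by rw [map_smul, hn k hk, smul_zero]⟩
  | ι_mul f x hx =>
    obtain ⟨n, hn⟩ := hx
    refine ⟨n + 1, fun k hk => ?_⟩
    obtain ⟨k, rfl⟩ := Nat.exists_eq_add_of_le' (Nat.one_le_of_lt hk)
    rw [contraction_pow_ι_mul, hn (k + 1) (by omega), hn k (by omega)]
    simp

theorem expOp_contraction_eq_sum {x : SymmetricAlgebra ℂ M} {n : ℕ}
    (hn : ∀ k ≥ n, (contraction B hB ^ k) x = 0) : expOp (contraction B hB) x =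
      ∑ k ∈ Finset.range n, ((k.factorial : ℂ)⁻¹) • (contraction B hB ^ k) x := by
  refine finsum_eq_sum_of_support_subset _ fun k hk => ?_
  by_contra h
  exact hk (by simp only [hn k (by simpa using h), smul_zero])

/-- `exp(∂_B)` as a linear map. -/
noncomputable def wick : SymmetricAlgebra ℂ M →ₗ[ℂ] SymmetricAlgebra ℂ M where
  toFun := expOp (contraction B hB)
  map_add' x y := by
    obtain ⟨n, hn⟩ := exists_contraction_pow_eq_zero B hB x
    obtain ⟨m, hm⟩ := exists_contraction_pow_eq_zero B hB y
    have h1 : ∀ k ≥ max n m, (contraction B hB ^ k) x = 0 := fun k hk => hn k (le_of_max_le_left hk)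
    have h2 : ∀ k ≥ max n m, (contraction B hB ^ k) y = 0 := fun k hk => hm k (le_of_max_le_right hk)
    rw [expOp_contraction_eq_sum B hB h1, expOp_contraction_eq_sum B hB h2,
      expOp_contraction_eq_sum B hB (n := max n m) fun k hk => by rw [map_add, h1 k hk, h2 k hk, add_zero],
      ← Finset.sum_add_distrib]
    simp
  map_smul' c x := by
    obtain ⟨n, hn⟩ := exists_contraction_pow_eq_zero B hB x
    rw [expOp_contraction_eq_sum B hB hn, expOp_contraction_eq_sum B hB (n := n) fun k hk => by
      rw [map_smul, hn k hk, smul_zero], RingHom.id_apply, Finset.smul_sum]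
    exact Finset.sum_congr rfl fun k _ => by rw [map_smul, smul_comm]

@[simp] theorem wick_one : wick B hB 1 = 1 := by
  change expOp _ _ = _
  rw [expOp_contraction_eq_sum B hB (n := 1)]
  · simp
  · intro k hk
    obtain ⟨k, rfl⟩ := Nat.exists_eq_add_of_le' hk
    rw [pow_succ, Module.End.mul_apply, contraction_one, map_zero]

theorem symDeriv_wick (l : M →ₗ[ℂ] ℂ) (x : SymmetricAlgebra ℂ M) :
    symDeriv l (wick B hB x) = wick B hB (symDeriv l x) := by
  obtain ⟨n, hn⟩ := exists_contraction_pow_eq_zero B hB x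
  change symDeriv l (expOp _ _) = expOp _ _
  rw [expOp_contraction_eq_sum B hB hn, expOp_contraction_eq_sum B hB (n := n) fun k hk => by
    rw [← symDeriv_contraction_pow, hn k hk, map_zero], map_sum]
  exact Finset.sum_congr rfl fun k _ => by rw [map_smul, symDeriv_contraction_pow]

/-- Exponentiating the commutator: `exp(∂_B) f = (f + B(f, ·)) exp(∂_B)`. With `wick_one` it
determines `exp(∂_B)`, so all identities between Wick exponentials follow by induction without
touching the series again. -/
theorem wick_ι_mul (f : M) (x : SymmetricAlgebra ℂ M) :
    wick B hB (ιS M f * x) = ιS M f * wick B hB x + symDeriv (B f) (wick B hB x) := by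
  obtain ⟨n, hn⟩ := exists_contraction_pow_eq_zero B hB x
  have h1 : ∀ k ≥ n + 1, (contraction B hB ^ k) x = 0 := fun k hk => hn k (by omega)
  have h2 : ∀ k ≥ n + 1, (contraction B hB ^ k) (ιS M f * x) = 0 := by
    intro k hk
    obtain ⟨k, rfl⟩ := Nat.exists_eq_add_of_le' (Nat.one_le_of_lt hk)
    rw [contraction_pow_ι_mul, hn (k + 1) (by omega), hn k (by omega)]
    simp
  have e1 : wick B hB (ιS M f * x) = _ := expOp_contraction_eq_sum B hB h2
  have e2 : wick B hB x = _ := expOp_contraction_eq_sum B hB h1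
  have e3 : wick B hB x = _ := expOp_contraction_eq_sum B hB hn
  rw [e1]
  -- The derivation term is written with `n` summands and the other one with `n + 1`, so that the
  -- terms match after the index shift caused by `∂_B^{k+1} f`.
  conv_rhs => rw [e2]
  conv_rhs => enter [2]; rw [← e2, e3]
  rw [Finset.sum_range_succ', Finset.sum_range_succ' _ n, mul_add, Finset.mul_sum, map_sum]
  simp only [contraction_pow_ι_mul, smul_add, Finset.sum_add_distrib, map_smul, mul_smul_comm]
  have e4 : ∀ k : ℕ, ((k + 1).factorial : ℂ)⁻¹ • ((k + 1 : ℕ) : ℂ) •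
      symDeriv (B f) ((contraction B hB ^ k) x) =
      (k.factorial : ℂ)⁻¹ • symDeriv (B f) ((contraction B hB ^ k) x) := by
    intro k
    rw [smul_smul]
    congr 1
    have : ((k + 1 : ℕ) : ℂ) ≠ 0 := Nat.cast_ne_zero.2 k.succ_ne_zero
    rw [Nat.factorial_succ]
    push_cast at this ⊢
    field_simp
  simp only [e4, pow_zero, Module.End.one_apply]
  abel

theorem wick_ι (f : M) : wick B hB (ιS M f) = ιS M f := by
  simpa using wick_ι_mul B hB f 1

end Contraction

/-- Multiplying by `f` produces the derivations `B f` and `B' f` one after the other; since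
derivations commute with Wick exponentials, they add up to the derivation of `(B + B') f`. -/
theorem wick_wick (B B' B'' : LinearMap.BilinForm ℂ M) (hB : ∀ f g, B f g = B g f)
    (hB' : ∀ f g, B' f g = B' g f) (hB'' : ∀ f g, B'' f g = B'' g f) (h : B + B' = B'')
    (x : SymmetricAlgebra ℂ M) : wick B hB (wick B' hB' x) = wick B'' hB'' x := by
  subst h
  induction x using sym_induction with
  | one => simp
  | add x y hx hy => simp only [map_add, hx, hy]
  | smul c x hx => simp only [map_smul, hx]
  | ι_mul f x hx =>
    rw [wick_ι_mul, map_add, wick_ι_mul, ← symDeriv_wick, hx, wick_ι_mul, LinearMap.add_apply,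
      symDeriv_add, LinearMap.add_apply, add_assoc]

theorem wick_zero (hB : ∀ f g, (0 : LinearMap.BilinForm ℂ M) f g = (0 : LinearMap.BilinForm ℂ M) g f)
    (x : SymmetricAlgebra ℂ M) : wick 0 hB x = x := by
  induction x using sym_induction with
  | one => simp
  | add x y hx hy => simp only [map_add, hx, hy]
  | smul c x hx => simp only [map_smul, hx]
  | ι_mul f x hx => rw [wick_ι_mul, hx, LinearMap.zero_apply, symDeriv_zero]; simp

/-- Naturality of the Wick exponential under pull-back of forms. It serves for `W_φ`, for the
passage to distributions and for the normalization. -/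
theorem wick_symMap (L : M →ₗ[ℂ] N) (B : LinearMap.BilinForm ℂ M) (hB : ∀ f g, B f g = B g f)
    (B' : LinearMap.BilinForm ℂ N) (hB' : ∀ f g, B' f g = B' g f) (h : ∀ f g, B' (L f) (L g) = B f g)
    (x : SymmetricAlgebra ℂ M) : wick B' hB' (symMap L x) = symMap L (wick B hB x) := by
  induction x using sym_induction with
  | one => simp
  | add x y hx hy => simp only [map_add, hx, hy]
  | smul c x hx => simp only [map_smul, hx]
  | ι_mul f x hx =>
    rw [map_mul, symMap_ι, wick_ι_mul, hx, wick_ι_mul, map_add, map_mul, symMap_ι, symDeriv_symMap]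
    congr 4
    ext g
    exact h f g

theorem wick_mul_ι (B : LinearMap.BilinForm ℂ M) (hB : ∀ f g, B f g = B g f) (f g : M) :
    wick B hB (ιS M f * ιS M g) = ιS M f * ιS M g + algebraMap ℂ _ (B f g) := by
  rw [wick_ι_mul, wick_ι, symDeriv_ι]

/-- The Wick exponential is invertible. -/
noncomputable def wickEquiv (B : LinearMap.BilinForm ℂ M) (hB : ∀ f g, B f g = B g f) :
    SymmetricAlgebra ℂ M ≃ₗ[ℂ] SymmetricAlgebra ℂ M :=
  have hB' : ∀ f g, (-B) f g = (-B) g f := fun f g => by simp [hB f g]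
  LinearEquiv.ofLinearMap (wick B hB) (wick (-B) hB')
    (LinearMap.ext fun x => by
      simp [wick_wick B (-B) 0 hB hB' (fun _ _ => rfl) (by simp), wick_zero])
    (LinearMap.ext fun x => by
      simp [wick_wick (-B) B 0 hB' hB (fun _ _ => rfl) (by simp), wick_zero])

theorem wickEquiv_apply (B : LinearMap.BilinForm ℂ M) (hB : ∀ f g, B f g = B g f)
    (x : SymmetricAlgebra ℂ M) : wickEquiv B hB x = wick B hB x := rfl

/-- Modulo the ideal generated by `ker L`, each generator `f` equals `s (L f)`, so every `x` is
congruent to `symMap s (symMap L x)`, which is zero when `symMap L x` is. -/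
theorem ker_symMap {M : Type*} [AddCommGroup M] [Module ℂ M] (L : M →ₗ[ℂ] N) (s : N →ₗ[ℂ] M)
    (hs : L ∘ₗ s = LinearMap.id) (x : SymmetricAlgebra ℂ M) (hx : symMap L x = 0) : x ∈ Submodule.span ℂ
      {y | ∃ (z : SymmetricAlgebra ℂ M) (f : M), L f = 0 ∧ y = z * ιS M f} := by
  set I := Submodule.span ℂ
      {y | ∃ (z : SymmetricAlgebra ℂ M) (f : M), L f = 0 ∧ y = z * ιS M f} with hI
  have hmul : ∀ a, ∀ y ∈ I, a * y ∈ I := by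
    intro a y hy
    induction hy using Submodule.span_induction with
    | mem y hy =>
      obtain ⟨z, f, hf, rfl⟩ := hy
      exact Submodule.subset_span ⟨a * z, f, hf, by ring⟩
    | zero => simp
    | add x y _ _ hx hy => rw [mul_add]; exact I.add_mem hx hy
    | smul c x _ hx => rw [mul_smul_comm]; exact I.smul_mem c hx
  have key : ∀ x, x - symMap s (symMap L x) ∈ I := by
    intro x
    induction x using sym_induction with
    | one => simp
    | add x y hx hy => simp only [map_add]; convert I.add_mem hx hy using 1; ring
    | smul c x hx => simp only [map_smul, ← smul_sub]; exact I.smul_mem c hx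
    | ι_mul f x hx =>
      have h0 : L (s (L f)) = L f := LinearMap.congr_fun hs (L f)
      have h1 : symMap s (symMap L x) * ιS M (f - s (L f)) ∈ I := Submodule.subset_span
        ⟨_, _, by
          -- `N` is only an additive monoid, so the cancellation takes place in `M`: `L f` is
          -- replaced by `L (s (L f))` and the two are joined under `L`.
          rw [sub_eq_add_neg, map_add]
          nth_rewrite 1 [← h0]
          rw [← map_add, add_neg_cancel, map_zero], rfl⟩
      convert I.add_mem h1 (hmul (ιS M f) _ hx) using 1
      simp only [map_mul, symMap_ι, map_sub]
      ring
  simpa [hx] using key x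

theorem symMap_surjective (L : M →ₗ[ℂ] N) (s : N →ₗ[ℂ] M) (hs : L ∘ₗ s = LinearMap.id) :
    Function.Surjective (symMap L) :=
  fun y => ⟨symMap s y, by rw [symMap_comp, hs, symMap_id]⟩

end Wick

/-! ### Descent and transport of multilinear structures -/

/-- The arguments are exchanged one at a time; each exchange alters the value by a term with an
entry in `S`. -/
theorem MultilinearMap.congr_of_sub_mem {ι : Type*} [Fintype ι] [DecidableEq ι] {V W : Type*}
    [AddCommGroup V] [Module ℂ V] [AddCommGroup W] [Module ℂ W] (m : MultilinearMap ℂ (fun _ : ι => V) W)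
    (S : Submodule ℂ V) (h : ∀ (i : ι) (x : ι → V) (y : V), y ∈ S → m (Function.update x i y) = 0)
    (x x' : ι → V) (hx : ∀ i, x i - x' i ∈ S) : m x = m x' := by
  have key : ∀ s : Finset ι, m (s.piecewise x x') = m x' := by
    intro s
    induction s using Finset.induction_on with
    | empty => simp
    | insert i s hi ih =>
      rw [← ih, Finset.piecewise_insert, ← sub_eq_zero]
      nth_rewrite 2 [← Function.update_eq_self i (s.piecewise x x')]
      rw [← MultilinearMap.map_update_sub]
      refine h _ _ _ ?_
      simpa [hi] using hx i
  simpa using key Finset.univ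

/-- Transport of a `CE₂`-algebra structure along a linear isomorphism. -/
noncomputable def CEAlgebra.transport {A A' : Type*} [AddCommGroup A] [Module ℂ A] [AddCommGroup A']
    [Module ℂ A'] (Q : CEAlgebra A) (e : A ≃ₗ[ℂ] A') : CEAlgebra A' where
  ρ φ := (e : A →ₗ[ℂ] A').compMultilinearMap ((Q.ρ φ).compLinearMap fun _ => (e.symm : A' →ₗ[ℂ] A))
  map_id x := by simp [Q.map_id]
  map_comp φ k ψ x := by simp [Q.map_comp]
  map_perm φ σ x := by
    simp only [LinearMap.compMultilinearMap_apply, MultilinearMap.compLinearMap_apply,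
      LinearEquiv.coe_coe]
    rw [← Q.map_perm φ σ]

end ConfDisk

namespace ConfDisk

open Set Metric MeasureTheory Filter

/-! ### Wirtinger calculus -/

theorem fderiv_real_apply {F : ℂ → ℂ} {z : ℂ} (hF : DifferentiableAt ℂ F z) (v : ℂ) :
    fderiv ℝ F z v = deriv F z * v := by
  rw [hF.fderiv_restrictScalars ℝ]
  simp [mul_comm]

theorem dz_of_differentiableAt {F : ℂ → ℂ} {z : ℂ} (hF : DifferentiableAt ℂ F z) :
    dz F z = deriv F z := by
  rw [dz, fderiv_real_apply hF, fderiv_real_apply hF]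
  linear_combination (-1 / 2 * deriv F z) * Complex.I_sq

theorem dzbar_of_differentiableAt {F : ℂ → ℂ} {z : ℂ} (hF : DifferentiableAt ℂ F z) :
    dzbar F z = 0 := by
  rw [dzbar, fderiv_real_apply hF, fderiv_real_apply hF]
  linear_combination (1 / 2 * deriv F z) * Complex.I_sq

theorem fderiv_conj_comp {u : ℂ → ℂ} {z : ℂ} (hu : DifferentiableAt ℝ u z) (v : ℂ) :
    fderiv ℝ (fun w => conj (u w)) z v = conj (fderiv ℝ u z v) := by
  have h := (Complex.conjCLE.toContinuousLinearMap.hasFDerivAt (x := u z)).comp z hu.hasFDerivAt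
  have h' : HasFDerivAt (fun w => conj (u w)) _ z := h
  rw [h'.fderiv]
  rfl

theorem dz_conj {u : ℂ → ℂ} {z : ℂ} (hu : DifferentiableAt ℝ u z) :
    dz (fun w => conj (u w)) z = conj (dzbar u z) := by
  simp [dz, dzbar, fderiv_conj_comp hu, sub_eq_add_neg, map_ofNat]

theorem dzbar_conj {u : ℂ → ℂ} {z : ℂ} (hu : DifferentiableAt ℝ u z) :
    dzbar (fun w => conj (u w)) z = conj (dz u z) := by
  simp [dz, dzbar, fderiv_conj_comp hu, sub_eq_add_neg, map_ofNat]

theorem dz_iter_congr {u v : ℂ → ℂ} {z : ℂ} (h : u =ᶠ[𝓝 z] v) (k : ℕ) :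
    dz^[k] u =ᶠ[𝓝 z] dz^[k] v := by
  rw [dz_eq_wirt]; exact wirt_iter_congr h k

theorem dzbar_iter_congr {u v : ℂ → ℂ} {z : ℂ} (h : u =ᶠ[𝓝 z] v) (k : ℕ) :
    dzbar^[k] u =ᶠ[𝓝 z] dzbar^[k] v := by
  rw [dzbar_eq_wirt]; exact wirt_iter_congr h k

theorem dz_iter_zero (k : ℕ) : dz^[k] (fun _ => 0) = fun _ => 0 := by
  induction k with
  | zero => rfl
  | succ k ih => rw [Function.iterate_succ_apply', ih]; funext z; simp [dz]

theorem dzbar_iter_zero (k : ℕ) : dzbar^[k] (fun _ => 0) = fun _ => 0 := by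
  induction k with
  | zero => rfl
  | succ k ih => rw [Function.iterate_succ_apply', ih]; funext z; simp [dzbar]

theorem eventually_differentiableAt {F : ℂ → ℂ} {z : ℂ} (hF : AnalyticAt ℂ F z) :
    ∀ᶠ w in 𝓝 z, DifferentiableAt ℂ F w :=
  hF.eventually_analyticAt.mono fun _ h => h.differentiableAt

theorem dz_iter_of_analyticAt {F : ℂ → ℂ} {z : ℂ} (hF : AnalyticAt ℂ F z) (k : ℕ) :
    dz^[k] F =ᶠ[𝓝 z] iteratedDeriv k F := by
  induction k with
  | zero => rw [iteratedDeriv_zero]; rfl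
  | succ k ih =>
    rw [Function.iterate_succ_apply', iteratedDeriv_succ]
    refine (dz_iter_congr ih 1).trans ?_
    filter_upwards [eventually_differentiableAt (hF.iterated_deriv k)] with w hw
    rw [← iteratedDeriv_eq_iterate] at hw
    exact dz_of_differentiableAt hw

theorem dzbar_iter_of_analyticAt {F : ℂ → ℂ} {z : ℂ} (hF : AnalyticAt ℂ F z) (k : ℕ) :
    dzbar^[k + 1] F =ᶠ[𝓝 z] fun _ => 0 := by
  have : dzbar F =ᶠ[𝓝 z] fun _ => 0 :=
    (eventually_differentiableAt hF).mono fun w => dzbar_of_differentiableAt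
  rw [Function.iterate_succ_apply]
  exact (dzbar_iter_congr this k).trans (by rw [dzbar_iter_zero])

theorem dz_iter_conj_of_analyticAt {F : ℂ → ℂ} {z : ℂ} (hF : AnalyticAt ℂ F z) (k : ℕ) :
    dz^[k + 1] (fun w => conj (F w)) =ᶠ[𝓝 z] fun _ => 0 := by
  have : dz (fun w => conj (F w)) =ᶠ[𝓝 z] fun _ => 0 := by
    filter_upwards [eventually_differentiableAt hF] with w hw
    rw [dz_conj (hw.restrictScalars ℝ), dzbar_of_differentiableAt hw, map_zero]
  rw [Function.iterate_succ_apply]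
  exact (dz_iter_congr this k).trans (by rw [dz_iter_zero])

theorem dzbar_iter_conj_of_analyticAt {F : ℂ → ℂ} {z : ℂ} (hF : AnalyticAt ℂ F z) (k : ℕ) :
    dzbar^[k] (fun w => conj (F w)) =ᶠ[𝓝 z] fun w => conj (iteratedDeriv k F w) := by
  induction k with
  | zero => rw [iteratedDeriv_zero]; rfl
  | succ k ih =>
    rw [Function.iterate_succ_apply', iteratedDeriv_succ]
    refine (dzbar_iter_congr ih 1).trans ?_
    filter_upwards [eventually_differentiableAt (hF.iterated_deriv k)] with w hw
    rw [← iteratedDeriv_eq_iterate] at hw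
    rw [Function.iterate_one, dzbar_conj (hw.restrictScalars ℝ), dz_of_differentiableAt hw]

/-! ### Holomorphic and antiholomorphic functions in `H(𝔻)` -/

theorem mem_disc {z : ℂ} : z ∈ disc ↔ ‖z‖ < 1 := mem_ball_zero_iff

theorem analyticAt_of_disc {F : ℂ → ℂ} (hF : DifferentiableOn ℂ F disc) {z : ℂ} (hz : z ∈ disc) :
    AnalyticAt ℂ F z := hF.analyticAt (disc.isOpen.mem_nhds hz)

theorem indicator_disc_eventuallyEq (F : ℂ → ℂ) {z : ℂ} (hz : z ∈ disc) :
    (disc : Set ℂ).indicator F =ᶠ[𝓝 z] F := by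
  filter_upwards [disc.isOpen.mem_nhds hz] with w hw
  exact indicator_of_mem hw _

/-- A function that is harmonic near every point of the disc, as an element of `H(𝔻)`. -/
noncomputable def Harm.mk' (u : ℂ → ℂ) (hu : InnerProductSpace.HarmonicOnNhd u disc) : Harm :=
  ⟨(disc : Set ℂ).indicator u, fun z hz => by
    rw [InnerProductSpace.harmonicAt_congr_nhds (indicator_disc_eventuallyEq u hz)]
    exact hu z hz, fun z hz => indicator_of_notMem hz _⟩

theorem Harm.mk'_apply (u : ℂ → ℂ) (hu : InnerProductSpace.HarmonicOnNhd u disc) {z : ℂ}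
    (hz : z ∈ disc) : (Harm.mk' u hu).1 z = u z := indicator_of_mem hz _

theorem Harm.mk'_eventuallyEq (u : ℂ → ℂ) (hu : InnerProductSpace.HarmonicOnNhd u disc) {z : ℂ}
    (hz : z ∈ disc) : (Harm.mk' u hu).1 =ᶠ[𝓝 z] u := indicator_disc_eventuallyEq u hz

theorem Harm.ext {u v : Harm} (h : ∀ z ∈ disc, u.1 z = v.1 z) : u = v := by
  ext z
  by_cases hz : z ∈ disc
  · exact h z hz
  · rw [u.2.2 z hz, v.2.2 z hz]

theorem harmonicOnNhd_of_differentiableOn {F : ℂ → ℂ} (hF : DifferentiableOn ℂ F disc) :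
    InnerProductSpace.HarmonicOnNhd F disc := fun _ hz => (analyticAt_of_disc hF hz).harmonicAt

theorem harmonicOnNhd_conj {F : ℂ → ℂ} (hF : DifferentiableOn ℂ F disc) :
    InnerProductSpace.HarmonicOnNhd (fun z => conj (F z)) disc :=
  fun _ hz => (analyticAt_of_disc hF hz).harmonicAt.comp_CLM Complex.conjCLE.toContinuousLinearMap

/-- A holomorphic function on the disc as an element of `H(𝔻)`. -/
noncomputable def Harm.hol (F : ℂ → ℂ) (hF : DifferentiableOn ℂ F disc) : Harm :=
  Harm.mk' F (harmonicOnNhd_of_differentiableOn hF)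

/-- The complex conjugate of a holomorphic function on the disc as an element of `H(𝔻)`. -/
noncomputable def Harm.anti (F : ℂ → ℂ) (hF : DifferentiableOn ℂ F disc) : Harm :=
  Harm.mk' (fun z => conj (F z)) (harmonicOnNhd_conj hF)

theorem Harm.exists_hol_add_anti (u : Harm) :
    ∃ (F G : ℂ → ℂ) (hF : DifferentiableOn ℂ F disc) (hG : DifferentiableOn ℂ G disc),
      u = Harm.hol F hF + Harm.anti G hG := by
  obtain ⟨A, hA, hA'⟩ := InnerProductSpace.HarmonicOnNhd.exists_analyticOnNhd_ball_re_eq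
    (z := 0) (R := 1) fun z hz => (harmonicAt_iff_re_im.1 (u.2.1 z hz)).1
  obtain ⟨B, hB, hB'⟩ := InnerProductSpace.HarmonicOnNhd.exists_analyticOnNhd_ball_re_eq
    (z := 0) (R := 1) fun z hz => (harmonicAt_iff_re_im.1 (u.2.1 z hz)).2
  have hAd : DifferentiableOn ℂ A disc := hA.differentiableOn
  have hBd : DifferentiableOn ℂ B disc := hB.differentiableOn
  -- If `Re u = Re A` and `Im u = Re B`, then `u = (A + Ā)/2 + i (B + B̄)/2`. The holomorphic part
  -- is `(A + iB)/2`, and the rest `(Ā + iB̄)/2` is the conjugate of `(A - iB)/2`.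
  refine ⟨fun z => (1 / 2) * (A z + Complex.I * B z), fun z => (1 / 2) * (A z - Complex.I * B z),
    (hAd.add (hBd.const_mul _)).const_mul _, (hAd.sub (hBd.const_mul _)).const_mul _, ?_⟩
  refine Harm.ext fun z hz => ?_
  change _ = (Harm.hol _ _).1 z + (Harm.anti _ _).1 z
  rw [Harm.hol, Harm.anti, Harm.mk'_apply _ _ hz, Harm.mk'_apply _ _ hz]
  have e1 : (u.1 z).re = (A z).re := (hA' hz).symm
  have e2 : (u.1 z).im = (B z).re := (hB' hz).symm
  rw [← Complex.re_add_im (u.1 z), e1, e2, Complex.re_eq_add_conj, Complex.re_eq_add_conj]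
  simp only [map_mul, map_sub, map_div₀, map_one, Complex.conj_I, map_ofNat]
  ring

theorem dzDelta_hol (n : ℕ) (a : disc) (F : ℂ → ℂ) (hF : DifferentiableOn ℂ F disc) :
    dzDelta n a (Harm.hol F hF) = (-1) ^ (n + 1) * iteratedDeriv (n + 1) F a := by
  change (-1) ^ (n + 1) * dz^[n + 1] (Harm.hol F hF).1 a = _
  rw [Harm.hol, (dz_iter_congr (Harm.mk'_eventuallyEq F _ a.2) (n + 1)).eq_of_nhds,
    (dz_iter_of_analyticAt (analyticAt_of_disc hF a.2) (n + 1)).eq_of_nhds]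

theorem dzDelta_anti (n : ℕ) (a : disc) (F : ℂ → ℂ) (hF : DifferentiableOn ℂ F disc) :
    dzDelta n a (Harm.anti F hF) = 0 := by
  change (-1) ^ (n + 1) * dz^[n + 1] (Harm.anti F hF).1 a = _
  rw [Harm.anti, (dz_iter_congr (Harm.mk'_eventuallyEq _ _ a.2) (n + 1)).eq_of_nhds,
    (dz_iter_conj_of_analyticAt (analyticAt_of_disc hF a.2) n).eq_of_nhds, mul_zero]

theorem dzbarDelta_hol (n : ℕ) (a : disc) (F : ℂ → ℂ) (hF : DifferentiableOn ℂ F disc) :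
    dzbarDelta n a (Harm.hol F hF) = 0 := by
  change (-1) ^ (n + 1) * dzbar^[n + 1] (Harm.hol F hF).1 a = _
  rw [Harm.hol, (dzbar_iter_congr (Harm.mk'_eventuallyEq F _ a.2) (n + 1)).eq_of_nhds,
    (dzbar_iter_of_analyticAt (analyticAt_of_disc hF a.2) n).eq_of_nhds, mul_zero]

theorem dzbarDelta_anti (n : ℕ) (a : disc) (F : ℂ → ℂ) (hF : DifferentiableOn ℂ F disc) :
    dzbarDelta n a (Harm.anti F hF) = (-1) ^ (n + 1) * conj (iteratedDeriv (n + 1) F a) := by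
  change (-1) ^ (n + 1) * dzbar^[n + 1] (Harm.anti F hF).1 a = _
  rw [Harm.anti, (dzbar_iter_congr (Harm.mk'_eventuallyEq _ _ a.2) (n + 1)).eq_of_nhds,
    (dzbar_iter_conj_of_analyticAt (analyticAt_of_disc hF a.2) (n + 1)).eq_of_nhds]

/-! ### Harmonic distributions have order zero -/

theorem exists_subset_closedBall {K : Set ℂ} (hK : IsCompact K) (hKd : K ⊆ disc) :
    ∃ R, 0 < R ∧ R < 1 ∧ K ⊆ closedBall 0 R := by
  obtain ⟨r, hr, h⟩ := exists_lt_subset_ball hK.isClosed (show K ⊆ ball 0 1 from hKd)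
  exact ⟨max r (1 / 2), by positivity, max_lt hr (by norm_num),
    h.trans (ball_subset_closedBall.trans (closedBall_subset_closedBall (le_max_left _ _)))⟩

theorem closedBall_subset_disc {R : ℝ} (hR : R < 1) : closedBall (0 : ℂ) R ⊆ disc :=
  closedBall_subset_ball hR

/-- Cauchy estimates on a slightly larger disc absorb all derivatives in the continuity seminorm, so
a sup norm suffices on holomorphic and antiholomorphic functions. -/
theorem HarmDual₀.exists_bound (T : HarmDual₀) : ∃ R C : ℝ, 0 < R ∧ R < 1 ∧ 0 ≤ C ∧
    ∀ (F : ℂ → ℂ) (hF : DifferentiableOn ℂ F disc) (b : ℝ), (∀ z ∈ closedBall 0 R, ‖F z‖ ≤ b) →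
      ‖T (Harm.hol F hF)‖ ≤ C * b ∧ ‖T (Harm.anti F hF)‖ ≤ C * b := by
  obtain ⟨K, hK, hKd, m, C, hC, h⟩ := T.1.2
  obtain ⟨R₀, hR₀, hR₀', hKR⟩ := exists_subset_closedBall hK hKd
  -- `R` is halfway between `R₀` and `1`, so that discs of radius `δ = R - R₀` around points of `K`
  -- remain in the closed disc of radius `R`.
  set R := (R₀ + 1) / 2 with hR
  set δ := R - R₀ with hδ
  have hδ0 : 0 < δ := by rw [hδ, hR]; linarith
  set E : ℝ := ∑ k ∈ Finset.range (m + 1), k.factorial / δ ^ k with hE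
  have hE0 : 0 ≤ E := Finset.sum_nonneg fun k _ => by positivity
  refine ⟨R, C * E, by positivity, by rw [hR]; linarith, by positivity, fun F hF b hb => ?_⟩
  have hb0 : 0 ≤ b := (norm_nonneg _).trans (hb 0 (by simp; positivity))
  have key : ∀ k ≤ m, ∀ z ∈ K, ‖iteratedFDeriv ℝ k F z‖ ≤ E * b := by
    intro k hk z hz
    have hzd := hKd hz
    have hsub : closedBall z δ ⊆ closedBall 0 R := by
      apply closedBall_subset_closedBall'
      have := hKR hz
      rw [mem_closedBall] at this
      rw [hδ]; linarith
    have hRd : closedBall z δ ⊆ disc := hsub.trans (closedBall_subset_disc (by rw [hR]; linarith))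
    rw [← (analyticAt_of_disc hF hzd).contDiffAt.restrictScalars_iteratedFDeriv, Function.comp_apply,
      ContinuousMultilinearMap.norm_restrictScalars, norm_iteratedFDeriv_eq_norm_iteratedDeriv]
    have h1 := Complex.norm_iteratedDeriv_le_of_forall_mem_sphere_norm_le (c := z) (R := δ)
      (C := b) (f := F) k hδ0 ((hF.mono hRd).diffContOnCl_ball subset_rfl)
      (fun w hw => hb w (hsub (sphere_subset_closedBall hw)))
    refine h1.trans ?_
    rw [mul_div_right_comm]
    gcongr
    exact Finset.single_le_sum (f := fun k : ℕ => (k.factorial : ℝ) / δ ^ k)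
      (fun k _ => by positivity) (Finset.mem_range.2 (by omega))
  constructor
  · rw [mul_assoc]
    refine h _ _ (by positivity) fun k hk z hz => ?_
    rw [Harm.hol, ((Harm.mk'_eventuallyEq F _ (hKd hz)).iteratedFDeriv ℝ k).eq_of_nhds]
    exact key k hk z hz
  · rw [mul_assoc]
    refine h _ _ (by positivity) fun k hk z hz => ?_
    rw [Harm.anti, ((Harm.mk'_eventuallyEq _ _ (hKd hz)).iteratedFDeriv ℝ k).eq_of_nhds]
    have := Complex.conjLIE.norm_iteratedFDeriv_comp_left F z k
    exact this.trans_le (key k hk z hz)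

/-- The monomial `z ↦ z ^ k`. -/
noncomputable def Harm.mono (k : ℕ) : Harm := Harm.hol (fun z => z ^ k) (by fun_prop)

/-- The monomial `z ↦ conj z ^ k`. -/
noncomputable def Harm.antimono (k : ℕ) : Harm := Harm.anti (fun z => z ^ k) (by fun_prop)

/-- Cauchy estimates on a circle of radius `s` strictly between `R` and `1` dominate the Taylor
series by a geometric series of ratio `R / s`. Convergence along finite sets, rather than initial
segments, makes the resulting sums unconditional. -/
theorem taylor_tendstoUniformlyOn {F : ℂ → ℂ} (hF : DifferentiableOn ℂ F disc) {R : ℝ} (hR0 : 0 < R)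
    (hR : R < 1) : TendstoUniformlyOn
      (fun (t : Finset ℕ) z => ∑ k ∈ t, ((k.factorial : ℂ)⁻¹ * iteratedDeriv k F 0) * z ^ k) F atTop
      (closedBall 0 R) := by
  set s := (R + 1) / 2 with hs
  have hs0 : 0 < s := by positivity
  have hs1 : s < 1 := by rw [hs]; linarith
  obtain ⟨M, hM⟩ := (isCompact_closedBall (0 : ℂ) s).exists_bound_of_continuousOn
    (hF.continuousOn.mono (closedBall_subset_disc hs1))
  have hc : ∀ k : ℕ, ‖(k.factorial : ℂ)⁻¹ * iteratedDeriv k F 0‖ ≤ M / s ^ k := by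
    intro k
    have h1 := Complex.norm_iteratedDeriv_le_of_forall_mem_sphere_norm_le (c := 0) (R := s)
      (C := M) (f := F) k hs0 ((hF.mono (closedBall_subset_disc hs1)).diffContOnCl_ball subset_rfl)
      (fun w hw => hM w (sphere_subset_closedBall hw))
    rw [norm_mul, norm_inv, Complex.norm_natCast]
    have : (0 : ℝ) < k.factorial := by positivity
    rw [inv_mul_le_iff₀ this]
    refine h1.trans (le_of_eq ?_)
    ring
  have hsum : Summable fun k : ℕ => M * (R / s) ^ k :=
    (summable_geometric_of_lt_one (by positivity) (by rw [div_lt_one hs0, hs]; linarith)).mul_left M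
  have h := tendstoUniformlyOn_tsum (f := fun (k : ℕ) (z : ℂ) =>
    ((k.factorial : ℂ)⁻¹ * iteratedDeriv k F 0) * z ^ k) (s := closedBall 0 R) hsum (by
      intro k z hz
      rw [norm_mul, norm_pow, div_pow]
      have : ‖z‖ ≤ R := mem_closedBall_zero_iff.1 hz
      calc _ ≤ M / s ^ k * R ^ k := mul_le_mul (hc k) (by gcongr) (by positivity)
            ((norm_nonneg _).trans (hc k))
        _ = _ := by ring)
  refine h.congr_right fun z hz => ?_
  have := Complex.hasSum_taylorSeries_on_ball (c := 0) (r := 1) (f := F) hF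
    (closedBall_subset_disc hR hz)
  rw [← this.tsum_eq]
  refine tsum_congr fun k => ?_
  simp only [sub_zero, smul_eq_mul]; ring

theorem Harm.hol_sub_sum (F : ℂ → ℂ) (hF : DifferentiableOn ℂ F disc) (c : ℕ → ℂ) (t : Finset ℕ) :
    Harm.hol (fun z => F z - ∑ k ∈ t, c k * z ^ k) (hF.sub (by fun_prop)) =
      Harm.hol F hF - ∑ k ∈ t, c k • Harm.mono k := by
  refine Harm.ext fun z hz => ?_
  rw [Harm.hol, Harm.mk'_apply _ _ hz, AddSubgroupClass.coe_sub, Pi.sub_apply,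
    AddSubmonoidClass.coe_finsetSum, Finset.sum_apply]
  simp only [Submodule.coe_smul, Pi.smul_apply, Harm.hol, Harm.mono, Harm.mk'_apply _ _ hz,
    smul_eq_mul]

theorem Harm.anti_sub_sum (F : ℂ → ℂ) (hF : DifferentiableOn ℂ F disc) (c : ℕ → ℂ) (t : Finset ℕ) :
    Harm.anti (fun z => F z - ∑ k ∈ t, c k * z ^ k) (hF.sub (by fun_prop)) =
      Harm.anti F hF - ∑ k ∈ t, conj (c k) • Harm.antimono k := by
  refine Harm.ext fun z hz => ?_
  rw [Harm.anti, Harm.mk'_apply _ _ hz, AddSubgroupClass.coe_sub, Pi.sub_apply,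
    AddSubmonoidClass.coe_finsetSum, Finset.sum_apply]
  simp only [Submodule.coe_smul, Pi.smul_apply, Harm.anti, Harm.antimono, Harm.mk'_apply _ _ hz,
    smul_eq_mul, map_sub, map_sum, map_mul]

theorem hasSum_of_norm_sub_le {c : ℕ → ℂ} {a : ℂ} {C : ℝ} (hC : 0 ≤ C)
    (h : ∀ ε > 0, ∀ᶠ t : Finset ℕ in atTop, ‖a - ∑ k ∈ t, c k‖ ≤ C * ε) : HasSum c a := by
  rw [HasSum, SummationFilter.unconditional_filter, Metric.tendsto_nhds]
  intro ε hε
  -- The division by `C + 1` allows for `C = 0`.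
  filter_upwards [h (ε / (C + 1)) (by positivity)] with t ht
  rw [dist_comm, dist_eq_norm]
  refine ht.trans_lt ?_
  rw [mul_div_assoc', div_lt_iff₀ (by positivity)]
  nlinarith

theorem HarmDual₀.hasSum_hol (T : HarmDual₀) (F : ℂ → ℂ) (hF : DifferentiableOn ℂ F disc) :
    HasSum (fun k : ℕ => ((k.factorial : ℂ)⁻¹ * iteratedDeriv k F 0) * T (Harm.mono k))
      (T (Harm.hol F hF)) := by
  obtain ⟨R, C, hR0, hR1, hC, h⟩ := HarmDual₀.exists_bound T
  refine hasSum_of_norm_sub_le hC fun ε hε => ?_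
  filter_upwards [Metric.tendstoUniformlyOn_iff.1 (taylor_tendstoUniformlyOn hF hR0 hR1) ε hε]
    with t ht
  have h1 := (h (fun z => F z - ∑ k ∈ t, ((k.factorial : ℂ)⁻¹ * iteratedDeriv k F 0) * z ^ k)
    (hF.sub (by fun_prop)) ε fun z hz => by rw [← dist_eq_norm]; exact (ht z hz).le).1
  rw [Harm.hol_sub_sum, map_sub, map_sum] at h1
  simpa only [map_smul, smul_eq_mul] using h1

theorem HarmDual₀.hasSum_anti (T : HarmDual₀) (F : ℂ → ℂ) (hF : DifferentiableOn ℂ F disc) :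
    HasSum (fun k : ℕ => conj ((k.factorial : ℂ)⁻¹ * iteratedDeriv k F 0) * T (Harm.antimono k))
      (T (Harm.anti F hF)) := by
  obtain ⟨R, C, hR0, hR1, hC, h⟩ := HarmDual₀.exists_bound T
  refine hasSum_of_norm_sub_le hC fun ε hε => ?_
  filter_upwards [Metric.tendstoUniformlyOn_iff.1 (taylor_tendstoUniformlyOn hF hR0 hR1) ε hε]
    with t ht
  have h1 := (h (fun z => F z - ∑ k ∈ t, ((k.factorial : ℂ)⁻¹ * iteratedDeriv k F 0) * z ^ k)
    (hF.sub (by fun_prop)) ε fun z hz => by rw [← dist_eq_norm]; exact (ht z hz).le).2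
  rw [Harm.anti_sub_sum, map_sub, map_sum] at h1
  simpa only [map_smul, smul_eq_mul] using h1

theorem Harm.mono_zero : Harm.mono 0 = Harm.one := by
  refine Harm.ext fun z hz => ?_
  rw [Harm.mono, Harm.hol, Harm.mk'_apply _ _ hz, pow_zero]
  exact (indicator_of_mem hz (fun _ => (1 : ℂ))).symm

theorem Harm.antimono_zero : Harm.antimono 0 = Harm.one := by
  refine Harm.ext fun z hz => ?_
  rw [Harm.antimono, Harm.anti, Harm.mk'_apply _ _ hz, pow_zero, map_one]
  exact (indicator_of_mem hz (fun _ => (1 : ℂ))).symm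

theorem HarmDual₀.apply_one (T : HarmDual₀) : T Harm.one = 0 := T.2

/-- A harmonic distribution is determined by its values on the monomials. -/
theorem HarmDual₀.ext_mono {S T : HarmDual₀} (h1 : ∀ k, S (Harm.mono (k + 1)) = T (Harm.mono (k + 1)))
    (h2 : ∀ k, S (Harm.antimono (k + 1)) = T (Harm.antimono (k + 1))) : S = T := by
  have h1' : ∀ k, S (Harm.mono k) = T (Harm.mono k) := by
    rintro (_ | k)
    · rw [Harm.mono_zero, HarmDual₀.apply_one S, HarmDual₀.apply_one T]
    · exact h1 k
  have h2' : ∀ k, S (Harm.antimono k) = T (Harm.antimono k) := by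
    rintro (_ | k)
    · rw [Harm.antimono_zero, HarmDual₀.apply_one S, HarmDual₀.apply_one T]
    · exact h2 k
  ext u
  obtain ⟨F, G, hF, hG, rfl⟩ := Harm.exists_hol_add_anti u
  rw [map_add, map_add]
  congr 1
  · refine (HarmDual₀.hasSum_hol S F hF).unique ?_
    simpa only [h1'] using HarmDual₀.hasSum_hol T F hF
  · refine (HarmDual₀.hasSum_anti S G hG).unique ?_
    simpa only [h2'] using HarmDual₀.hasSum_anti T G hG

theorem iteratedDeriv_monomial_zero (n k : ℕ) :
    iteratedDeriv n (fun z : ℂ => z ^ k) 0 = if n = k then (n.factorial : ℂ) else 0 := by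
  rw [iteratedDeriv_fun_pow_zero]
  push_cast
  exact ite_congr rfl (fun h => by rw [h]) fun _ => rfl

/-- On a monomial all but one term of the expansion vanish, so the coefficients are the moments up
to sign. Conversely the expansion at `u` is the Taylor series of `u` evaluated termwise by `T`. -/
theorem hasExpansion_iff (T : HarmDual₀) (a b : ℕ → ℂ) : HasExpansion T a b ↔
    ∀ n, T (Harm.mono (n + 1)) = (-1) ^ (n + 1) * a n ∧
      T (Harm.antimono (n + 1)) = (-1) ^ (n + 1) * b n := by
  have hfac : ∀ n : ℕ, (n.factorial : ℂ) ≠ 0 := fun n => Nat.cast_ne_zero.2 n.factorial_ne_zero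
  constructor
  · intro h n
    constructor
    · have h1 := h (Harm.mono (n + 1))
      simp only [Harm.mono, dzDelta_hol, dzbarDelta_hol, iteratedDeriv_monomial_zero] at h1
      refine h1.unique ?_
      convert hasSum_single n fun m hm => ?_ using 1
      · simp only [if_true]; field_simp [hfac (n + 1)]; ring
      · rw [if_neg (by omega)]; ring
    · have h1 := h (Harm.antimono (n + 1))
      simp only [Harm.antimono, dzDelta_anti, dzbarDelta_anti, iteratedDeriv_monomial_zero] at h1
      refine h1.unique ?_
      convert hasSum_single n fun m hm => ?_ using 1
      · simp only [if_true, map_natCast]; field_simp [hfac (n + 1)]; ring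
      · rw [if_neg (by omega)]; simp
  · intro h u
    obtain ⟨F, G, hF, hG, rfl⟩ := Harm.exists_hol_add_anti u
    -- The terms of degree zero drop out because `T` kills constants, which is why the expansion
    -- starts at degree one.
    have h1 := (hasSum_nat_add_iff' 1).2 (HarmDual₀.hasSum_hol T F hF)
    have h2 := (hasSum_nat_add_iff' 1).2 (HarmDual₀.hasSum_anti T G hG)
    simp only [Finset.range_one, Finset.sum_singleton, Harm.mono_zero, Harm.antimono_zero,
      HarmDual₀.apply_one T, mul_zero, sub_zero] at h1 h2
    rw [map_add]
    refine (h1.add h2).congr_fun fun n => ?_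
    rw [map_add, map_add, dzDelta_hol, dzDelta_anti, dzbarDelta_hol, dzbarDelta_anti, (h n).1, (h n).2]
    simp only [map_mul, map_inv₀, map_natCast]
    ring

end ConfDisk

namespace ConfDisk

open Set Metric MeasureTheory Filter

/-! ### The growth condition -/

/-- Since `z̄ = z⁻¹` on the unit circle, the squared modulus coincides there with the real part of
the polynomial `g`; its mean is the value at the centre, where the cross term vanishes. -/
theorem circleAverage_harmPoly (n : ℕ) (a b : ℂ) :
    Real.circleAverage (fun z => ‖harmPoly n a b z‖ ^ 2) 0 1 = ‖a‖ ^ 2 + ‖b‖ ^ 2 := by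
  set g : ℂ → ℂ := fun z => (‖a‖ ^ 2 + ‖b‖ ^ 2 : ℝ) + 2 * (a * conj b) * z ^ (2 * (n + 1)) with hg
  have hga : ∀ z, AnalyticAt ℂ g z := fun z => by
    rw [hg]; fun_prop
  have h1 : Real.circleAverage (fun z => ‖harmPoly n a b z‖ ^ 2) 0 1 =
      Real.circleAverage (fun z => (g z).re) 0 1 := by
    refine Real.circleAverage_congr_sphere fun z hz => ?_
    have hz1 : ‖z‖ = 1 := by simpa using hz
    have hzz : z * conj z = 1 := by rw [Complex.mul_conj, Complex.normSq_eq_norm_sq, hz1]; simp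
    have h2 : (‖harmPoly n a b z‖ ^ 2 : ℝ) = (((harmPoly n a b z) * conj (harmPoly n a b z)).re) := by
      rw [Complex.mul_conj, Complex.normSq_eq_norm_sq, Complex.ofReal_re]
    have h3 : (harmPoly n a b z) * conj (harmPoly n a b z) = a * conj a + b * conj b +
        (a * conj b * z ^ (2 * (n + 1)) + conj (a * conj b * z ^ (2 * (n + 1)))) := by
      have h4 : (z * conj z) ^ (n + 1) = 1 := by rw [hzz, one_pow]
      have h5 : ((-1 : ℂ) ^ (n + 1)) ^ 2 = 1 := by rw [← pow_mul, mul_comm, pow_mul]; simp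
      simp only [harmPoly, map_mul, map_add, map_pow, map_neg, map_one, Complex.conj_conj]
      rw [mul_pow] at h4
      linear_combination (a * z ^ (n + 1) + b * conj z ^ (n + 1)) * (conj a * conj z ^ (n + 1) +
        conj b * z ^ (n + 1)) * h5 + (a * conj a + b * conj b) * h4
    simp only [h2, h3, hg, Complex.mul_conj, Complex.normSq_eq_norm_sq, Complex.add_re,
      Complex.ofReal_re, Complex.conj_re]
    rw [mul_assoc 2, show (2 : ℂ) = ((2 : ℝ) : ℂ) by simp, Complex.re_ofReal_mul]
    ring
  have h2 : InnerProductSpace.HarmonicOnNhd (fun z => (g z).re) (closedBall 0 |1|) :=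
    fun z _ => (hga z).harmonicAt_re
  rw [h1, InnerProductSpace.HarmonicOnNhd.circleAverage_eq h2]
  simp [hg, -Complex.ofReal_add]

theorem growthCondition_iff (a b : ℕ → ℂ) : GrowthCondition a b ↔ ∃ r C : ℝ, 0 < r ∧ r < 1 ∧ 0 < C ∧
    ∀ n : ℕ, ‖a n‖ ≤ C * r ^ (n + 1) ∧ ‖b n‖ ≤ C * r ^ (n + 1) := by
  simp only [GrowthCondition, circleAverage_harmPoly]
  constructor
  · rintro ⟨r, C, hr, hr1, hC, h⟩
    refine ⟨r, C, hr, hr1, hC, fun n => ⟨?_, ?_⟩⟩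
    · exact (Real.le_sqrt_of_sq_le (by nlinarith [sq_nonneg ‖b n‖])).trans (h n).le
    · exact (Real.le_sqrt_of_sq_le (by nlinarith [sq_nonneg ‖a n‖])).trans (h n).le
  · rintro ⟨r, C, hr, hr1, hC, h⟩
    -- The two bounds together give `√2 C r^{n+1}`; the larger constant `3` makes the inequality
    -- strict.
    refine ⟨r, 3 * C, hr, hr1, by positivity, fun n => ?_⟩
    have hp : 0 < C * r ^ (n + 1) := by positivity
    rw [Real.sqrt_lt' (by positivity)]
    obtain ⟨h1, h2⟩ := h n
    have h3 := pow_le_pow_left₀ (norm_nonneg _) h1 2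
    have h4 := pow_le_pow_left₀ (norm_nonneg _) h2 2
    nlinarith [sq_pos_of_pos hp]

theorem HarmDual₀.growth (T : HarmDual₀) (a b : ℕ → ℂ) (h : HasExpansion T a b) :
    GrowthCondition a b := by
  rw [growthCondition_iff]
  rw [hasExpansion_iff] at h
  obtain ⟨R, C, hR0, hR1, hC, hT⟩ := HarmDual₀.exists_bound T
  -- The constant from the continuity bound may be zero, whereas a positive one is required.
  refine ⟨R, C + 1, hR0, hR1, by positivity, fun n => ?_⟩
  obtain ⟨h1, h2⟩ := hT (fun z => z ^ (n + 1)) (by fun_prop) (R ^ (n + 1)) fun z hz => by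
    rw [norm_pow]
    gcongr
    simpa using hz
  have h3 : C * R ^ (n + 1) ≤ (C + 1) * R ^ (n + 1) := by gcongr; linarith
  constructor
  · have := (h n).1
    rw [Harm.mono] at this
    rw [this] at h1
    simp only [norm_mul, norm_pow, norm_neg, norm_one, one_pow, one_mul] at h1
    exact h1.trans h3
  · have := (h n).2
    rw [Harm.antimono] at this
    rw [this] at h2
    simp only [norm_mul, norm_pow, norm_neg, norm_one, one_pow, one_mul] at h2
    exact h2.trans h3

/-! ### Test functions with prescribed harmonic moments -/

/-- A smooth function with compact support in the disc, as a test function. -/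
def Test.mk' (f : ℂ → ℂ) (hf : ContDiff ℝ ∞ f) (K : Set ℂ) (hK : IsCompact K) (hKd : K ⊆ disc)
    (h : ∀ z ∉ K, f z = 0) : Test where
  toFun := f
  contDiff' := hf
  hasCompactSupport' := HasCompactSupport.intro hK h
  tsupport_subset' := (closure_minimal (fun x hx => by
    by_contra h'
    exact hx (h x h')) hK.isClosed).trans hKd

@[simp] theorem Test.mk'_apply (f : ℂ → ℂ) (hf : ContDiff ℝ ∞ f) (K : Set ℂ) (hK : IsCompact K)
    (hKd : K ⊆ disc) (h : ∀ z ∉ K, f z = 0) (z : ℂ) : Test.mk' f hf K hK hKd h z = f z := rfl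

/-- A bump function of `‖z‖²` is rotation invariant and smooth also at the origin, where `‖z‖` is
not. -/
theorem exists_radial_bump {ρ : ℝ} (hρ0 : 0 < ρ) (hρ : ρ < 1) : ∃ (χ : Test) (R : ℝ), R < 1 ∧
    (∀ ξ z : ℂ, ‖ξ‖ = 1 → χ (ξ * z) = χ z) ∧ (∀ z, χ z ≠ 0 → ρ < ‖z‖ ∧ ‖z‖ ≤ R) ∧
    (∀ z ∈ tsupport χ, ρ < ‖z‖) ∧ ∫ z, χ z = 1 := by
  have hρ2 : ρ ^ 2 < 1 := by nlinarith
  -- The centre is the midpoint of `(ρ², 1)` and the outer radius is half of what fits, so `‖z‖²`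
  -- stays away from both `ρ²` and `1` on the support.
  let η : ContDiffBump ((ρ ^ 2 + 1) / 2 : ℝ) := ⟨(1 - ρ ^ 2) / 8, (1 - ρ ^ 2) / 4, by linarith, by linarith⟩
  set R := Real.sqrt ((ρ ^ 2 + 1) / 2 + (1 - ρ ^ 2) / 4) with hR
  have hR1 : R < 1 := by rw [hR, Real.sqrt_lt' one_pos]; linarith
  set K : Set ℂ := {z | |‖z‖ ^ 2 - (ρ ^ 2 + 1) / 2| ≤ (1 - ρ ^ 2) / 4} with hKdef
  have hKR : ∀ z ∈ K, ρ < ‖z‖ ∧ ‖z‖ ≤ R := by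
    intro z hz
    have := abs_le.1 (show |‖z‖ ^ 2 - (ρ ^ 2 + 1) / 2| ≤ (1 - ρ ^ 2) / 4 from hz)
    exact ⟨lt_of_pow_lt_pow_left₀ 2 (norm_nonneg _) (by linarith),
      Real.le_sqrt_of_sq_le (by linarith)⟩
  have hKc : IsClosed K := isClosed_le (by fun_prop) continuous_const
  have hK : IsCompact K := (isCompact_closedBall (0 : ℂ) R).of_isClosed_subset hKc fun z hz =>
    mem_closedBall_zero_iff.2 (hKR z hz).2
  have hKd : K ⊆ disc := fun z hz => mem_disc.2 ((hKR z hz).2.trans_lt hR1)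
  set f : ℂ → ℝ := fun z => η (‖z‖ ^ 2) with hf
  have hfs : ContDiff ℝ ∞ f := η.contDiff.comp (contDiff_norm_sq ℝ)
  have hf0 : ∀ z ∉ K, f z = 0 := fun z hz => η.zero_of_le_dist (by
    rw [Real.dist_eq]; exact (not_le.1 hz).le)
  have hpos : 0 < ∫ z, f z := by
    refine hfs.continuous.integral_pos_of_hasCompactSupport_nonneg_nonzero
      (HasCompactSupport.intro hK hf0) (fun z => η.nonneg) (x := (Real.sqrt ((ρ ^ 2 + 1) / 2) : ℂ)) ?_
    simp only [hf, Complex.norm_real, Real.norm_eq_abs, sq_abs]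
    rw [Real.sq_sqrt (by positivity), η.one_of_mem_closedBall (by simp [η]; linarith)]
    exact one_ne_zero
  set c : ℂ := ((∫ z, f z : ℝ) : ℂ) with hc
  have hc0 : c ≠ 0 := by simpa [hc] using hpos.ne'
  have hz0 : ∀ z ∉ K, c⁻¹ * (f z : ℂ) = 0 := fun z hz => by simp [hf0 z hz]
  refine ⟨Test.mk' (fun z => c⁻¹ * (f z : ℂ))
    (contDiff_const.mul (Complex.ofRealCLM.contDiff.comp hfs)) K hK hKd hz0, R, hR1, ?_, ?_, ?_, ?_⟩
  · intro ξ z hξ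
    simp [hf, hξ]
  · intro z hz
    by_contra h
    exact hz (hz0 z fun hzK => h (hKR z hzK))
  · intro z hz
    refine (hKR z ?_).1
    refine closure_minimal (fun x hx => ?_) hKc hz
    by_contra h'
    exact hx (hz0 x h')
  · simp only [Test.mk'_apply]
    rw [integral_const_mul, integral_complex_ofReal, ← hc, inv_mul_cancel₀ hc0]

/-- Rotation by `exp(iπ/j)` preserves the measure and changes the sign of `F`. No integrability is
needed. -/
theorem integral_eq_zero_of_rotation {F : ℂ → ℂ} {j : ℤ} (hj : j ≠ 0)
    (hF : ∀ ξ z : ℂ, ‖ξ‖ = 1 → F (ξ * z) = ξ ^ j * F z) : ∫ z, F z = 0 := by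
  set ξ : ℂ := Complex.exp (((Real.pi / j : ℝ) : ℂ) * Complex.I) with hξ
  have hξ1 : ‖ξ‖ = 1 := Complex.norm_exp_ofReal_mul_I _
  have hξj : ξ ^ j = -1 := by
    rw [hξ, ← Complex.exp_int_mul, ← Complex.exp_pi_mul_I]
    congr 1
    have : (j : ℂ) ≠ 0 := by exact_mod_cast hj
    push_cast
    field_simp
  let e : ℂ ≃ₗᵢ[ℝ] ℂ := rotation ⟨ξ, by simp [Submonoid.unitSphere, hξ1]⟩
  have h1 : ∫ z, F (e z) = ∫ z, F z :=
    e.measurePreserving.integral_comp e.toHomeomorph.measurableEmbedding F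
  have h2 : ∀ z, F (e z) = -F z := fun z => by
    have : e z = ξ * z := rfl
    rw [this, hF ξ z hξ1, hξj, neg_one_mul]
  simp only [h2, integral_neg] at h1
  linear_combination (-1 / 2) * h1

theorem integral_radial_mul_zpow {χ : ℂ → ℂ} (hχ : ∀ ξ z : ℂ, ‖ξ‖ = 1 → χ (ξ * z) = χ z) {j : ℤ}
    (hj : j ≠ 0) : ∫ z, χ z * z ^ j = 0 :=
  integral_eq_zero_of_rotation hj fun ξ z hξ => by rw [hχ ξ z hξ, mul_zpow]; ring

theorem conj_eq_inv_of_norm_one {ξ : ℂ} (h : ‖ξ‖ = 1) : conj ξ = ξ⁻¹ := by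
  rw [Complex.inv_def, Complex.normSq_eq_norm_sq, h]; simp

/-- Take `f(z) = χ(z) h(1/z)` with `h(ζ) = ∑ Aₘ ζ^{m+1}` and `χ` radial of integral one. Against
`z^{n+1}` the terms `z^{n-m}` with `m ≠ n` integrate to zero by rotation. The choice `r < ρ < ‖z‖`
on the support of `χ` puts `1/z` inside the disc of convergence of `h`. -/
theorem exists_test_moments (A : ℕ → ℂ) {r C : ℝ} (hr0 : 0 < r) (hr : r < 1)
    (hA : ∀ n, ‖A n‖ ≤ C * r ^ (n + 1)) : ∃ f : Test, (∀ n, ∫ z, f z * z ^ (n + 1) = A n) ∧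
      (∀ n, ∫ z, f z * conj z ^ n = 0) := by
  set ρ := (r + 1) / 2 with hρ
  have hρ0 : 0 < ρ := by positivity
  have hrρ : r < ρ := by rw [hρ]; linarith
  obtain ⟨χ, R, hR1, hrot, hsupp, htsupp, hint⟩ := exists_radial_bump hρ0 (show ρ < 1 by rw [hρ]; linarith)
  have hC : 0 ≤ C := by
    have := (norm_nonneg _).trans (hA 0)
    rw [zero_add, pow_one] at this
    exact nonneg_of_mul_nonneg_left this hr0
  have hsum : Summable fun n : ℕ => C * (r / ρ) ^ (n + 1) :=
    ((summable_nat_add_iff 1).2 (summable_geometric_of_lt_one (by positivity)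
      (by rwa [div_lt_one hρ0]))).mul_left C
  have hbd : ∀ (n : ℕ) (ζ : ℂ), ‖ζ‖ ≤ ρ⁻¹ → ‖A n * ζ ^ (n + 1)‖ ≤ C * (r / ρ) ^ (n + 1) := by
    intro n ζ hζ
    rw [norm_mul, norm_pow, div_eq_mul_inv, mul_pow, ← mul_assoc]
    exact mul_le_mul (hA n) (by gcongr) (by positivity) ((norm_nonneg _).trans (hA n))
  set h : ℂ → ℂ := fun ζ => ∑' n, A n * ζ ^ (n + 1) with hh
  have hhd : DifferentiableOn ℂ h (ball 0 ρ⁻¹) :=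
    Complex.differentiableOn_tsum_of_summable_norm hsum (fun n => by fun_prop) isOpen_ball
      fun n ζ hζ => hbd n ζ (mem_ball_zero_iff.1 hζ).le
  have hinv : ∀ z : ℂ, ρ < ‖z‖ → ‖z⁻¹‖ < ρ⁻¹ := fun z hz => by
    rw [norm_inv]; exact inv_strictAnti₀ hρ0 hz
  have hsmooth : ContDiff ℝ ∞ fun z => χ z * h z⁻¹ := by
    rw [contDiff_iff_contDiffAt]
    intro z
    by_cases hz : z ∈ tsupport χ
    · have hz' := htsupp z hz
      have hz0 : z ≠ 0 := norm_pos_iff.1 (hρ0.trans hz')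
      have ha : AnalyticAt ℂ h z⁻¹ :=
        hhd.analyticAt (isOpen_ball.mem_nhds (mem_ball_zero_iff.2 (hinv z hz')))
      have hb : AnalyticAt ℂ (fun z => h z⁻¹) z := ha.comp (analyticAt_id.inv hz0)
      exact χ.contDiff.contDiffAt.mul (hb.contDiffAt.restrict_scalars ℝ)
    · refine (contDiffAt_const (c := (0 : ℂ))).congr_of_eventuallyEq ?_
      filter_upwards [notMem_tsupport_iff_eventuallyEq.1 hz] with w hw
      simp [hw]
  -- Summation and integration are exchanged by domination with the geometric series in `r / ρ`,
  -- once for both kinds of moments.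
  have key : ∀ w : ℂ → ℂ, Continuous w →
      HasSum (fun n => ∫ z, A n * (χ z * (z⁻¹) ^ (n + 1) * w z)) (∫ z, χ z * h z⁻¹ * w z) := by
    intro w hw
    have hχw : Integrable fun z => ‖χ z * w z‖ :=
      ((χ.continuous.mul hw).integrable_of_hasCompactSupport χ.hasCompactSupport.mul_right).norm
    have hle : ∀ n z, ‖A n * (χ z * (z⁻¹) ^ (n + 1) * w z)‖ ≤ C * (r / ρ) ^ (n + 1) * ‖χ z * w z‖ := by
      intro n z
      by_cases hz : χ z = 0
      · simp [hz]
      · rw [show A n * (χ z * (z⁻¹) ^ (n + 1) * w z) = (A n * (z⁻¹) ^ (n + 1)) * (χ z * w z) by ring,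
          norm_mul]
        gcongr
        exact hbd n _ (hinv z (hsupp z hz).1).le
    have hmeas : ∀ n, AEStronglyMeasurable (fun z => A n * (χ z * (z⁻¹) ^ (n + 1) * w z)) := by
      intro n
      have h1 := χ.continuous.measurable
      have h2 := hw.measurable
      exact (by fun_prop : Measurable _).aestronglyMeasurable
    have hi : ∀ n, Integrable (fun z => A n * (χ z * (z⁻¹) ^ (n + 1) * w z)) := fun n =>
      (hχw.const_mul _).mono' (hmeas n) (.of_forall (hle n))
    have he : ∫ z, χ z * h z⁻¹ * w z = ∫ z, ∑' n, A n * (χ z * (z⁻¹) ^ (n + 1) * w z) := by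
      congr 1; funext z
      rw [hh]
      simp only
      rw [← tsum_mul_left, ← tsum_mul_right]
      exact tsum_congr fun n => by ring
    rw [he]
    refine hasSum_integral_of_summable_integral_norm hi ?_
    refine Summable.of_nonneg_of_le (fun n => integral_nonneg fun z => norm_nonneg _) (fun n => ?_)
      (hsum.mul_right (∫ z, ‖χ z * w z‖))
    rw [← integral_const_mul]
    exact integral_mono (hi n).norm (hχw.const_mul _) (hle n)
  refine ⟨Test.mk' (fun z => χ z * h z⁻¹) hsmooth (closedBall 0 R) (isCompact_closedBall 0 R)
    (closedBall_subset_disc hR1) fun z hz => ?_, fun n => ?_, fun n => ?_⟩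
  · by_cases h' : χ z = 0
    · rw [h', zero_mul]
    · exact absurd (mem_closedBall_zero_iff.2 (hsupp z h').2) hz
  · have hz : ∀ z, χ z ≠ 0 → z ≠ 0 := fun z hz => norm_pos_iff.1 (hρ0.trans (hsupp z hz).1)
    refine (key (fun z => z ^ (n + 1)) (by fun_prop)).unique ?_
    convert hasSum_single n fun m hm => ?_ using 1
    · rw [integral_const_mul]
      have : ∀ z, χ z * (z⁻¹) ^ (n + 1) * z ^ (n + 1) = χ z := by
        intro z
        by_cases h' : χ z = 0
        · simp [h']
        · rw [mul_assoc, ← mul_pow, inv_mul_cancel₀ (hz z h'), one_pow, mul_one]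
      simp only [this, hint, mul_one]
    · rw [integral_const_mul]
      have : ∀ z, χ z * (z⁻¹) ^ (m + 1) * z ^ (n + 1) = χ z * z ^ ((n : ℤ) - m) := by
        intro z
        by_cases h' : χ z = 0
        · simp [h']
        · rw [mul_assoc, inv_pow, ← zpow_natCast, ← zpow_natCast, ← zpow_neg, ← zpow_add₀ (hz z h')]
          congr 2
          push_cast
          ring
      simp only [this]
      rw [integral_radial_mul_zpow hrot (by omega), mul_zero]
  · refine (key (fun z => conj z ^ n) (by fun_prop)).unique ?_
    convert hasSum_zero with m
    -- The rotation weight of `z^{-(m+1)} z̄^n` is `-(m+1+n)`, never zero. This includes `n = 0`, so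
    -- `f` also has integral zero.
    rw [integral_const_mul, integral_eq_zero_of_rotation (j := -((m : ℤ) + 1 + n)) (by omega), mul_zero]
    intro ξ z hξ
    have hξ0 : ξ ≠ 0 := norm_pos_iff.1 (by rw [hξ]; exact one_pos)
    rw [hrot ξ z hξ, map_mul, conj_eq_inv_of_norm_one hξ, mul_inv, mul_pow, mul_pow, inv_pow, inv_pow,
      zpow_neg, zpow_add₀ hξ0, mul_inv, zpow_natCast]
    norm_cast
    ring

theorem toDist_apply (f : Test₀) (u : Harm) : toDist f u = ∫ z, f.1 z * u.1 z := rfl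

theorem Test.integral_mul_congr (f : Test) {u v : ℂ → ℂ} (h : ∀ z ∈ disc, u z = v z) :
    ∫ z, f z * u z = ∫ z, f z * v z := by
  congr 1; funext z
  by_cases hz : z ∈ disc
  · rw [h z hz]
  · rw [f.eq_zero_of_notMem hz, zero_mul, zero_mul]

theorem Test.integral_mul_continuous_add (f g : Test) {u : ℂ → ℂ} (hu : Continuous u) :
    ∫ z, (f + g) z * u z = (∫ z, f z * u z) + ∫ z, g z * u z := by
  rw [← integral_add]
  · congr 1; funext z; simp [add_mul]
  · exact (f.continuous.mul hu).integrable_of_hasCompactSupport f.hasCompactSupport.mul_right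
  · exact (g.continuous.mul hu).integrable_of_hasCompactSupport g.hasCompactSupport.mul_right

/-- The complex conjugate of a test function. -/
noncomputable def Test.conj (f : Test) : Test :=
  Test.mk' (fun z => conj (f z)) (Complex.conjCLE.contDiff.comp f.contDiff) (tsupport f)
    f.hasCompactSupport f.tsupport_subset fun z hz => by
      rw [image_eq_zero_of_notMem_tsupport hz, map_zero]

theorem toDist_mono (f : Test₀) (n : ℕ) : toDist f (Harm.mono n) = ∫ z, f.1 z * z ^ n :=
  f.1.integral_mul_congr fun _ hz => Harm.mk'_apply _ (harmonicOnNhd_of_differentiableOn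
    (by fun_prop)) hz

theorem toDist_antimono (f : Test₀) (n : ℕ) : toDist f (Harm.antimono n) = ∫ z, f.1 z * conj z ^ n :=
  f.1.integral_mul_congr fun z hz => (Harm.mk'_apply _ (harmonicOnNhd_conj (F := fun z => z ^ n)
    (by fun_prop)) hz).trans (map_pow _ _ _)

/-- One test function carries the holomorphic moments and the conjugate of another the
antiholomorphic ones. Each has vanishing moments of the opposite type, so they do not interfere in
the sum. -/
theorem exists_toDist_hasExpansion (a b : ℕ → ℂ) (h : GrowthCondition a b) :
    ∃ f : Test₀, HasExpansion (toDist f) a b := by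
  obtain ⟨r, C, hr0, hr1, hC, h⟩ := (growthCondition_iff a b).1 h
  obtain ⟨f, hf1, hf2⟩ := exists_test_moments (fun n => (-1) ^ (n + 1) * a n) hr0 hr1
    (by simpa using fun n => (h n).1)
  obtain ⟨g, hg1, hg2⟩ := exists_test_moments (fun n => (-1) ^ (n + 1) * conj (b n)) hr0 hr1
    (by simpa using fun n => (h n).2)
  have hconj : ∀ u : ℂ → ℂ, ∫ z, g.conj z * u z = conj (∫ z, g z * conj (u z)) := by
    intro u
    rw [← integral_conj]
    congr 1; funext z
    rw [map_mul, Complex.conj_conj]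
    rfl
  have e0 : ∫ z, (f + g.conj) z = 0 := by
    have h1 := Test.integral_mul_continuous_add f g.conj (u := fun _ => 1) continuous_const
    have h2 := hf2 0
    have h3 := hg2 0
    rw [hconj] at h1
    simp only [pow_zero, mul_one, map_one] at h1 h2 h3
    rw [h1, h2, h3]; simp
  refine ⟨⟨f + g.conj, e0⟩, (hasExpansion_iff _ _ _).2 fun n => ⟨?_, ?_⟩⟩
  · rw [toDist_mono, Test.integral_mul_continuous_add _ _ (by fun_prop), hf1, hconj]
    simp only [map_pow]
    rw [hg2]; simp
  · rw [toDist_antimono, Test.integral_mul_continuous_add _ _ (by fun_prop), hf2, hconj]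
    simp only [map_pow, Complex.conj_conj]
    rw [hg1]; simp

theorem HarmDual₀.exists_expansion (T : HarmDual₀) : ∃ a b, HasExpansion T a b := by
  have h1 : ∀ n : ℕ, (-1 : ℂ) ^ (n + 1) * (-1) ^ (n + 1) = 1 := fun n => by
    rw [← mul_pow]; simp
  refine ⟨fun n => (-1) ^ (n + 1) * T (Harm.mono (n + 1)),
    fun n => (-1) ^ (n + 1) * T (Harm.antimono (n + 1)), (hasExpansion_iff _ _ _).2 fun n => ?_⟩
  rw [← mul_assoc, ← mul_assoc, h1, one_mul, one_mul]
  exact ⟨rfl, rfl⟩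

theorem HasExpansion.unique_dist {S T : HarmDual₀} {a b : ℕ → ℂ} (hS : HasExpansion S a b)
    (hT : HasExpansion T a b) : S = T := by
  ext u
  exact (hS u).unique (hT u)

/-- The expansion coefficients of any `T` satisfy the growth condition, so some test function has
the same moments as `T`, and moments determine the distribution. -/
theorem toDist_surjective : Function.Surjective toDist := by
  intro T
  obtain ⟨a, b, h⟩ := HarmDual₀.exists_expansion T
  obtain ⟨f, hf⟩ := exists_toDist_hasExpansion a b (HarmDual₀.growth T a b h)
  exact ⟨f, hf.unique_dist h⟩

theorem growthCondition_iff_exists_hasExpansion (a b : ℕ → ℂ) :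
    GrowthCondition a b ↔ ∃ T : HarmDual₀, HasExpansion T a b :=
  ⟨fun h => let ⟨f, hf⟩ := exists_toDist_hasExpansion a b h; ⟨toDist f, hf⟩,
    fun ⟨T, hT⟩ => HarmDual₀.growth T a b hT⟩

theorem existsUnique_expansion (T : HarmDual₀) : ∃! p : (ℕ → ℂ) × (ℕ → ℂ),
    GrowthCondition p.1 p.2 ∧ HasExpansion T p.1 p.2 := by
  obtain ⟨a, b, h⟩ := HarmDual₀.exists_expansion T
  refine ⟨(a, b), ⟨HarmDual₀.growth T a b h, h⟩, ?_⟩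
  rintro ⟨a', b'⟩ ⟨-, h'⟩
  have h1 := (hasExpansion_iff _ _ _).1 h
  have h2 := (hasExpansion_iff _ _ _).1 h'
  have h0 : ∀ n : ℕ, (-1 : ℂ) ^ (n + 1) ≠ 0 := fun n => pow_ne_zero _ (by simp)
  ext n
  · exact mul_left_cancel₀ (h0 n) ((h2 n).1.symm.trans (h1 n).1)
  · exact mul_left_cancel₀ (h0 n) ((h2 n).2.symm.trans (h1 n).2)

end ConfDisk

namespace ConfDisk

open Set Metric MeasureTheory Filter

/-! ### The Laplacian and integration by parts -/

/-- The Laplacian `-(∂_x² + ∂_y²)` of a function on `ℂ`. -/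
noncomputable def lapl (u : ℂ → ℂ) (z : ℂ) : ℂ :=
  -(fderiv ℝ (fun y => fderiv ℝ u y 1) z 1 + fderiv ℝ (fun y => fderiv ℝ u y Complex.I) z Complex.I)

open LineDeriv in
theorem lap_apply (h : Test) (z : ℂ) : (lap h).1 z = lapl h z := by
  have h0 : ∀ (f : Test) (v z : ℂ), (∂_{v} f : Test) z = fderiv ℝ f z v := fun f v z => by
    have : (∂_{v} f : Test) z = lineDeriv ℝ f z v := TestFunction.lineDerivCLM_apply_of_le (by simp)
    rw [this]
    exact ((f.contDiff.differentiable (by simp)).differentiableAt (x := z)).lineDeriv_eq_fderiv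
  change (-(∂_{(1 : ℂ)} (∂_{(1 : ℂ)} h) + ∂_{Complex.I} (∂_{Complex.I} h)) : Test) z = _
  simp only [FunLike.coe_neg, FunLike.coe_add, Pi.neg_apply, Pi.add_apply]
  rw [h0, h0, lapl]
  congr 3

theorem contDiff_fderiv_apply {h : ℂ → ℂ} (hh : ContDiff ℝ ∞ h) (v : ℂ) :
    ContDiff ℝ ∞ fun z => fderiv ℝ h z v :=
  (hh.fderiv_right (m := ∞) (by simp)).clm_apply contDiff_const

theorem hasCompactSupport_fderiv_apply {h : ℂ → ℂ} (hh : HasCompactSupport h) (v : ℂ) :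
    HasCompactSupport fun z => fderiv ℝ h z v :=
  (hh.fderiv ℝ).comp_left (g := fun L : ℂ →L[ℝ] ℂ => L v) rfl

theorem integrable_mul_of_hasCompactSupport {h g : ℂ → ℂ} (hh : Continuous h) (hc : HasCompactSupport h)
    (hg : Continuous g) : Integrable fun z => h z * g z :=
  (hh.mul hg).integrable_of_hasCompactSupport hc.mul_right

theorem integral_fderiv_mul {h g g' : ℂ → ℂ} (hh : ContDiff ℝ ∞ h) (hc : HasCompactSupport h)
    (hg : Continuous g) (hg' : Continuous g') {v : ℂ} (hgg' : ∀ z, HasLineDerivAt ℝ g (g' z) z v) :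
    ∫ z, fderiv ℝ h z v * g z = -∫ z, h z * g' z := by
  have h' := contDiff_fderiv_apply hh v
  have key := integral_bilinear_hasLineDerivAt_right_eq_neg_left_of_integrable
    (μ := (volume : Measure ℂ)) (f := g) (f' := g') (g := h)
    (g' := fun z => fderiv ℝ h z v) (v := v) (B := ContinuousLinearMap.mul ℝ ℂ)
    (by simpa [mul_comm] using integrable_mul_of_hasCompactSupport hh.continuous hc hg')
    (by simpa [mul_comm] using integrable_mul_of_hasCompactSupport h'.continuous
          (hasCompactSupport_fderiv_apply hc v) hg)
    (by simpa [mul_comm] using integrable_mul_of_hasCompactSupport hh.continuous hc hg)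
    (fun z _ => hgg' z)
    (fun z _ => ((hh.differentiable (by simp)).differentiableAt (x := z)).hasFDerivAt.hasLineDerivAt v)
  simpa [mul_comm] using key

theorem continuous_lapl {h : ℂ → ℂ} (hh : ContDiff ℝ ∞ h) : Continuous (lapl h) :=
  ((contDiff_fderiv_apply (contDiff_fderiv_apply hh _) _).continuous.add
    (contDiff_fderiv_apply (contDiff_fderiv_apply hh _) _).continuous).neg

theorem hasCompactSupport_lapl {h : ℂ → ℂ} (hc : HasCompactSupport h) : HasCompactSupport (lapl h) :=
  ((hasCompactSupport_fderiv_apply (hasCompactSupport_fderiv_apply hc _) _).add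
    (hasCompactSupport_fderiv_apply (hasCompactSupport_fderiv_apply hc _) _)).neg

/-- Green's identity for a compactly supported `h`. -/
theorem integral_lapl_mul {h g g₁ g₂ g₁₁ g₂₂ : ℂ → ℂ} (hh : ContDiff ℝ ∞ h) (hc : HasCompactSupport h)
    (hg : Continuous g) (hg1 : Continuous g₁) (hg2 : Continuous g₂) (hg11 : Continuous g₁₁)
    (hg22 : Continuous g₂₂) (h1 : ∀ z, HasLineDerivAt ℝ g (g₁ z) z 1)
    (h2 : ∀ z, HasLineDerivAt ℝ g (g₂ z) z Complex.I) (h11 : ∀ z, HasLineDerivAt ℝ g₁ (g₁₁ z) z 1)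
    (h22 : ∀ z, HasLineDerivAt ℝ g₂ (g₂₂ z) z Complex.I) :
    ∫ z, lapl h z * g z = -∫ z, h z * (g₁₁ z + g₂₂ z) := by
  have i : ∀ v, Integrable fun z => fderiv ℝ (fun y => fderiv ℝ h y v) z v * g z := fun v =>
    integrable_mul_of_hasCompactSupport
      (contDiff_fderiv_apply (contDiff_fderiv_apply hh _) _).continuous
      (hasCompactSupport_fderiv_apply (hasCompactSupport_fderiv_apply hc _) _) hg
  have e : ∀ z, lapl h z * g z = -(fderiv ℝ (fun y => fderiv ℝ h y 1) z 1 * g z +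
      fderiv ℝ (fun y => fderiv ℝ h y Complex.I) z Complex.I * g z) := fun z => by rw [lapl]; ring
  have e' : ∀ z, h z * (g₁₁ z + g₂₂ z) = h z * g₁₁ z + h z * g₂₂ z := fun z => by ring
  simp only [e, e']
  rw [integral_neg, integral_add (i 1) (i Complex.I),
    integral_add (integrable_mul_of_hasCompactSupport hh.continuous hc hg11)
      (integrable_mul_of_hasCompactSupport hh.continuous hc hg22),
    integral_fderiv_mul (contDiff_fderiv_apply hh _) (hasCompactSupport_fderiv_apply hc _) hg hg1 h1,
    integral_fderiv_mul (contDiff_fderiv_apply hh _) (hasCompactSupport_fderiv_apply hc _) hg hg2 h2,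
    integral_fderiv_mul hh hc hg1 hg11 h11, integral_fderiv_mul hh hc hg2 hg22 h22]
  ring

theorem integral_lapl_mul_pow {h : ℂ → ℂ} (hh : ContDiff ℝ ∞ h) (hc : HasCompactSupport h) (n : ℕ) :
    ∫ z, lapl h z * z ^ n = 0 := by
  have hd : ∀ (m : ℕ) (c v z : ℂ), HasLineDerivAt ℝ (fun z => c * z ^ m) (c * (m * z ^ (m - 1)) * v) z v := by
    intro m c v z
    have := (((hasDerivAt_pow m z).const_mul c).hasFDerivAt.restrictScalars ℝ).hasLineDerivAt v
    simpa [mul_comm] using this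
  -- The truncated exponents `n - 1` and `n - 1 - 1` are harmless: whenever they are truncated, a
  -- factor `n` or `n - 1` vanishes.
  have h1 := integral_lapl_mul (h := h) (g := fun z => z ^ n) (g₁ := fun z => n * z ^ (n - 1))
    (g₂ := fun z => (n * Complex.I) * z ^ (n - 1))
    (g₁₁ := fun z => n * ((n - 1 : ℕ) * z ^ (n - 1 - 1)))
    (g₂₂ := fun z => (n * Complex.I) * ((n - 1 : ℕ) * z ^ (n - 1 - 1)) * Complex.I) hh hc
    (by fun_prop) (by fun_prop) (by fun_prop) (by fun_prop) (by fun_prop)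
    (fun z => by simpa using hd n 1 1 z)
    (fun z => by convert hd n 1 Complex.I z using 1 <;> [simp; ring])
    (fun z => by simpa using hd (n - 1) n 1 z)
    (fun z => hd (n - 1) (n * Complex.I) Complex.I z)
  rw [h1, neg_eq_zero]
  convert integral_zero ℂ ℂ with z
  linear_combination (h z * n * ((n - 1 : ℕ) * z ^ (n - 1 - 1))) * Complex.I_sq

theorem lapl_conj {h : ℂ → ℂ} (hh : ContDiff ℝ ∞ h) (z : ℂ) :
    lapl (fun w => conj (h w)) z = conj (lapl h z) := by
  have h1 : ∀ v, (fun y => fderiv ℝ (fun w => conj (h w)) y v) = fun y => conj (fderiv ℝ h y v) :=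
    fun v => funext fun y => fderiv_conj_comp ((hh.differentiable (by simp)) y) v
  rw [lapl, lapl, h1, h1,
    fderiv_conj_comp ((contDiff_fderiv_apply hh 1).differentiable (by simp) z),
    fderiv_conj_comp ((contDiff_fderiv_apply hh Complex.I).differentiable (by simp) z)]
  simp

theorem contDiff_conj {h : ℂ → ℂ} (hh : ContDiff ℝ ∞ h) : ContDiff ℝ ∞ fun w => conj (h w) :=
  Complex.conjCLE.contDiff.comp hh

/-- Only monomials have to be tested. Integration by parts is thereby needed only against
polynomials on all of `ℂ`, and the antiholomorphic case is the conjugate of the holomorphic one. -/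
theorem toDist_lap (h : Test) : toDist (lap h) = 0 := by
  refine HarmDual₀.ext_mono (fun k => ?_) fun k => ?_
  · rw [toDist_mono]
    simp only [lap_apply]
    exact integral_lapl_mul_pow h.contDiff h.hasCompactSupport _
  · rw [toDist_antimono]
    simp only [lap_apply]
    have h1 := integral_lapl_mul_pow (contDiff_conj h.contDiff)
      (h.hasCompactSupport.comp_left (g := conj) (map_zero _)) (k + 1)
    have h2 := congrArg conj h1
    rw [← integral_conj, map_zero] at h2
    rw [show (0 : HarmDual₀) (Harm.antimono (k + 1)) = 0 from rfl, ← h2]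
    congr 1; funext z
    rw [lapl_conj h.contDiff]
    simp

/-! ### The fundamental solution of the Laplacian -/

theorem locallyIntegrable_log_norm : LocallyIntegrable fun z : ℂ => Real.log ‖z‖ := by
  intro z
  by_cases hz : z = 0
  · exact ⟨ball 0 2, by rw [hz]; exact ball_mem_nhds _ (by norm_num), integrableOn_log_norm⟩
  · have hz' : 0 < ‖z‖ := norm_pos_iff.2 hz
    refine ⟨closedBall z (‖z‖ / 2), closedBall_mem_nhds _ (by positivity), ?_⟩
    refine ContinuousOn.integrableOn_compact (isCompact_closedBall _ _) ?_
    refine continuousOn_id.norm.log fun w hw => ?_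
    rw [id, norm_ne_zero_iff]
    rintro rfl
    rw [mem_closedBall, dist_zero_left] at hw
    linarith

/-- In polar coordinates the radial integrand `2r / (1 + r²)²` has the primitive `-(1 + r²)⁻¹`. The
value `2π` is the mass of the approximate identity obtained from the regularized logarithm. -/
theorem integral_two_div_sq : ∫ z : ℂ, (2 / (1 + ‖z‖ ^ 2) ^ 2 : ℝ) = 2 * Real.pi ∧
    Integrable fun z : ℂ => (2 / (1 + ‖z‖ ^ 2) ^ 2 : ℝ) := by
  have hd : ∀ x ∈ Ioi (0 : ℝ), HasDerivAt (fun y : ℝ => -(1 + y ^ 2)⁻¹) (x * (2 / (1 + x ^ 2) ^ 2)) x := by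
    intro x _
    have h0 : (1 + x ^ 2) ≠ 0 := by positivity
    have h1 : HasDerivAt (fun y : ℝ => 1 + y ^ 2) (2 * x) x := by
      simpa using (hasDerivAt_pow 2 x).const_add 1
    convert! (h1.inv h0).neg using 1
    field_simp
  have hcont : ContinuousWithinAt (fun y : ℝ => -(1 + y ^ 2)⁻¹) (Ici 0) 0 := by
    refine ContinuousAt.continuousWithinAt ?_
    exact (ContinuousAt.inv₀ (by fun_prop) (by norm_num)).neg
  have hpos : ∀ x ∈ Ioi (0 : ℝ), 0 ≤ x * (2 / (1 + x ^ 2) ^ 2) := fun x hx => by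
    have : 0 < x := hx
    positivity
  have hlim : Tendsto (fun y : ℝ => -(1 + y ^ 2)⁻¹) atTop (𝓝 0) := by
    rw [← neg_zero]
    refine (tendsto_inv_atTop_zero.comp ?_).neg
    exact tendsto_atTop_add_const_left _ _ (tendsto_pow_atTop (by norm_num))
  constructor
  · have h1 := integral_fun_norm_addHaar (volume : Measure ℂ) (fun y : ℝ => 2 / (1 + y ^ 2) ^ 2)
    rw [h1]
    have h2 := integral_Ioi_of_hasDerivAt_of_nonneg hcont hd hpos hlim
    simp only [Complex.finrank_real_complex, Nat.add_one_sub_one, pow_one, smul_eq_mul]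
    rw [h2, measureReal_def, Complex.volume_ball]
    simp
  · rw [integrable_fun_norm_addHaar (volume : Measure ℂ) (f := fun y : ℝ => 2 / (1 + y ^ 2) ^ 2)]
    simp only [Complex.finrank_real_complex, Nat.add_one_sub_one, pow_one, smul_eq_mul]
    exact integrableOn_Ioi_deriv_of_nonneg hcont hd hpos hlim

/-- The regularized logarithm `½ log (|z|² + ε²)`. -/
noncomputable def regLog (ε : ℝ) (z : ℂ) : ℝ := (1 / 2) * Real.log (z.re ^ 2 + z.im ^ 2 + ε ^ 2)

theorem norm_sq_eq (z : ℂ) : ‖z‖ ^ 2 = z.re ^ 2 + z.im ^ 2 := by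
  rw [← Complex.normSq_eq_norm_sq, Complex.normSq_apply]; ring

/-- The regularized logarithm is smooth, so Green's identity applies without boundary terms; `∂_x² +
∂_y²` sends it to `2ε² / (|z|² + ε²)²`. -/
theorem integral_lapl_mul_regLog {h : ℂ → ℂ} (hh : ContDiff ℝ ∞ h) (hc : HasCompactSupport h) {ε : ℝ}
    (hε : 0 < ε) : ∫ z, lapl h z * (regLog ε z : ℂ) =
      -∫ z, h z * ((2 * ε ^ 2 / (z.re ^ 2 + z.im ^ 2 + ε ^ 2) ^ 2 : ℝ) : ℂ) := by
  have hq : ∀ x y : ℝ, 0 < x ^ 2 + y ^ 2 + ε ^ 2 := fun x y => by positivity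
  have hq' : ∀ z : ℂ, z.re ^ 2 + z.im ^ 2 + ε ^ 2 ≠ 0 := fun z => (hq _ _).ne'
  have d0 : ∀ x y : ℝ, HasDerivAt (fun t : ℝ => (x + t) ^ 2 + y ^ 2 + ε ^ 2) (2 * x) 0 := by
    intro x y
    have := ((((hasDerivAt_id (0 : ℝ)).const_add x).pow 2).add_const (y ^ 2)).add_const (ε ^ 2)
    simpa using this
  have d1 : ∀ x y : ℝ, HasDerivAt (fun t : ℝ => (1 / 2) * Real.log ((x + t) ^ 2 + y ^ 2 + ε ^ 2))
      (x / (x ^ 2 + y ^ 2 + ε ^ 2)) 0 := by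
    intro x y
    have := ((d0 x y).log (by simpa using (hq x y).ne')).const_mul (1 / 2)
    convert! this using 1
    simp; ring
  have d2 : ∀ x y : ℝ, HasDerivAt (fun t : ℝ => (x + t) / ((x + t) ^ 2 + y ^ 2 + ε ^ 2))
      ((y ^ 2 + ε ^ 2 - x ^ 2) / (x ^ 2 + y ^ 2 + ε ^ 2) ^ 2) 0 := by
    intro x y
    have := ((hasDerivAt_id (0 : ℝ)).const_add x).div (d0 x y) (by simpa using (hq x y).ne')
    convert! this using 1
    simp; ring
  have key := integral_lapl_mul (h := h) (g := fun z => (regLog ε z : ℂ))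
    (g₁ := fun z => ((z.re / (z.re ^ 2 + z.im ^ 2 + ε ^ 2) : ℝ) : ℂ))
    (g₂ := fun z => ((z.im / (z.re ^ 2 + z.im ^ 2 + ε ^ 2) : ℝ) : ℂ))
    (g₁₁ := fun z => (((z.im ^ 2 + ε ^ 2 - z.re ^ 2) / (z.re ^ 2 + z.im ^ 2 + ε ^ 2) ^ 2 : ℝ) : ℂ))
    (g₂₂ := fun z => (((z.re ^ 2 + ε ^ 2 - z.im ^ 2) / (z.re ^ 2 + z.im ^ 2 + ε ^ 2) ^ 2 : ℝ) : ℂ)) hh hc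
    (by
      refine Complex.continuous_ofReal.comp (continuous_const.mul ?_)
      exact Continuous.log (by fun_prop) hq')
    (by refine Complex.continuous_ofReal.comp (Continuous.div (by fun_prop) (by fun_prop) hq'))
    (by refine Complex.continuous_ofReal.comp (Continuous.div (by fun_prop) (by fun_prop) hq'))
    (by refine Complex.continuous_ofReal.comp
          (Continuous.div (by fun_prop) (by fun_prop) fun z => pow_ne_zero 2 (hq' z)))
    (by refine Complex.continuous_ofReal.comp
          (Continuous.div (by fun_prop) (by fun_prop) fun z => pow_ne_zero 2 (hq' z)))
    (fun z => by
      have := (d1 z.re z.im).ofReal_comp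
      simpa [HasLineDerivAt, regLog] using this)
    (fun z => by
      have := (d1 z.im z.re).ofReal_comp
      simpa [HasLineDerivAt, regLog, add_comm (z.im ^ 2), add_comm ((z.im + _) ^ 2)] using this)
    (fun z => by
      have := (d2 z.re z.im).ofReal_comp
      simpa [HasLineDerivAt] using this)
    (fun z => by
      have := (d2 z.im z.re).ofReal_comp
      simpa [HasLineDerivAt, add_comm (z.im ^ 2), add_comm ((z.im + _) ^ 2)] using this)
  rw [key]
  congr 2; funext z
  rw [← Complex.ofReal_add]
  congr 2
  ring

/-- The substitution `z ↦ εz` moves all dependence on `ε` into `h(εz)`, and dominated convergence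
applies. -/
theorem tendsto_integral_mul_poisson {h : ℂ → ℂ} (hh : Continuous h) (hc : HasCompactSupport h) :
    Tendsto (fun ε : ℝ => ∫ z, h z * ((2 * ε ^ 2 / (z.re ^ 2 + z.im ^ 2 + ε ^ 2) ^ 2 : ℝ) : ℂ))
      (𝓝[>] 0) (𝓝 (h 0 * (2 * Real.pi))) := by
  obtain ⟨C, hC⟩ := hh.bounded_above_of_compact_support hc
  have h1 : ∀ ε > 0, ∫ z, h z * ((2 * ε ^ 2 / (z.re ^ 2 + z.im ^ 2 + ε ^ 2) ^ 2 : ℝ) : ℂ) =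
      ∫ z, h (ε • z) * ((2 / (1 + ‖z‖ ^ 2) ^ 2 : ℝ) : ℂ) := by
    intro ε hε
    have := Measure.integral_comp_smul (volume : Measure ℂ) (fun z => h z *
      ((2 * ε ^ 2 / (z.re ^ 2 + z.im ^ 2 + ε ^ 2) ^ 2 : ℝ) : ℂ)) ε
    have hε2 : 0 < ε ^ 2 := by positivity
    rw [Complex.finrank_real_complex, abs_of_pos (inv_pos.2 hε2), eq_inv_smul_iff₀ hε2.ne'] at this
    rw [← this, ← integral_smul]
    congr 1; funext z
    have e : (ε • z).re ^ 2 + (ε • z).im ^ 2 + ε ^ 2 = ε ^ 2 * (1 + ‖z‖ ^ 2) := by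
      rw [← norm_sq_eq, norm_smul, Real.norm_eq_abs, mul_pow, sq_abs]; ring
    rw [e, Complex.real_smul, mul_left_comm, ← Complex.ofReal_mul]
    congr 2
    field_simp
  have h2 : Tendsto (fun ε : ℝ => ∫ z, h (ε • z) * ((2 / (1 + ‖z‖ ^ 2) ^ 2 : ℝ) : ℂ)) (𝓝[>] 0)
      (𝓝 (∫ z : ℂ, h 0 * ((2 / (1 + ‖z‖ ^ 2) ^ 2 : ℝ) : ℂ))) := by
    refine tendsto_integral_filter_of_dominated_convergence
      (fun z => C * (2 / (1 + ‖z‖ ^ 2) ^ 2)) (.of_forall fun ε => ?_) (.of_forall fun ε => ?_)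
      (integral_two_div_sq.2.const_mul C) (.of_forall fun z => ?_)
    · refine Continuous.aestronglyMeasurable (.mul (by fun_prop) ?_)
      exact Complex.continuous_ofReal.comp (Continuous.div (by fun_prop) (by fun_prop)
        fun z => by positivity)
    · refine .of_forall fun z => ?_
      rw [norm_mul, Complex.norm_real, Real.norm_of_nonneg (by positivity)]
      gcongr
      exact hC _
    · refine Tendsto.mul_const _ ?_
      have : Continuous fun ε : ℝ => h (ε • z) := by fun_prop
      have h3 := this.tendsto 0
      rw [zero_smul] at h3
      exact h3.mono_left nhdsWithin_le_nhds
  rw [integral_const_mul, integral_complex_ofReal, integral_two_div_sq.1] at h2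
  push_cast at h2
  refine h2.congr' ?_
  filter_upwards [self_mem_nhdsWithin] with ε hε
  rw [h1 ε hε]
  simp

theorem abs_regLog_le {ε : ℝ} (hε : 0 < ε) (hε1 : ε ≤ 1) {z : ℂ} (hz : z ≠ 0) :
    |regLog ε z| ≤ |Real.log ‖z‖| + ‖z‖ ^ 2 := by
  have hz' : 0 < ‖z‖ := norm_pos_iff.2 hz
  rw [regLog, ← norm_sq_eq]
  have h1 : Real.log (‖z‖ ^ 2) ≤ Real.log (‖z‖ ^ 2 + ε ^ 2) :=
    Real.log_le_log (by positivity) (by nlinarith)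
  have h2 : Real.log (‖z‖ ^ 2 + ε ^ 2) ≤ ‖z‖ ^ 2 + ε ^ 2 - 1 :=
    Real.log_le_sub_one_of_pos (by positivity)
  rw [Real.log_pow] at h1
  push_cast at h1
  have h3 := neg_abs_le (Real.log ‖z‖)
  have h4 : ε ^ 2 ≤ 1 := by nlinarith
  have h5 := abs_nonneg (Real.log ‖z‖)
  rw [abs_le]
  constructor <;> nlinarith [sq_nonneg ‖z‖]

/-- This is the fundamental solution of the Laplacian, as the limit `ε → 0` of the identity for
`regLog ε`. -/
theorem integral_lapl_mul_log {h : ℂ → ℂ} (hh : ContDiff ℝ ∞ h) (hc : HasCompactSupport h) :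
    ∫ z, lapl h z * ((Real.log ‖z‖ : ℝ) : ℂ) = -(2 * Real.pi) * h 0 := by
  have hl := continuous_lapl hh
  have hlc := hasCompactSupport_lapl hc
  have hi : Integrable fun z => ‖lapl h z‖ * (|Real.log ‖z‖| + ‖z‖ ^ 2) := by
    have h1 : LocallyIntegrable fun z : ℂ => |Real.log ‖z‖| + ‖z‖ ^ 2 := by
      refine LocallyIntegrable.add (fun z => (locallyIntegrable_log_norm z).norm) ?_
      exact (by fun_prop : Continuous fun z : ℂ => ‖z‖ ^ 2).locallyIntegrable
    simpa using h1.integrable_smul_left_of_hasCompactSupport hl.norm hlc.norm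
  have h1 : Tendsto (fun ε : ℝ => ∫ z, lapl h z * (regLog ε z : ℂ)) (𝓝[>] 0)
      (𝓝 (∫ z, lapl h z * ((Real.log ‖z‖ : ℝ) : ℂ))) := by
    refine tendsto_integral_filter_of_dominated_convergence _ ?_ ?_ hi ?_
    · filter_upwards [self_mem_nhdsWithin] with ε hε
      refine (hl.mul (Complex.continuous_ofReal.comp (continuous_const.mul ?_))).aestronglyMeasurable
      have hε : 0 < ε := hε
      exact Continuous.log (by fun_prop) fun z => by positivity
    · filter_upwards [Ioc_mem_nhdsGT (zero_lt_one' ℝ)] with ε hε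
      -- The origin is excluded: there `regLog ε 0 = log ε`, while the bound is `0` because
      -- `Real.log 0 = 0`.
      filter_upwards [compl_mem_ae_iff.2 (measure_singleton (0 : ℂ))] with z hz
      rw [norm_mul, Complex.norm_real, Real.norm_eq_abs]
      gcongr
      exact abs_regLog_le hε.1 hε.2 hz
    · filter_upwards [compl_mem_ae_iff.2 (measure_singleton (0 : ℂ))] with z hz
      have hz' : 0 < ‖z‖ := norm_pos_iff.2 hz
      refine Tendsto.const_mul _ ((Complex.continuous_ofReal.tendsto _).comp ?_)
      have h3 : ContinuousAt (fun ε : ℝ => regLog ε z) 0 := by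
        refine ContinuousAt.mul continuousAt_const (ContinuousAt.log (by fun_prop) ?_)
        rw [← norm_sq_eq]; positivity
      have h4 := h3.tendsto
      have h5 : regLog 0 z = Real.log ‖z‖ := by
        rw [regLog, ← norm_sq_eq]; simp
      rw [h5] at h4
      exact h4.mono_left nhdsWithin_le_nhds
  have h2 := (tendsto_integral_mul_poisson hh.continuous hc).neg
  refine (tendsto_nhds_unique h1 (h2.congr' ?_)).trans (by ring)
  filter_upwards [self_mem_nhdsWithin] with ε hε
  rw [integral_lapl_mul_regLog hh hc hε]

theorem lapl_comp_add_left (h : ℂ → ℂ) (a z : ℂ) : lapl (fun w => h (a + w)) z = lapl h (a + z) := by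
  have e : ∀ v, (fun y => fderiv ℝ (fun w => h (a + w)) y v) = fun y => fderiv ℝ h (a + y) v :=
    fun v => funext fun y => by rw [fderiv_comp_add_left]
  rw [lapl, lapl, e, e, fderiv_comp_add_left (f := fun y => fderiv ℝ h y 1),
    fderiv_comp_add_left (f := fun y => fderiv ℝ h y Complex.I)]

/-- The logarithmic potential of `f`. -/
noncomputable def pot (f : ℂ → ℂ) (z : ℂ) : ℂ := ∫ w, (green z w : ℂ) * f w

theorem pot_lapl {h : ℂ → ℂ} (hh : ContDiff ℝ ∞ h) (hc : HasCompactSupport h) (z : ℂ) :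
    pot (lapl h) z = h z := by
  have hc' : HasCompactSupport fun w => h (z + w) := hc.comp_homeomorph (Homeomorph.addLeft z)
  have h1 := integral_lapl_mul_log (h := fun w => h (z + w)) (hh.comp (contDiff_const.add contDiff_id)) hc'
  rw [pot, ← integral_add_left_eq_self _ z]
  have h2 : ∀ w, (green z (z + w) : ℂ) * lapl h (z + w) =
      (-(2 * Real.pi)⁻¹ : ℂ) * (lapl (fun w => h (z + w)) w * ((Real.log ‖w‖ : ℝ) : ℂ)) := by
    intro w
    rw [lapl_comp_add_left, green, sub_add_cancel_left, norm_neg]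
    push_cast; ring
  simp only [h2]
  rw [integral_const_mul, h1, add_zero]
  have : (Real.pi : ℂ) ≠ 0 := by exact_mod_cast Real.pi_ne_zero
  push_cast
  field_simp

/-- As a convolution with a locally integrable kernel, the potential inherits the smoothness of `f`,
and derivatives may be moved onto `f`. -/
theorem pot_eq_convolution (f : ℂ → ℂ) : pot f =
    convolution (fun w => ((-(2 * Real.pi)⁻¹ * Real.log ‖w‖ : ℝ) : ℂ)) f (ContinuousLinearMap.mul ℝ ℂ) := by
  funext z
  rw [pot, convolution, ← integral_sub_left_eq_self _ _ z]
  congr 1; funext w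
  simp [green]

theorem locallyIntegrable_green_zero :
    LocallyIntegrable fun w : ℂ => ((-(2 * Real.pi)⁻¹ * Real.log ‖w‖ : ℝ) : ℂ) := by
  intro z
  obtain ⟨s, hs, h⟩ := locallyIntegrable_log_norm z
  exact ⟨s, hs, (h.const_mul _).ofReal⟩

theorem contDiff_pot {f : ℂ → ℂ} (hf : ContDiff ℝ ∞ f) (hc : HasCompactSupport f) :
    ContDiff ℝ ∞ (pot f) := by
  rw [pot_eq_convolution]
  exact hc.contDiff_convolution_right (n := ⊤) _ locallyIntegrable_green_zero hf

theorem fderiv_pot_apply {f : ℂ → ℂ} (hf : ContDiff ℝ ∞ f) (hc : HasCompactSupport f) (z v : ℂ) :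
    fderiv ℝ (pot f) z v = pot (fun w => fderiv ℝ f w v) z := by
  have h1 := hc.hasFDerivAt_convolution_right (ContinuousLinearMap.mul ℝ ℂ)
    locallyIntegrable_green_zero (hf.of_le (by simp)) z
  rw [← pot_eq_convolution] at h1
  rw [h1.fderiv, convolution_precompR_apply _ locallyIntegrable_green_zero (hc.fderiv ℝ)
    (hf.continuous_fderiv (by simp)), pot_eq_convolution]

theorem integrable_green_mul {g : ℂ → ℂ} (hg : Continuous g) (hgc : HasCompactSupport g) (z : ℂ) :
    Integrable fun w => (green z w : ℂ) * g w := by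
  have h1 := (locallyIntegrable_green_zero.integrable_smul_left_of_hasCompactSupport
    (g := fun w => g (z - w)) (by fun_prop) (hgc.comp_homeomorph (Homeomorph.subLeft z))).comp_sub_left z
  refine h1.congr (.of_forall fun w => ?_)
  simp [green, mul_comm]

/-- Moving both derivatives onto `f` gives `pot (lapl f)`, which is `f` by `pot_lapl`. -/
theorem lapl_pot {f : ℂ → ℂ} (hf : ContDiff ℝ ∞ f) (hc : HasCompactSupport f) (z : ℂ) :
    lapl (pot f) z = f z := by
  have e : ∀ v, (fun y => fderiv ℝ (pot f) y v) = pot fun w => fderiv ℝ f w v :=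
    fun v => funext fun y => fderiv_pot_apply hf hc y v
  rw [lapl, e, e, fderiv_pot_apply (contDiff_fderiv_apply hf _) (hasCompactSupport_fderiv_apply hc _),
    fderiv_pot_apply (contDiff_fderiv_apply hf _) (hasCompactSupport_fderiv_apply hc _), pot, pot,
    ← integral_add, ← integral_neg, ← pot_lapl hf hc z, pot]
  · congr 1; funext w; rw [lapl]; ring
  all_goals
    exact integrable_green_mul (contDiff_fderiv_apply (contDiff_fderiv_apply hf _) _).continuous
      (hasCompactSupport_fderiv_apply (hasCompactSupport_fderiv_apply hc _) _) z

end ConfDisk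

namespace ConfDisk

open Set Metric MeasureTheory Filter

/-! ### The Green pairing and the kernel of `f ↦ ∫ f ·` -/

theorem kernelPairing_green (f g : Test) : kernelPairing green f g = ∫ z, f z * pot g z := by
  have h := integrableOn_green f g
  rw [kernelPairing]
  rw [Measure.volume_eq_prod] at h ⊢
  rw [setIntegral_prod _ h, ← setIntegral_eq_integral_of_forall_compl_eq_zero
    (s := (disc : Set ℂ)) (f := fun z => f z * pot g z)
    (fun z hz => by rw [f.eq_zero_of_notMem hz, zero_mul])]
  congr 1; funext z
  rw [pot, ← integral_const_mul, ← setIntegral_eq_integral_of_forall_compl_eq_zero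
    (s := (disc : Set ℂ)) (f := fun w => f z * ((green z w : ℂ) * g w))
    (fun w hw => by rw [g.eq_zero_of_notMem hw, mul_zero, mul_zero])]
  congr 1; funext w
  ring

theorem greenForm_apply (f g : Test₀) : greenForm f g = ∫ z, f.1 z * pot g.1 z :=
  kernelPairing_green f.1 g.1

/-- The algebraic heart of the argument: `G` inverts `Δ`, so pairing with `Δh` through `G` is plain
integration against `h`, the contraction that defines the quotient. -/
theorem greenForm_lap (f : Test₀) (h : Test) : greenForm f (lap h) = ∫ z, f.1 z * h z := by
  rw [greenForm_apply, show ((lap h).1 : ℂ → ℂ) = lapl h from funext (lap_apply h)]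
  simp only [pot_lapl h.contDiff h.hasCompactSupport]

/-- The logarithm is expanded in powers of `w / z`, with ratio at most `R / ‖z‖ < 1` on the support
of `f`, and each term is a multiple of a vanishing moment. -/
theorem integral_mul_log_one_sub_div {f : Test} {R : ℝ} (hfR : ∀ w, f w ≠ 0 → ‖w‖ ≤ R)
    (h0 : ∀ n, ∫ w, f w * w ^ n = 0) {z : ℂ} (hR : 0 < R) (hz : R < ‖z‖) :
    ∫ w, f w * Complex.log (1 - w / z) = 0 := by
  have hz0 : 0 < ‖z‖ := hR.trans hz
  have hle : ∀ w, f w ≠ 0 → ‖w / z‖ ≤ R / ‖z‖ := fun w hw => by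
    rw [norm_div]; gcongr; exact hfR w hw
  have hlt : R / ‖z‖ < 1 := (div_lt_one hz0).2 hz
  -- The term `n = 0` is a division by zero and hence `0`, in agreement with the missing constant
  -- term of `-log(1 - ζ)`.
  have hbd : ∀ (n : ℕ) w, ‖f w * ((w / z) ^ n / n)‖ ≤ (R / ‖z‖) ^ n * ‖f w‖ := by
    intro n w
    by_cases hw : f w = 0
    · simp [hw]
    rw [norm_mul, mul_comm, norm_div, norm_pow]
    gcongr
    rcases n.eq_zero_or_pos with rfl | hn
    · simp
    · refine (div_le_self (by positivity) ?_).trans (by gcongr; exact hle w hw)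
      rw [Complex.norm_natCast]; exact_mod_cast hn
  have hi : ∀ n : ℕ, Integrable fun w => f w * ((w / z) ^ n / n) := fun n =>
    integrable_mul_of_hasCompactSupport f.continuous f.hasCompactSupport (by fun_prop)
  have hs := hasSum_integral_of_summable_integral_norm hi (by
    refine Summable.of_nonneg_of_le (fun n => integral_nonneg fun z => norm_nonneg _) (fun n => ?_)
      ((summable_geometric_of_lt_one (by positivity) hlt).mul_right (∫ w, ‖f w‖))
    rw [← integral_const_mul]
    exact integral_mono (hi n).norm (f.integrable.norm.const_mul _) (hbd n))
  have h1 : ∀ n : ℕ, ∫ w, f w * ((w / z) ^ n / n) = 0 := by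
    intro n
    have : ∀ w, f w * ((w / z) ^ n / n) = ((z ^ n)⁻¹ * (n : ℂ)⁻¹) * (f w * w ^ n) := fun w => by
      rw [div_pow]; ring
    simp only [this]
    rw [integral_const_mul, h0, mul_zero]
  simp only [h1] at hs
  have h2 := hs.unique hasSum_zero
  rw [← neg_eq_zero, ← integral_neg, ← h2]
  congr 1; funext w
  by_cases hw : f w = 0
  · simp [hw]
  · rw [tsum_mul_left, (Complex.hasSum_taylorSeries_neg_log ((hle w hw).trans_lt hlt)).tsum_eq, mul_neg]

theorem Test.conj_apply (f : Test) (z : ℂ) : f.conj z = conj (f z) := rfl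

theorem Test.integrable_mul_of_continuousAt (f : Test) {u : ℂ → ℂ}
    (hu : ∀ z ∈ tsupport f, ContinuousAt u z) : Integrable fun z => f z * u z := by
  refine Continuous.integrable_of_hasCompactSupport ?_ f.hasCompactSupport.mul_right
  rw [continuous_iff_continuousAt]
  intro z
  by_cases hz : z ∈ tsupport f
  · exact f.continuous.continuousAt.mul (hu z hz)
  · have h0 : (fun z => f z * u z) =ᶠ[𝓝 z] fun _ => 0 := by
      filter_upwards [notMem_tsupport_iff_eventuallyEq.1 hz] with w hw
      simp [hw]
    exact continuousAt_const.congr h0.symm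

theorem exists_support_bound (f : Test) : ∃ R, 0 < R ∧ R < 1 ∧ ∀ w, f w ≠ 0 → ‖w‖ ≤ R := by
  obtain ⟨R, h0, h1, h⟩ := exists_subset_closedBall f.hasCompactSupport f.tsupport_subset
  exact ⟨R, h0, h1, fun w hw => mem_closedBall_zero_iff.1 (h (subset_tsupport _ hw))⟩

/-- For `‖w‖ ≤ R < ‖z‖` one has `log |z - w| = log |z| + Re log(1 - w/z)`. The first term is
constant in `w` and is killed by `∫ f = 0`; the holomorphic and antiholomorphic halves of the second
are killed by the moments of `f` and of its conjugate. -/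
theorem pot_eq_zero_of_toDist_eq_zero {f : Test₀} (hf : toDist f = 0) {R : ℝ}
    (hfR : ∀ w, f.1 w ≠ 0 → ‖w‖ ≤ R) (hR : 0 < R) {z : ℂ} (hz : R < ‖z‖) : pot f.1 z = 0 := by
  have hz0 : 0 < ‖z‖ := hR.trans hz
  have h1 : ∀ n, ∫ w, f.1 w * w ^ n = 0 := fun n => by rw [← toDist_mono, hf]; rfl
  have h2 : ∀ n, ∫ w, f.1.conj w * w ^ n = 0 := fun n => by
    have h3 : ∫ w, f.1 w * conj w ^ n = 0 := by rw [← toDist_antimono, hf]; rfl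
    rw [← map_zero conj, ← h3, ← integral_conj]
    congr 1; funext w
    simp [Test.conj_apply]
  have e1 := integral_mul_log_one_sub_div hfR h1 hR hz
  have e2 := integral_mul_log_one_sub_div (f := f.1.conj)
    (fun w hw => hfR w fun h => hw (by rw [Test.conj_apply, h, map_zero])) h2 hR hz
  have hlog : ∀ w, ‖w‖ ≤ R → ContinuousAt (fun w => Complex.log (1 - w / z)) w ∧
      ((Real.log ‖z - w‖ : ℝ) : ℂ) = (Real.log ‖z‖ : ℝ) +
        (1 / 2) * (Complex.log (1 - w / z) + conj (Complex.log (1 - w / z))) := by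
    intro w hw
    have hlt : ‖w / z‖ < 1 := by
      rw [norm_div, div_lt_one hz0]; exact hw.trans_lt hz
    have hsl : 1 - w / z ∈ Complex.slitPlane := by
      refine Or.inl ?_
      have := (Complex.abs_re_le_norm (w / z)).trans_lt hlt
      rw [abs_lt] at this
      simp only [Complex.sub_re, Complex.one_re]
      linarith
    refine ⟨ContinuousAt.clog (by fun_prop) hsl, ?_⟩
    rw [Complex.add_conj, Complex.log_re]
    have h3 : z - w = z * (1 - w / z) := by
      have : z ≠ 0 := norm_pos_iff.1 hz0
      field_simp
    rw [h3, norm_mul, Real.log_mul hz0.ne' (norm_ne_zero_iff.2 (Complex.slitPlane_ne_zero hsl))]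
    push_cast; ring
  have hts : ∀ w ∈ tsupport f.1, ‖w‖ ≤ R := fun w hw => by
    rw [← mem_closedBall_zero_iff]
    exact closure_minimal (fun w hw => mem_closedBall_zero_iff.2 (hfR w hw)) isClosed_closedBall hw
  have i1 := f.1.integrable_mul_of_continuousAt fun w hw => (hlog w (hts w hw)).1
  have i2 : Integrable fun w => f.1 w * conj (Complex.log (1 - w / z)) :=
    f.1.integrable_mul_of_continuousAt fun w hw => (Complex.continuous_conj.continuousAt.comp
      (hlog w (hts w hw)).1)
  have i12 : Integrable fun w => (1 / 2 : ℂ) * (f.1 w * Complex.log (1 - w / z) +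
      f.1 w * conj (Complex.log (1 - w / z))) := (i1.add i2).const_mul _
  have i0 := f.1.integrable
  have e3 : ∫ w, f.1 w * conj (Complex.log (1 - w / z)) = 0 := by
    rw [← map_zero conj, ← e2, ← integral_conj]
    congr 1; funext w
    simp [Test.conj_apply]
  have e0 : ∫ w, f.1 w = 0 := f.2
  have hpt : ∀ w, (green z w : ℂ) * f.1 w = (-(2 * Real.pi)⁻¹ : ℂ) * ((Real.log ‖z‖ : ℝ) * f.1 w +
      (1 / 2) * (f.1 w * Complex.log (1 - w / z) + f.1 w * conj (Complex.log (1 - w / z)))) := by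
    intro w
    by_cases hw : f.1 w = 0
    · simp [hw]
    · rw [green, Complex.ofReal_mul, (hlog w (hfR w hw)).2]
      push_cast; ring
  rw [pot]
  simp only [hpt]
  rw [integral_const_mul, integral_add (i0.const_mul _) i12, integral_const_mul,
    integral_const_mul, integral_add i1 i2, e0, e1, e3]
  simp

/-- The preimage under `Δ` is the logarithmic potential of `f`, which is compactly supported in the
disc because all moments vanish. -/
theorem ker_toDist : LinearMap.ker toDist = LinearMap.range lap := by
  ext f
  rw [LinearMap.mem_ker, LinearMap.mem_range]
  constructor
  · intro hf
    obtain ⟨R, hR0, hR1, hR⟩ := exists_support_bound f.1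
    refine ⟨Test.mk' (pot f.1) (contDiff_pot f.1.contDiff f.1.hasCompactSupport) (closedBall 0 R)
      (isCompact_closedBall _ _) (closedBall_subset_disc hR1) fun z hz =>
        pot_eq_zero_of_toDist_eq_zero hf hR hR0 (by simpa using hz), ?_⟩
    ext z
    rw [lap_apply]
    exact lapl_pot f.1.contDiff f.1.hasCompactSupport z
  · rintro ⟨h, rfl⟩
    exact toDist_lap h

/-! ### Change of variables -/

/-- The factor `|φ'|⁻²` in `W_φ` cancels the real Jacobian `|φ'|²`. No regularity of `u` is needed.
-/
theorem integral_push_mul (φ : DiscEmb) (f : Test) (u : ℂ → ℂ) :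
    ∫ z, φ.push f z * u z = ∫ z, f z * u (φ z) := by
  have h1 : ∫ z, φ.push f z * u z = ∫ z in φ '' disc, φ.push f z * u z := by
    rw [setIntegral_eq_integral_of_forall_compl_eq_zero]
    intro x hx
    have : φ.push f x = 0 := φ.pushFun_eq_zero f fun h => hx (image_mono f.tsupport_subset h)
    rw [this, zero_mul]
  have h2 : ∫ z, f z * u (φ z) = ∫ z in disc, f z * u (φ z) := by
    rw [setIntegral_eq_integral_of_forall_compl_eq_zero]
    intro x hx
    rw [f.eq_zero_of_notMem hx, zero_mul]
  rw [h1, h2, integral_image_eq_integral_abs_det_fderiv_smul volume disc.isOpen.measurableSet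
    (fun z hz => ((φ.analyticAt hz).differentiableAt.hasDerivAt.hasFDerivAt.restrictScalars
      ℝ).hasFDerivWithinAt) φ.injOn']
  refine setIntegral_congr_fun disc.isOpen.measurableSet fun z hz => ?_
  have h3 : φ.push f (φ z) = (((‖deriv φ z‖ ^ 2)⁻¹ : ℝ) : ℂ) * f z := φ.pushFun_apply _ hz
  have h4 : (‖deriv φ z‖ : ℂ) ≠ 0 := by simpa using φ.deriv_ne_zero' z hz
  simp only [h3]
  erw [DiscEmb.abs_det_smulRight]
  simp only [Complex.real_smul]
  push_cast
  field_simp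

theorem push_eq_zero (φ : DiscEmb) (f : Test) {x : ℂ} (hx : x ∉ φ '' disc) : φ.push f x = 0 :=
  φ.pushFun_eq_zero f fun h => hx (image_mono f.tsupport_subset h)

theorem push₀_coe (φ : DiscEmb) (f : Test₀) : (φ.push₀ f).1 = φ.push f.1 := rfl

theorem pull_apply (φ : DiscEmb) (u : Harm) {z : ℂ} (hz : z ∈ disc) : (φ.pull u).1 z = u.1 (φ z) :=
  indicator_of_mem hz fun z => u.1 (φ z)

theorem toDist_push₀ (φ : DiscEmb) (f : Test₀) : toDist (φ.push₀ f) = φ.act (toDist f) := by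
  ext u
  change ∫ z, φ.push f.1 z * u.1 z = ∫ z, f.1 z * (φ.pull u).1 z
  rw [integral_push_mul]
  exact f.1.integral_mul_congr fun z hz => (pull_apply φ u hz).symm

theorem pot_push (φ : DiscEmb) (f : Test) (z : ℂ) : pot (φ.push f) z = ∫ w, f w * (green z (φ w) : ℂ) := by
  rw [pot, ← integral_push_mul φ f fun w => (green z w : ℂ)]
  congr 1; funext w; ring

theorem greenForm_push₀ (φ ψ : DiscEmb) (f g : Test₀) : greenForm (φ.push₀ f) (ψ.push₀ g) =
    ∫ z, f.1 z * ∫ w, g.1 w * (green (φ z) (ψ w) : ℂ) := by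
  rw [greenForm_apply, push₀_coe, integral_push_mul, push₀_coe]
  simp only [pot_push]

theorem test_apply_eq_integral_green {h : Test} {z : ℂ} : h z = ∫ w, (lap h).1 w * (green z w : ℂ) := by
  rw [← pot_lapl h.contDiff h.hasCompactSupport z, pot]
  congr 1; funext w
  rw [lap_apply, mul_comm]

end ConfDisk

namespace ConfDisk

open Set Metric MeasureTheory Filter

/-! ### Logarithms of moduli of holomorphic functions -/

theorem dz_add {u v : ℂ → ℂ} {z : ℂ} (hu : DifferentiableAt ℝ u z) (hv : DifferentiableAt ℝ v z) :
    dz (u + v) z = dz u z + dz v z := by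
  rw [dz, dz, dz, fderiv_add hu hv]
  simp only [add_apply]
  ring

theorem dzbar_add {u v : ℂ → ℂ} {z : ℂ} (hu : DifferentiableAt ℝ u z) (hv : DifferentiableAt ℝ v z) :
    dzbar (u + v) z = dzbar u z + dzbar v z := by
  rw [dzbar, dzbar, dzbar, fderiv_add hu hv]
  simp only [add_apply]
  ring

theorem harmonicOnNhd_log_norm {q : ℂ → ℂ} (hq : DifferentiableOn ℂ q disc) (h0 : ∀ w ∈ disc, q w ≠ 0) :
    InnerProductSpace.HarmonicOnNhd (fun w => ((2 * Real.log ‖q w‖ : ℝ) : ℂ)) disc := fun w hw =>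
  ((analyticAt_of_disc hq hw).harmonicAt_log_norm (h0 w hw)).comp_CLM
    (Complex.ofRealCLM.comp ((2 : ℝ) • ContinuousLinearMap.id ℝ ℝ))

/-- The harmonic function `2 log |q|`, for a nowhere vanishing holomorphic function `q` on the disc. -/
noncomputable def Harm.logNorm (q : ℂ → ℂ) (hq : DifferentiableOn ℂ q disc) (h0 : ∀ w ∈ disc, q w ≠ 0) :
    Harm := Harm.mk' _ (harmonicOnNhd_log_norm hq h0)

theorem Harm.logNorm_apply {q : ℂ → ℂ} (hq : DifferentiableOn ℂ q disc) (h0 : ∀ w ∈ disc, q w ≠ 0)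
    {w : ℂ} (hw : w ∈ disc) : (Harm.logNorm q hq h0).1 w = ((2 * Real.log ‖q w‖ : ℝ) : ℂ) :=
  Harm.mk'_apply _ _ hw

theorem Harm.logNorm_eventuallyEq {q : ℂ → ℂ} (hq : DifferentiableOn ℂ q disc)
    (h0 : ∀ w ∈ disc, q w ≠ 0) {b : ℂ} (hb : b ∈ disc) :
    ∃ F : ℂ → ℂ, HasDerivAt F (deriv q b / q b) b ∧
      (Harm.logNorm q hq h0).1 =ᶠ[𝓝 b] F + fun w => conj (F w) := by
  have hqb := h0 b hb
  have hd := (analyticAt_of_disc hq hb).differentiableAt.hasDerivAt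
  -- Dividing by `q b` puts the argument of the logarithm near `1`, where the principal branch is
  -- holomorphic; the real constant `log |q b|` restores the modulus.
  refine ⟨fun w => Complex.log (q w / q b) + (Real.log ‖q b‖ : ℝ), ?_, ?_⟩
  · have := ((hd.div_const (q b)).clog (by
      rw [div_self hqb]; exact Complex.one_mem_slitPlane)).add_const ((Real.log ‖q b‖ : ℝ) : ℂ)
    simpa [div_self hqb] using this
  · have hev : ∀ᶠ w in 𝓝 b, q w ≠ 0 := hd.continuousAt.eventually_ne hqb
    filter_upwards [disc.isOpen.mem_nhds hb, hev] with w hw hqw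
    rw [Harm.logNorm_apply hq h0 hw, Pi.add_apply, Complex.add_conj, Complex.add_re, Complex.log_re,
      Complex.ofReal_re, norm_div, Real.log_div (norm_ne_zero_iff.2 hqw) (norm_ne_zero_iff.2 hqb)]
    push_cast; ring

theorem dzDelta_logNorm {q : ℂ → ℂ} (hq : DifferentiableOn ℂ q disc) (h0 : ∀ w ∈ disc, q w ≠ 0)
    (b : disc) : dzDelta 0 b (Harm.logNorm q hq h0) = -(deriv q b / q b) := by
  obtain ⟨F, hF, h⟩ := Harm.logNorm_eventuallyEq hq h0 b.2
  have hFr : DifferentiableAt ℝ F b := hF.differentiableAt.restrictScalars ℝ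
  have hFc : DifferentiableAt ℝ (fun w => conj (F w)) b :=
    Complex.conjCLE.differentiableAt.comp (b : ℂ) hFr
  change (-1) ^ (0 + 1) * dz^[0 + 1] (Harm.logNorm q hq h0).1 b = _
  rw [(dz_iter_congr h (0 + 1)).eq_of_nhds]
  simp only [zero_add, Function.iterate_one, pow_one]
  rw [dz_add hFr hFc, dz_conj hFr,
    dz_of_differentiableAt hF.differentiableAt, dzbar_of_differentiableAt hF.differentiableAt, hF.deriv]
  simp

theorem dzbarDelta_logNorm {q : ℂ → ℂ} (hq : DifferentiableOn ℂ q disc) (h0 : ∀ w ∈ disc, q w ≠ 0)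
    (b : disc) : dzbarDelta 0 b (Harm.logNorm q hq h0) = -conj (deriv q b / q b) := by
  obtain ⟨F, hF, h⟩ := Harm.logNorm_eventuallyEq hq h0 b.2
  have hFr : DifferentiableAt ℝ F b := hF.differentiableAt.restrictScalars ℝ
  have hFc : DifferentiableAt ℝ (fun w => conj (F w)) b :=
    Complex.conjCLE.differentiableAt.comp (b : ℂ) hFr
  change (-1) ^ (0 + 1) * dzbar^[0 + 1] (Harm.logNorm q hq h0).1 b = _
  rw [(dzbar_iter_congr h (0 + 1)).eq_of_nhds]
  simp only [zero_add, Function.iterate_one, pow_one]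
  rw [dzbar_add hFr hFc, dzbar_conj hFr,
    dz_of_differentiableAt hF.differentiableAt, dzbar_of_differentiableAt hF.differentiableAt, hF.deriv]
  simp

namespace DiscEmb

theorem differentiableOn_dslope (φ : DiscEmb) {z : ℂ} (hz : z ∈ disc) :
    DifferentiableOn ℂ (dslope φ z) disc :=
  (Complex.differentiableOn_dslope (disc.isOpen.mem_nhds hz)).2 φ.differentiableOn'

theorem dslope_ne_zero (φ : DiscEmb) {z : ℂ} (hz : z ∈ disc) : ∀ w ∈ disc, dslope φ z w ≠ 0 := by
  intro w hw
  by_cases h : w = z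
  · subst h
    rw [dslope_same]
    exact φ.deriv_ne_zero' _ hw
  · rw [dslope_of_ne _ h, slope_def_field]
    exact div_ne_zero (sub_ne_zero.2 fun h' => h (φ.injOn' hw hz h')) (sub_ne_zero.2 h)

/-- The harmonic function `2 log |(φ(z) - φ(·)) / (z - ·)|`. -/
noncomputable def logSlope (φ : DiscEmb) (z : disc) : Harm :=
  Harm.logNorm (dslope φ z) (φ.differentiableOn_dslope z.2) (φ.dslope_ne_zero z.2)

theorem green_apply_apply (φ : DiscEmb) {z w : ℂ} (hz : z ∈ disc) (hw : w ∈ disc) (h : w ≠ z) :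
    green (φ z) (φ w) = green z w - (4 * Real.pi)⁻¹ * (2 * Real.log ‖dslope φ z w‖) := by
  have h1 : φ w - φ z = (w - z) * dslope φ z w := by
    rw [← smul_eq_mul, sub_smul_dslope]
  rw [green, green, norm_sub_rev, h1, norm_mul, Real.log_mul (norm_ne_zero_iff.2 (sub_ne_zero.2 h))
    (norm_ne_zero_iff.2 (φ.dslope_ne_zero hz w hw)), norm_sub_rev z w]
  have := Real.pi_ne_zero
  field_simp
  ring

end DiscEmb

theorem Harm.continuousAt (u : Harm) {z : ℂ} (hz : z ∈ disc) : ContinuousAt u.1 z :=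
  (contDiffAt_harm u hz).continuousAt

theorem Test.integrable_mul_harm (f : Test) (u : Harm) : Integrable fun z => f z * u.1 z :=
  f.integrable_mul_of_continuousAt fun _ hz => Harm.continuousAt u (f.tsupport_subset hz)

/-- `G(φ(z), φ(w)) - G(z, w)` is a multiple of the harmonic function `logSlope z` of `w`, so the
correction depends only on the distribution of `g`. -/
theorem integral_mul_green_comp (φ : DiscEmb) (g : Test₀) (z : disc) :
    ∫ w, g.1 w * (green (φ z) (φ w) : ℂ) = pot g.1 z -
      (4 * Real.pi : ℂ)⁻¹ * toDist g (φ.logSlope z) := by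
  have h1 : (fun w => g.1 w * (green (φ z) (φ w) : ℂ)) =ᵐ[volume] fun w => (green z w : ℂ) * g.1 w -
      (4 * Real.pi : ℂ)⁻¹ * (g.1 w * (φ.logSlope z).1 w) := by
    -- At `w = z` both Green functions take the default value of `log 0`, while `logSlope` takes the
    -- true limit there, so this point is discarded.
    filter_upwards [compl_mem_ae_iff.2 (measure_singleton (z : ℂ))] with w hw
    by_cases hwd : w ∈ disc
    · rw [φ.green_apply_apply z.2 hwd hw, DiscEmb.logSlope, Harm.logNorm_apply _ _ hwd]
      push_cast; ring
    · rw [g.1.eq_zero_of_notMem hwd]; ring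
  rw [integral_congr_ae h1, integral_sub (integrable_green_mul g.1.continuous g.1.hasCompactSupport _)
    ((g.1.integrable_mul_harm _).const_mul _), integral_const_mul, toDist_apply, pot]

/-- For `x` outside the image of `ψ`, the function `log |x - ψ(w)|` is already harmonic in `w`, so
no singular part remains. -/
theorem integral_mul_green_of_notMem (ψ : DiscEmb) (g : Test₀) (x : ℂ)
    (h0 : ∀ w ∈ disc, x - ψ w ≠ 0) : ∫ w, g.1 w * (green x (ψ w) : ℂ) =
      -(4 * Real.pi : ℂ)⁻¹ * toDist g (Harm.logNorm (fun w => x - ψ w)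
        (ψ.differentiableOn'.const_sub x) h0) := by
  have h1 : ∫ w, g.1 w * (green x (ψ w) : ℂ) = ∫ w, g.1 w * (-(4 * Real.pi : ℂ)⁻¹ *
      (Harm.logNorm (fun w => x - ψ w) (ψ.differentiableOn'.const_sub x) h0).1 w) := by
    refine g.1.integral_mul_congr fun w hw => ?_
    rw [Harm.logNorm_apply _ _ hw, green]
    push_cast
    have : (Real.pi : ℂ) ≠ 0 := by exact_mod_cast Real.pi_ne_zero
    field_simp
    ring
  rw [h1, toDist_apply, ← integral_const_mul]
  congr 1; funext w; ring

/-- The function `h'` is `h ∘ φ⁻¹` extended by zero. It is obtained from `ker_toDist`, since `W_φ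
Δh` vanishes as a distribution, and then identified pointwise by its Green representation, where all
harmonic corrections vanish. -/
theorem exists_push₀_lap (φ : DiscEmb) (h : Test) : ∃ h' : Test, φ.push₀ (lap h) = lap h' ∧
    (∀ z ∈ disc, h' (φ z) = h z) ∧ ∀ x ∉ φ '' disc, h' x = 0 := by
  have hk : φ.push₀ (lap h) ∈ LinearMap.range lap := by
    rw [← ker_toDist, LinearMap.mem_ker, toDist_push₀, toDist_lap, map_zero]
  obtain ⟨h', hh'⟩ := hk
  have key : ∀ x, h' x = ∫ w, (lap h).1 w * (green x (φ w) : ℂ) := fun x => by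
    rw [← pot_push, ← push₀_coe, ← hh', test_apply_eq_integral_green, pot]
    congr 1; funext w; ring
  refine ⟨h', hh'.symm, fun z hz => ?_, fun x hx => ?_⟩
  · rw [key, integral_mul_green_comp φ (lap h) ⟨z, hz⟩, toDist_lap, test_apply_eq_integral_green (h := h), pot]
    simp only [ZeroMemClass.zero_def]
    change _ - (4 * Real.pi : ℂ)⁻¹ * 0 = _
    rw [mul_zero, sub_zero]
    congr 1; funext w; ring
  · rw [key, integral_mul_green_of_notMem φ (lap h) x, toDist_lap]
    · change _ * (0 : ℂ) = 0
      rw [mul_zero]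
    · intro w hw h0
      exact hx ⟨w, hw, (sub_eq_zero.1 h0).symm⟩

/-- The Green pairing is conformally invariant as soon as one argument is a Laplacian. The change of
`∂_G` under `W_φ` is therefore well defined on `H'(𝔻)₀`. -/
theorem greenForm_push₀_lap (φ : DiscEmb) (h : Test) (g : Test₀) :
    greenForm (φ.push₀ (lap h)) (φ.push₀ g) = greenForm (lap h) g := by
  obtain ⟨h', e, h1, -⟩ := exists_push₀_lap φ h
  rw [e, greenForm_symm, greenForm_lap, greenForm_symm, greenForm_lap, push₀_coe, integral_push_mul]
  exact g.1.integral_mul_congr h1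

/-! ### The conformal pairing -/

theorem exists_toDist_section : ∃ s : HarmDual₀ →ₗ[ℂ] Test₀, toDist ∘ₗ s = LinearMap.id := by
  have : Module.Free ℂ HarmDual₀ := Module.Free.of_divisionRing ℂ HarmDual₀
  have : Module.Projective ℂ HarmDual₀ := inferInstance
  exact LinearMap.exists_rightInverse_of_surjective toDist (LinearMap.range_eq_top.2 toDist_surjective)

/-- A linear section of `toDist`. -/
noncomputable def distSection : HarmDual₀ →ₗ[ℂ] Test₀ := exists_toDist_section.choose

theorem toDist_distSection (T : HarmDual₀) : toDist (distSection T) = T :=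
  LinearMap.congr_fun exists_toDist_section.choose_spec T

/-- The pairing `(f, g) ↦ -4π (∂_G(W_φ f, W_φ g) - ∂_G(f, g))` on `H'(𝔻)₀`. -/
noncomputable def confForm (φ : DiscEmb) : LinearMap.BilinForm ℂ HarmDual₀ :=
  (-4 * Real.pi : ℂ) • (greenForm.compl₁₂ (φ.push₀ ∘ₗ distSection) (φ.push₀ ∘ₗ distSection) -
    greenForm.compl₁₂ distSection distSection)

theorem confForm_symm (φ : DiscEmb) (S T : HarmDual₀) : confForm φ S T = confForm φ T S := by
  simp [confForm, greenForm_symm (φ.push₀ (distSection S)), greenForm_symm (distSection S)]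

theorem confForm_toDist (φ : DiscEmb) (f g : Test₀) : confForm φ (toDist f) (toDist g) =
    (-4 * Real.pi) * (greenForm (φ.push₀ f) (φ.push₀ g) - greenForm f g) := by
  -- The choice of section matters only up to Laplacians, on which the difference of pairings
  -- vanishes. One argument is treated here; symmetry handles the other.
  have key : ∀ f g : Test₀, greenForm (φ.push₀ (distSection (toDist f))) (φ.push₀ g) -
      greenForm (distSection (toDist f)) g = greenForm (φ.push₀ f) (φ.push₀ g) - greenForm f g := by
    intro f g
    have : distSection (toDist f) - f ∈ LinearMap.range lap := by
      rw [← ker_toDist, LinearMap.mem_ker, map_sub, toDist_distSection, sub_self]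
    obtain ⟨h, hh⟩ := this
    rw [← sub_add_cancel (distSection (toDist f)) f, ← hh, map_add, map_add, map_add, LinearMap.add_apply,
      LinearMap.add_apply, greenForm_push₀_lap]
    ring
  have e : confForm φ (toDist f) (toDist g) = (-4 * Real.pi) *
      (greenForm (φ.push₀ (distSection (toDist f))) (φ.push₀ (distSection (toDist g))) -
        greenForm (distSection (toDist f)) (distSection (toDist g))) := by
    simp [confForm]
  rw [e, key, greenForm_symm (φ.push₀ f), greenForm_symm f, key, greenForm_symm (φ.push₀ f),
    greenForm_symm f]

theorem continuous_pot (f : Test) : Continuous (pot f) :=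
  (contDiff_pot f.contDiff f.hasCompactSupport).continuous

theorem Test.integrable_mul_continuous (f : Test) {u : ℂ → ℂ} (hu : Continuous u) :
    Integrable fun z => f z * u z :=
  f.integrable_mul_of_continuousAt fun _ _ => hu.continuousAt

theorem confForm_toDist_eq_integral (φ : DiscEmb) (f g : Test₀) {u : ℂ → ℂ}
    (hu : ∀ z : disc, u z = toDist g (φ.logSlope z)) :
    confForm φ (toDist f) (toDist g) = ∫ z, f.1 z * u z := by
  have hpi : (Real.pi : ℂ) ≠ 0 := by exact_mod_cast Real.pi_ne_zero
  have hpt : ∀ z ∈ disc, pot (φ.push g.1) (φ z) = pot g.1 z - (4 * Real.pi : ℂ)⁻¹ * u z := by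
    intro z hz
    rw [pot_push, integral_mul_green_comp φ g ⟨z, hz⟩, hu ⟨z, hz⟩]
  have hc : ∀ z ∈ tsupport f.1, ContinuousAt (fun z => pot (φ.push g.1) (φ z)) z := fun z hz =>
    (continuous_pot _).continuousAt.comp (φ.analyticAt (f.1.tsupport_subset hz)).continuousAt
  rw [confForm_toDist, greenForm_apply, greenForm_apply, push₀_coe, push₀_coe, integral_push_mul,
    ← integral_sub (f.1.integrable_mul_of_continuousAt hc)
      (f.1.integrable_mul_continuous (continuous_pot _)), ← integral_const_mul]
  congr 1; funext z
  by_cases hz : z ∈ disc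
  · rw [hpt z hz]
    field_simp
    ring
  · rw [f.1.eq_zero_of_notMem hz]; ring

/-- Evaluates `∂_φ(S, T)` by applying `T` in one variable and `S` in the other. Any harmonic `U`
that represents the inner evaluation will do, so test functions representing concrete distributions
never need to be found. -/
theorem confForm_apply (φ : DiscEmb) (S T : HarmDual₀) (U : Harm)
    (hU : ∀ z : disc, U.1 z = T (φ.logSlope z)) : confForm φ S T = S U := by
  obtain ⟨f, rfl⟩ := toDist_surjective S
  obtain ⟨g, rfl⟩ := toDist_surjective T
  rw [confForm_toDist_eq_integral φ f g hU, toDist_apply]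

end ConfDisk

namespace ConfDisk

open Set Metric MeasureTheory Filter

/-! ### The pairing on derivatives of delta functions -/

namespace DiscEmb

/-- The holomorphic function `z ↦ ∂_w log ((φ(z) - φ(w)) / (z - w))` at `w = b`. -/
noncomputable def slopeLogDeriv (φ : DiscEmb) (b z : ℂ) : ℂ := dslope (dslope φ b) b z / dslope φ b z

theorem differentiableOn_slopeLogDeriv (φ : DiscEmb) {b : ℂ} (hb : b ∈ disc) :
    DifferentiableOn ℂ (φ.slopeLogDeriv b) disc :=
  ((Complex.differentiableOn_dslope (disc.isOpen.mem_nhds hb)).2 (φ.differentiableOn_dslope hb)).div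
    (φ.differentiableOn_dslope hb) (φ.dslope_ne_zero hb)

theorem dslope_symm (φ : ℂ → ℂ) (z b : ℂ) : dslope φ z b = dslope φ b z := by
  by_cases h : z = b
  · rw [h]
  · rw [dslope_of_ne _ h, dslope_of_ne _ (Ne.symm h), slope_comm]

/-- Differentiation in the second variable yields an iterated divided difference, which is
holomorphic in `z` also at `z = b`. This keeps the diagonal values within reach of the same formula.
-/
theorem deriv_dslope (φ : DiscEmb) (z : ℂ) {b : ℂ} (hb : b ∈ disc) :
    deriv (dslope φ z) b = dslope (dslope φ b) b z := by
  by_cases h : z = b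
  · rw [h, dslope_same]
  · have hev : dslope φ z =ᶠ[𝓝 b] fun w => (φ w - φ z) / (w - z) := by
      filter_upwards [isOpen_ne.mem_nhds (Ne.symm h)] with w hw
      rw [dslope_of_ne _ hw, slope_def_field]
    have hd := (φ.analyticAt hb).differentiableAt.hasDerivAt
    have hbz : b - z ≠ 0 := sub_ne_zero.2 (Ne.symm h)
    have hzb : z - b ≠ 0 := sub_ne_zero.2 h
    have h1 := ((hd.sub_const (φ z)).div ((hasDerivAt_id b).sub_const z) hbz)
    have h2 : deriv (fun w => (φ w - φ z) / (w - z)) b = _ := h1.deriv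
    rw [hev.deriv_eq, h2, dslope_of_ne _ h, slope_def_field, dslope_of_ne _ h, slope_def_field,
      dslope_same]
    have e : z - b = -(b - z) := by ring
    simp only [_root_.id]
    rw [e]
    field_simp
    ring

theorem slopeLogDeriv_of_ne (φ : DiscEmb) {b z : ℂ} (hb : b ∈ disc) (hz : z ∈ disc) (h : z ≠ b) :
    φ.slopeLogDeriv b z = 1 / (z - b) - deriv φ b / (φ z - φ b) := by
  have h1 : z - b ≠ 0 := sub_ne_zero.2 h
  have h2 : φ z - φ b ≠ 0 := sub_ne_zero.2 fun h' => h (φ.injOn' hz hb h')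
  rw [slopeLogDeriv, dslope_of_ne _ h, slope_def_field, dslope_of_ne _ h, slope_def_field, dslope_same]
  field_simp

theorem deriv_slopeLogDeriv (φ : DiscEmb) {b z : ℂ} (hb : b ∈ disc) (hz : z ∈ disc) (h : z ≠ b) :
    deriv (φ.slopeLogDeriv b) z = deriv φ z * deriv φ b / (φ z - φ b) ^ 2 - 1 / (z - b) ^ 2 := by
  have hev : φ.slopeLogDeriv b =ᶠ[𝓝 z] fun w => 1 / (w - b) - deriv φ b / (φ w - φ b) := by
    filter_upwards [isOpen_ne.mem_nhds h, disc.isOpen.mem_nhds hz] with w hw hwd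
    exact φ.slopeLogDeriv_of_ne hb hwd hw
  have h1 : z - b ≠ 0 := sub_ne_zero.2 h
  have h2 : φ z - φ b ≠ 0 := sub_ne_zero.2 fun h' => h (φ.injOn' hz hb h')
  have hd := (φ.analyticAt hz).differentiableAt.hasDerivAt
  have h3 := ((hasDerivAt_const z (1 : ℂ)).div ((hasDerivAt_id z).sub_const b) h1).sub
    ((hasDerivAt_const z (deriv φ b)).div (hd.sub_const (φ b)) h2)
  have h4 : deriv (fun w => 1 / (w - b) - deriv φ b / (φ w - φ b)) z = _ := h3.deriv
  rw [hev.deriv_eq, h4]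
  simp only [_root_.id]
  field_simp
  ring

theorem dzDelta_logSlope (φ : DiscEmb) (b z : disc) :
    dzDelta 0 b (φ.logSlope z) = -φ.slopeLogDeriv b z := by
  rw [logSlope, dzDelta_logNorm, φ.deriv_dslope z b.2, dslope_symm φ z b, slopeLogDeriv]

theorem dzbarDelta_logSlope (φ : DiscEmb) (b z : disc) :
    dzbarDelta 0 b (φ.logSlope z) = -conj (φ.slopeLogDeriv b z) := by
  rw [logSlope, dzbarDelta_logNorm, φ.deriv_dslope z b.2, dslope_symm φ z b, slopeLogDeriv]

end DiscEmb

theorem confForm_dzDelta_right (φ : DiscEmb) (S : HarmDual₀) (b : disc) :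
    confForm φ S (dzDelta 0 b) =
      S (Harm.hol (fun z => -φ.slopeLogDeriv b z) (φ.differentiableOn_slopeLogDeriv b.2).neg) :=
  confForm_apply φ S _ _ fun z => by
    rw [φ.dzDelta_logSlope]; exact Harm.mk'_apply _ _ z.2

theorem confForm_dzbarDelta_right (φ : DiscEmb) (S : HarmDual₀) (b : disc) :
    confForm φ S (dzbarDelta 0 b) =
      S (Harm.anti (fun z => -φ.slopeLogDeriv b z) (φ.differentiableOn_slopeLogDeriv b.2).neg) :=
  confForm_apply φ S _ _ fun z => by
    rw [φ.dzbarDelta_logSlope, ← map_neg]; exact Harm.mk'_apply _ _ z.2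

theorem confForm_dzDelta (φ : DiscEmb) (a b : disc) :
    confForm φ (dzDelta 0 a) (dzDelta 0 b) = deriv (φ.slopeLogDeriv b) a := by
  rw [confForm_dzDelta_right, dzDelta_hol]
  simp [iteratedDeriv_one]

theorem confForm_dzbarDelta (φ : DiscEmb) (a b : disc) :
    confForm φ (dzbarDelta 0 a) (dzbarDelta 0 b) = conj (deriv (φ.slopeLogDeriv b) a) := by
  rw [confForm_dzbarDelta_right, dzbarDelta_anti]
  simp [iteratedDeriv_one]

theorem pull_hol (φ : DiscEmb) (F : ℂ → ℂ) (hF : DifferentiableOn ℂ F disc) :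
    φ.pull (Harm.hol F hF) = Harm.hol (F ∘ φ) (hF.comp φ.differentiableOn' φ.mapsTo') :=
  Harm.ext fun z hz => by
    rw [pull_apply φ _ hz]
    rw [Harm.hol, Harm.hol, Harm.mk'_apply _ _ (φ.mapsTo' hz), Harm.mk'_apply _ _ hz, Function.comp_apply]

theorem pull_anti (φ : DiscEmb) (F : ℂ → ℂ) (hF : DifferentiableOn ℂ F disc) :
    φ.pull (Harm.anti F hF) = Harm.anti (F ∘ φ) (hF.comp φ.differentiableOn' φ.mapsTo') :=
  Harm.ext fun z hz => by
    rw [pull_apply φ _ hz]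
    rw [Harm.anti, Harm.anti, Harm.mk'_apply _ _ (φ.mapsTo' hz), Harm.mk'_apply _ _ hz, Function.comp_apply]

theorem HarmDual₀.map_add' (T : HarmDual₀) (u v : Harm) : T (u + v) = T u + T v := map_add T.1.1 u v

theorem act_dzDelta (φ : DiscEmb) (a : disc) :
    φ.act (dzDelta 0 a) = deriv φ a • dzDelta 0 (φ.map a) := by
  ext u
  change dzDelta 0 a (φ.pull u) = deriv φ a * dzDelta 0 (φ.map a) u
  obtain ⟨F, G, hF, hG, rfl⟩ := Harm.exists_hol_add_anti u
  rw [map_add, HarmDual₀.map_add', HarmDual₀.map_add', pull_hol, pull_anti, dzDelta_anti, dzDelta_anti,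
    dzDelta_hol, dzDelta_hol]
  simp only [zero_add, iteratedDeriv_one]
  rw [deriv_comp (a : ℂ) (analyticAt_of_disc hF (φ.mapsTo' a.2)).differentiableAt
    (φ.analyticAt a.2).differentiableAt]
  change _ = deriv φ a * (_ * deriv F (φ a) + 0)
  ring

/-! ### The Green pairing of two disjoint discs -/

/-- On disjoint images the Green function has no singularity and is harmonic in each variable, so
the two distributions are applied to it one after the other; nothing has to be subtracted. -/
theorem greenForm_push₀_of_disjoint (φ ψ : DiscEmb) (hd : Disjoint (φ '' disc) (ψ '' disc)) (a b : disc)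
    {f g : Test₀} (hf : toDist f = dzDelta 0 a) (hg : toDist g = dzDelta 0 b) :
    (-4 * Real.pi) * greenForm (φ.push₀ f) (ψ.push₀ g) =
      deriv φ a * deriv ψ b / (φ a - ψ b) ^ 2 := by
  have hne : ∀ z ∈ disc, ∀ w ∈ disc, φ z - ψ w ≠ 0 := fun z hz w hw h =>
    Set.disjoint_left.1 hd ⟨z, hz, rfl⟩ ⟨w, hw, (sub_eq_zero.1 h).symm⟩
  have hF : DifferentiableOn ℂ (fun z => deriv ψ b / (φ z - ψ b)) disc :=
    (differentiableOn_const _).div (φ.differentiableOn'.sub_const _) fun z hz => hne z hz b b.2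
  have h1 : ∀ z ∈ disc, ∫ w, g.1 w * (green (φ z) (ψ w) : ℂ) =
      -(4 * Real.pi : ℂ)⁻¹ * (Harm.hol _ hF).1 z := by
    intro z hz
    rw [integral_mul_green_of_notMem ψ g (φ z) (hne z hz), hg, dzDelta_logNorm, deriv_const_sub,
      Harm.hol, Harm.mk'_apply _ _ hz]
    ring
  have h2 : greenForm (φ.push₀ f) (ψ.push₀ g) = -(4 * Real.pi : ℂ)⁻¹ * toDist f (Harm.hol _ hF) := by
    rw [greenForm_push₀, f.1.integral_mul_congr h1, toDist_apply, ← integral_const_mul]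
    congr 1; funext z; ring
  have hda := (φ.analyticAt a.2).differentiableAt.hasDerivAt
  have h3 : deriv (fun z => deriv ψ b / (φ z - ψ b)) a = _ :=
    ((hasDerivAt_const (a : ℂ) (deriv ψ b)).div (hda.sub_const (ψ b)) (hne a a.2 b b.2)).deriv
  rw [h2, hf, dzDelta_hol, zero_add, iteratedDeriv_one, h3]
  have : (Real.pi : ℂ) ≠ 0 := by exact_mod_cast Real.pi_ne_zero
  have := hne a a.2 b b.2
  field_simp
  ring

end ConfDisk

namespace ConfDisk

open Set Metric MeasureTheory Filter

/-! ### Harmonicity of the potential difference -/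

theorem lapl_eq_fderiv_fderiv {u : ℂ → ℂ} {z : ℂ} (hu : ContDiffAt ℝ 2 u z) :
    lapl u z = -(fderiv ℝ (fderiv ℝ u) z 1 1 + fderiv ℝ (fderiv ℝ u) z Complex.I Complex.I) := by
  have h1 : DifferentiableAt ℝ (fderiv ℝ u) z :=
    (hu.fderiv_right (m := 1) (by norm_num)).differentiableAt (by norm_num)
  have h2 : ∀ v : ℂ, fderiv ℝ (fun y => fderiv ℝ u y v) z v = fderiv ℝ (fderiv ℝ u) z v v := by
    intro v
    rw [fderiv_clm_apply h1 (differentiableAt_const v)]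
    simp
  rw [lapl, h2, h2]

theorem laplacian_eq_neg_lapl {u : ℂ → ℂ} {z : ℂ} (hu : ContDiffAt ℝ 2 u z) :
    Laplacian.laplacian u z = -lapl u z := by
  rw [InnerProductSpace.laplacian_eq_iteratedFDeriv_complexPlane, lapl_eq_fderiv_fderiv hu, neg_neg]
  simp [iteratedFDeriv_two_apply]

/-- Multiplication by `c` is `|c|` times a rotation, and the trace of a bilinear form is rotation
invariant. Symmetry of `B` is not needed, since the mixed terms cancel. -/
theorem bilin_conformal (B : ℂ →L[ℝ] ℂ →L[ℝ] ℂ) (c : ℂ) :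
    B c c + B (Complex.I * c) (Complex.I * c) = ((‖c‖ ^ 2 : ℝ) : ℂ) * (B 1 1 + B Complex.I Complex.I) := by
  have h1 : c = c.re • (1 : ℂ) + c.im • Complex.I := by
    apply Complex.ext <;> simp
  have h2 : Complex.I * c = (-c.im) • (1 : ℂ) + c.re • Complex.I := by
    apply Complex.ext <;> simp
  rw [h2, norm_sq_eq]
  -- The real and imaginary parts of `c` become independent variables, so that substituting for `c`
  -- does not rewrite inside them.
  clear h2
  generalize c.re = x at h1 ⊢
  generalize c.im = y at h1 ⊢
  rw [h1]
  simp only [map_add, map_smul, add_apply, smul_apply]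
  simp only [Complex.real_smul]
  push_cast
  ring

/-- The first-order terms cancel in the trace: they are the differential of `v` at `φ''·1·1` and at
`φ''·i·i = -φ''`. -/
theorem lapl_comp_holomorphic {v φ : ℂ → ℂ} {z : ℂ} (hv : ContDiff ℝ ∞ v) (hφ : AnalyticAt ℂ φ z) :
    lapl (fun w => v (φ w)) z = ((‖deriv φ z‖ ^ 2 : ℝ) : ℂ) * lapl v (φ z) := by
  have hv1 : Differentiable ℝ v := hv.differentiable (by simp)
  have hv2 : Differentiable ℝ (fderiv ℝ v) := (hv.fderiv_right (m := 1) (by norm_cast)).differentiable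
    (by norm_num)
  have key : ∀ p : ℂ, fderiv ℝ (fun y => fderiv ℝ (fun w => v (φ w)) y p) z p =
      fderiv ℝ (fderiv ℝ v) (φ z) (deriv φ z * p) (deriv φ z * p) +
        fderiv ℝ v (φ z) (deriv (deriv φ) z * p * p) := by
    intro p
    have hev : (fun y => fderiv ℝ (fun w => v (φ w)) y p) =ᶠ[𝓝 z]
        fun y => fderiv ℝ v (φ y) (deriv φ y * p) := by
      filter_upwards [eventually_differentiableAt hφ] with y hy
      have h1 := (hv1 (φ y)).hasFDerivAt.comp y (hy.hasDerivAt.hasFDerivAt.restrictScalars ℝ)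
      have h2 : fderiv ℝ (fun w => v (φ w)) y = _ := h1.fderiv
      rw [h2]
      simp [mul_comm]
    have hφr := hφ.differentiableAt.hasDerivAt.hasFDerivAt.restrictScalars ℝ
    have h3 := (hv2 (φ z)).hasFDerivAt.comp z hφr
    have h4 := ((hφ.deriv.differentiableAt.hasDerivAt.mul_const p).hasFDerivAt.restrictScalars ℝ)
    have h5 : fderiv ℝ (fun y => fderiv ℝ v (φ y) (deriv φ y * p)) z = _ := (h3.clm_apply h4).fderiv
    rw [hev.fderiv_eq, h5]
    simp [mul_comm, add_comm]
  have e := bilin_conformal (fderiv ℝ (fderiv ℝ v) (φ z)) (deriv φ z)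
  rw [lapl, key, key, lapl_eq_fderiv_fderiv (hv.contDiffAt.of_le (by norm_cast)), mul_neg, ← e,
    mul_one, mul_one, mul_one, mul_assoc, Complex.I_mul_I, mul_comm Complex.I, mul_neg_one, map_neg]
  ring

/-- For `T` represented by `g`, the function is `4π` times `pot g - pot (W_φ g) ∘ φ`. The Laplacian
of the second term is `|φ'|² · |φ'|⁻² g`, which cancels that of the first, so no differentiation
under an integral sign is needed. -/
theorem exists_harm_logSlope (φ : DiscEmb) (T : HarmDual₀) :
    ∃ U : Harm, ∀ z : disc, U.1 z = T (φ.logSlope z) := by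
  obtain ⟨g, rfl⟩ := toDist_surjective T
  set v := pot (φ.push g.1) with hv
  set u := pot g.1 with hu
  have hvc : ContDiff ℝ ∞ v := contDiff_pot (φ.push g.1).contDiff (φ.push g.1).hasCompactSupport
  have huc : ContDiff ℝ ∞ u := contDiff_pot g.1.contDiff g.1.hasCompactSupport
  have hpi : (Real.pi : ℂ) ≠ 0 := by exact_mod_cast Real.pi_ne_zero
  have hvφ : ∀ z ∈ disc, ContDiffAt ℝ 2 (fun w => v (φ w)) z := fun z hz =>
    (hvc.contDiffAt.of_le (by norm_cast)).comp z ((φ.contDiffAt hz).of_le (by norm_cast))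
  have hu2 : ∀ z, ContDiffAt ℝ 2 u z := fun z => huc.contDiffAt.of_le (by norm_cast)
  have hH : InnerProductSpace.HarmonicOnNhd (u - fun w => v (φ w)) disc := by
    intro z hz
    refine ⟨(hu2 z).sub (hvφ z hz), ?_⟩
    filter_upwards [disc.isOpen.mem_nhds hz] with w hw
    rw [(hu2 w).laplacian_sub (hvφ w hw), laplacian_eq_neg_lapl (hu2 w), laplacian_eq_neg_lapl (hvφ w hw),
      lapl_comp_holomorphic hvc (φ.analyticAt hw), hu, hv,
      lapl_pot g.1.contDiff g.1.hasCompactSupport,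
      lapl_pot (φ.push g.1).contDiff (φ.push g.1).hasCompactSupport]
    have h3 : φ.push g.1 (φ w) = (((‖deriv φ w‖ ^ 2)⁻¹ : ℝ) : ℂ) * g.1 w := φ.pushFun_apply _ hw
    have h4 : (‖deriv φ w‖ : ℂ) ≠ 0 := by simpa using φ.deriv_ne_zero' w hw
    rw [h3]
    push_cast
    field_simp
    simp
  refine ⟨(4 * Real.pi : ℂ) • Harm.mk' _ hH, fun z => ?_⟩
  change (4 * Real.pi : ℂ) * (Harm.mk' _ hH).1 z = _
  rw [Harm.mk'_apply _ _ z.2, Pi.sub_apply, hv, pot_push, integral_mul_green_comp]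
  field_simp
  ring

/-- With `U` the evaluation of `dzbarDelta m b`, symmetry turns `∂_z U` at any point into an
antiholomorphic derivative of a holomorphic function. Thus `∂_z U = 0` on the disc and all its
further derivatives vanish. -/
theorem confForm_dzDelta_dzbarDelta (φ : DiscEmb) (a b : disc) (n m : ℕ) :
    confForm φ (dzDelta n a) (dzbarDelta m b) = 0 := by
  obtain ⟨U, hU⟩ := exists_harm_logSlope φ (dzbarDelta m b)
  have h1 : ∀ z : disc, dz U.1 z = 0 := by
    intro z
    have h2 : dzDelta 0 z U = 0 := by
      rw [← confForm_apply φ _ _ U hU, confForm_symm, confForm_dzDelta_right, dzbarDelta_hol]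
    have h3 : dzDelta 0 z U = -dz U.1 z := by
      change (-1) ^ (0 + 1) * dz^[0 + 1] U.1 z = _
      simp
    rw [h3] at h2
    exact neg_eq_zero.1 h2
  have hev : dz U.1 =ᶠ[𝓝 (a : ℂ)] fun _ => 0 := by
    filter_upwards [disc.isOpen.mem_nhds a.2] with z hz
    exact h1 ⟨z, hz⟩
  rw [confForm_apply φ _ _ U hU]
  change (-1) ^ (n + 1) * dz^[n + 1] U.1 a = 0
  rw [Function.iterate_succ_apply, (dz_iter_congr hev n).eq_of_nhds, dz_iter_zero, mul_zero]

/-! ### Continuity of holomorphic families at the diagonal -/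

/-- By the maximum principle, `Q w - Q a` is controlled on a disc by its values on the boundary
circle, and compactness makes these uniformly small. Thus explicit formulas away from the diagonal
imply joint continuity on it. -/
theorem continuousAt_of_continuousOn_sphere {Q : ℂ → ℂ → ℂ} {a : ℂ} {r : ℝ} (hr : 0 < r)
    (hQ : ∀ w ∈ ball a (r / 2), DifferentiableOn ℂ (Q w) (closedBall a r))
    (hc : ContinuousOn (fun p : ℂ × ℂ => Q p.1 p.2) (ball a (r / 2) ×ˢ sphere a r)) :
    ContinuousAt (fun p : ℂ × ℂ => Q p.1 p.2) (a, a) := by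
  have ha : a ∈ ball a (r / 2) := mem_ball_self (half_pos hr)
  rw [Metric.continuousAt_iff']
  intro ε hε
  obtain ⟨v, hv, h⟩ := (isCompact_sphere a r).mem_uniformity_of_prod (f := Q) hc ha
    (dist_mem_uniformity (half_pos hε))
  rw [isOpen_ball.nhdsWithin_eq ha] at hv
  have h1 : ∀ᶠ z in 𝓝 a, dist (Q a z) (Q a a) < ε / 2 :=
    Metric.continuousAt_iff'.1 ((hQ a ha).continuousOn.continuousAt (closedBall_mem_nhds a hr)) _ (half_pos hε)
  rw [nhds_prod_eq]
  filter_upwards [prod_mem_prod (inter_mem hv (isOpen_ball.mem_nhds ha))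
    (inter_mem h1 (closedBall_mem_nhds a hr))]
  rintro ⟨w, z⟩ ⟨⟨hw, hwb⟩, hz, hzb⟩
  have h2 : ‖Q w z - Q a z‖ ≤ ε / 2 := by
    refine Complex.norm_le_of_forall_mem_frontier_norm_le (f := fun z => Q w z - Q a z)
      (U := ball a r) isBounded_ball ?_ ?_ ?_
    · exact (((hQ w hwb).sub (hQ a ha)).diffContOnCl_ball subset_rfl)
    · intro ζ hζ
      rw [frontier_ball a hr.ne'] at hζ
      rw [← dist_eq_norm]
      exact (h w hw ζ hζ).le
    · rwa [closure_ball a hr.ne']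
  calc dist (Q w z) (Q a a) ≤ dist (Q w z) (Q a z) + dist (Q a z) (Q a a) := dist_triangle _ _ _
    _ < ε / 2 + ε / 2 := by rw [dist_eq_norm (Q w z)]; exact add_lt_add_of_le_of_lt h2 hz
    _ = ε := add_halves ε

theorem exists_closedBall_subset_disc {a : ℂ} (ha : a ∈ disc) : ∃ r, 0 < r ∧ closedBall a r ⊆ disc :=
  Metric.nhds_basis_closedBall.mem_iff.1 (disc.isOpen.mem_nhds ha)

theorem ne_of_mem_ball_of_mem_sphere {a w z : ℂ} {r : ℝ} (hr : 0 < r) (hw : w ∈ ball a (r / 2))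
    (hz : z ∈ sphere a r) : z ≠ w := by
  rintro rfl
  rw [mem_ball] at hw
  rw [mem_sphere] at hz
  linarith

namespace DiscEmb

theorem continuousAt_deriv_slopeLogDeriv (φ : DiscEmb) (a : disc) :
    ContinuousAt (fun p : ℂ × ℂ => deriv (φ.slopeLogDeriv p.1) p.2) ((a : ℂ), (a : ℂ)) := by
  obtain ⟨r, hr, hs⟩ := exists_closedBall_subset_disc a.2
  have hb : ball (a : ℂ) (r / 2) ⊆ disc := fun w hw => hs (ball_subset_closedBall
    (ball_subset_ball (half_le_self hr.le) hw))
  have hdφ : ContinuousOn (deriv φ) disc := (φ.differentiableOn'.deriv disc.isOpen).continuousOn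
  have hcφ : ContinuousOn φ disc := φ.differentiableOn'.continuousOn
  refine continuousAt_of_continuousOn_sphere (Q := fun w z => deriv (φ.slopeLogDeriv w) z) hr
    (fun w hw => ((φ.differentiableOn_slopeLogDeriv (hb hw)).deriv disc.isOpen).mono hs) ?_
  have h1 : MapsTo Prod.fst (ball (a : ℂ) (r / 2) ×ˢ sphere (a : ℂ) r) disc := fun p hp => hb hp.1
  have h2 : MapsTo Prod.snd (ball (a : ℂ) (r / 2) ×ˢ sphere (a : ℂ) r) disc := fun p hp =>
    hs (sphere_subset_closedBall hp.2)
  have c1 := hdφ.comp continuousOn_fst h1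
  have c2 := hdφ.comp continuousOn_snd h2
  have c3 := hcφ.comp continuousOn_fst h1
  have c4 := hcφ.comp continuousOn_snd h2
  refine (((c2.mul c1).div ((c4.sub c3).pow 2) fun p hp => ?_).sub
    (continuousOn_const.div ((continuousOn_snd.sub continuousOn_fst).pow 2) fun p hp => ?_)).congr
      fun p hp => φ.deriv_slopeLogDeriv (h1 hp) (h2 hp) (ne_of_mem_ball_of_mem_sphere hr hp.1 hp.2)
  · exact pow_ne_zero 2 (sub_ne_zero.2 fun h => ne_of_mem_ball_of_mem_sphere hr hp.1 hp.2
      (φ.injOn' (h2 hp) (h1 hp) h))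
  · exact pow_ne_zero 2 (sub_ne_zero.2 (ne_of_mem_ball_of_mem_sphere hr hp.1 hp.2))

/-- The off-diagonal expression is the derivative of `slopeLogDeriv`, which is jointly continuous at
`(a, a)`; the limit is therefore its value there. -/
theorem tendsto_slopeLogDeriv (φ : DiscEmb) (a : disc) : Tendsto (fun p : ℂ × ℂ =>
      deriv φ p.1 * deriv φ p.2 / (φ p.1 - φ p.2) ^ 2 - 1 / (p.1 - p.2) ^ 2)
    (𝓝[{p | p.1 ≠ p.2}] ((a : ℂ), (a : ℂ))) (𝓝 (deriv (φ.slopeLogDeriv a) a)) := by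
  refine ((φ.continuousAt_deriv_slopeLogDeriv a).tendsto.mono_left nhdsWithin_le_nhds).congr' ?_
  have hd : ((disc : Set ℂ) ×ˢ (disc : Set ℂ)) ∈ 𝓝[{p | p.1 ≠ p.2}] ((a : ℂ), (a : ℂ)) :=
    mem_nhdsWithin_of_mem_nhds ((disc.isOpen.prod disc.isOpen).mem_nhds ⟨a.2, a.2⟩)
  filter_upwards [hd, self_mem_nhdsWithin] with p hp hne
  rw [φ.deriv_slopeLogDeriv hp.1 hp.2 (Ne.symm hne), ← neg_sub (φ p.1), ← neg_sub p.1, neg_sq, neg_sq,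
    mul_comm (deriv φ p.1)]

theorem continuousOn_dslope (φ : DiscEmb) :
    ContinuousOn (fun p : ℂ × ℂ => dslope φ p.1 p.2) ((disc : Set ℂ) ×ˢ (disc : Set ℂ)) := by
  have hcφ : ContinuousOn φ disc := φ.differentiableOn'.continuousOn
  have hq : ContinuousOn (fun p : ℂ × ℂ => (φ p.2 - φ p.1) / (p.2 - p.1))
      (((disc : Set ℂ) ×ˢ (disc : Set ℂ)) ∩ {p | p.2 ≠ p.1}) :=
    ((hcφ.comp continuousOn_snd fun p hp => hp.1.2).sub
      (hcφ.comp continuousOn_fst fun p hp => hp.1.1)).div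
      (continuousOn_snd.sub continuousOn_fst) fun p hp => sub_ne_zero.2 hp.2
  have hqd : ContinuousOn (fun p : ℂ × ℂ => dslope φ p.1 p.2)
      (((disc : Set ℂ) ×ˢ (disc : Set ℂ)) ∩ {p | p.2 ≠ p.1}) := hq.congr fun p hp => by
    simp only [dslope_of_ne _ hp.2, slope_def_field]
  rintro ⟨w, z⟩ ⟨hw, hz⟩
  refine ContinuousAt.continuousWithinAt ?_
  by_cases h : z = w
  · subst h
    obtain ⟨r, hr, hs⟩ := exists_closedBall_subset_disc hz
    have hb : ball z (r / 2) ⊆ disc := fun w hw => hs (ball_subset_closedBall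
      (ball_subset_ball (half_le_self hr.le) hw))
    refine continuousAt_of_continuousOn_sphere (Q := fun w z => dslope φ w z) hr
      (fun w hw => (φ.differentiableOn_dslope (hb hw)).mono hs) (hqd.mono fun p hp => ?_)
    exact ⟨⟨hb hp.1, hs (sphere_subset_closedBall hp.2)⟩, ne_of_mem_ball_of_mem_sphere hr hp.1 hp.2⟩
  · exact hqd.continuousAt (((disc.isOpen.prod disc.isOpen).inter
      (isOpen_ne_fun continuous_snd continuous_fst)).mem_nhds ⟨⟨hw, hz⟩, h⟩)

end DiscEmb

end ConfDisk

namespace ConfDisk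

open Set Metric MeasureTheory Filter

/-! ### The cocycle `H_φ` -/

theorem cocycle_of_ne (φ : DiscEmb) {z w : ℂ} (hz : z ∈ disc) (hw : w ∈ disc) (h : w ≠ z) :
    cocycle φ z w = Real.log ‖dslope φ z w‖ - (1 / 2) * Real.log ‖deriv φ z‖ -
      (1 / 2) * Real.log ‖deriv φ w‖ := by
  have h1 : φ w - φ z = (w - z) * dslope φ z w := by
    rw [← smul_eq_mul, sub_smul_dslope]
  rw [cocycle, norm_sub_rev (φ z), h1, norm_mul, Real.log_mul (norm_ne_zero_iff.2 (sub_ne_zero.2 h))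
    (norm_ne_zero_iff.2 (φ.dslope_ne_zero hz w hw)), norm_sub_rev z w]
  ring

/-- The continuous extension of `H_φ` to the diagonal. -/
noncomputable def cocycleExt (φ : DiscEmb) (z w : ℂ) : ℝ :=
  Real.log ‖dslope φ z w‖ - (1 / 2) * Real.log ‖deriv φ z‖ - (1 / 2) * Real.log ‖deriv φ w‖

theorem DiscEmb.continuousOn_log_deriv (φ : DiscEmb) :
    ContinuousOn (fun z => Real.log ‖deriv φ z‖) disc :=
  (φ.differentiableOn'.deriv disc.isOpen).continuousOn.norm.log fun z hz =>
    norm_ne_zero_iff.2 (φ.deriv_ne_zero' z hz)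

theorem continuousOn_cocycleExt (φ : DiscEmb) :
    ContinuousOn (fun p : ℂ × ℂ => cocycleExt φ p.1 p.2) ((disc : Set ℂ) ×ˢ (disc : Set ℂ)) :=
  ((φ.continuousOn_dslope.norm.log fun _ hp => norm_ne_zero_iff.2 (φ.dslope_ne_zero hp.1 _ hp.2)).sub
    ((φ.continuousOn_log_deriv.comp continuousOn_fst fun _ hp => hp.1).const_mul _)).sub
    ((φ.continuousOn_log_deriv.comp continuousOn_snd fun _ hp => hp.2).const_mul _)

theorem Test.integrable_mul_mul {P : ℂ → ℂ → ℝ} (f g : Test)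
    (hP : ContinuousOn (fun p : ℂ × ℂ => P p.1 p.2) ((disc : Set ℂ) ×ˢ (disc : Set ℂ))) :
    Integrable (fun p : ℂ × ℂ => (P p.1 p.2 : ℂ) * f p.1 * g p.2) := by
  have hK : IsCompact (tsupport f ×ˢ tsupport g) := f.hasCompactSupport.isCompact.prod
    g.hasCompactSupport.isCompact
  refine (integrableOn_iff_integrable_of_support_subset (s := tsupport f ×ˢ tsupport g) ?_).1 ?_
  · intro p hp
    refine ⟨subset_tsupport _ fun h => hp ?_, subset_tsupport _ fun h => hp ?_⟩
    · simp only [h]; ring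
    · simp only [h]; ring
  · refine ContinuousOn.integrableOn_compact hK ?_
    refine ((Complex.continuous_ofReal.comp_continuousOn (hP.mono
      (prod_mono f.tsupport_subset g.tsupport_subset))).mul
      (f.continuous.comp continuous_fst).continuousOn).mul
      (g.continuous.comp continuous_snd).continuousOn

theorem measure_diagonal : (volume : Measure (ℂ × ℂ)) {p | p.1 = p.2} = 0 := by
  have hm : MeasurableSet {p : ℂ × ℂ | p.1 = p.2} := (isClosed_eq continuous_fst continuous_snd).measurableSet
  rw [Measure.volume_eq_prod, Measure.measure_prod_null hm]
  refine .of_forall fun z => ?_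
  refine measure_mono_null (t := {z}) (fun w hw => ?_) (measure_singleton z)
  exact (show z = w from hw).symm

/-- `H_φ` agrees with its continuous extension off the diagonal, a null set, and continuity on the
compact supports permits Fubini. -/
theorem kernelPairing_cocycle (φ : DiscEmb) (f g : Test) : kernelPairing (cocycle φ) f g =
    ∫ z, f z * ∫ w, g w * (cocycleExt φ z w : ℂ) := by
  have hi := f.integrable_mul_mul g (continuousOn_cocycleExt φ)
  have hne : ∀ᵐ p : ℂ × ℂ, p.1 ≠ p.2 := by
    rw [ae_iff]
    simpa using measure_diagonal
  have h1 : kernelPairing (cocycle φ) f g = ∫ p : ℂ × ℂ, (cocycleExt φ p.1 p.2 : ℂ) * f p.1 * g p.2 := by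
    rw [kernelPairing, ← setIntegral_eq_integral_of_forall_compl_eq_zero
      (s := (disc : Set ℂ) ×ˢ (disc : Set ℂ))
      (f := fun p : ℂ × ℂ => (cocycleExt φ p.1 p.2 : ℂ) * f p.1 * g p.2)]
    · refine setIntegral_congr_ae (disc.isOpen.prod disc.isOpen).measurableSet ?_
      filter_upwards [hne] with p hp hpd
      rw [cocycle_of_ne φ hpd.1 hpd.2 hp.symm, cocycleExt]
    · intro p hp
      by_cases h : p.1 ∈ disc
      · rw [g.eq_zero_of_notMem fun h' => hp ⟨h, h'⟩, mul_zero]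
      · rw [f.eq_zero_of_notMem h, mul_zero, zero_mul]
  rw [h1]
  rw [Measure.volume_eq_prod] at hi ⊢
  rw [integral_prod _ hi]
  congr 1; funext z
  rw [← integral_const_mul]
  congr 1; funext w
  ring

/-- `H_φ` differs from half of `logSlope` by the terms `½ log |φ'|`, each a function of one variable
alone, which test functions of integral zero do not see. -/
theorem confForm_toDist_eq_kernelPairing (φ : DiscEmb) (f g : Test₀) :
    confForm φ (toDist f) (toDist g) =
      (-4 * Real.pi) * (-(2 * Real.pi)⁻¹ * kernelPairing (cocycle φ) f g) := by
  obtain ⟨U, hU⟩ := exists_harm_logSlope φ (toDist g)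
  have hpi : (Real.pi : ℂ) ≠ 0 := by exact_mod_cast Real.pi_ne_zero
  let α : ℂ → ℂ := fun w => (((1 / 2) * Real.log ‖deriv φ w‖ : ℝ) : ℂ)
  have hα : ContinuousOn α disc :=
    Complex.continuous_ofReal.comp_continuousOn (φ.continuousOn_log_deriv.const_mul _)
  have hα' : ∀ f : Test, Integrable fun w => f w * α w := fun f =>
    f.integrable_mul_of_continuousAt fun z hz =>
      hα.continuousAt (disc.isOpen.mem_nhds (f.tsupport_subset hz))
  have h1 : ∀ z ∈ disc, ∫ w, g.1 w * (cocycleExt φ z w : ℂ) =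
      (1 / 2) * U.1 z - ∫ w, g.1 w * α w := by
    intro z hz
    have hc : ∀ w ∈ disc, (cocycleExt φ z w : ℂ) =
        ((1 / 2) * (φ.logSlope ⟨z, hz⟩).1 w - α z) - α w := by
      intro w hw
      rw [DiscEmb.logSlope, Harm.logNorm_apply _ _ hw, cocycleExt]
      push_cast [α]
      ring
    have hi1 := (g.1.integrable_mul_harm (φ.logSlope ⟨z, hz⟩)).const_mul (1 / 2)
    have hi2 : Integrable fun w => α z * g.1 w := g.1.integrable.const_mul _
    have h0 : ∫ w, g.1 w = 0 := g.2
    rw [g.1.integral_mul_congr hc, hU ⟨z, hz⟩, toDist_apply, ← integral_const_mul]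
    have e : ∀ w, g.1 w * (((1 / 2) * (φ.logSlope ⟨z, hz⟩).1 w - α z) - α w) =
        ((1 / 2) * (g.1 w * (φ.logSlope ⟨z, hz⟩).1 w) - α z * g.1 w) - g.1 w * α w := fun w => by ring
    have hi12 : Integrable fun w => (1 / 2) * (g.1 w * (φ.logSlope ⟨z, hz⟩).1 w) - α z * g.1 w :=
      hi1.sub hi2
    simp only [e]
    rw [integral_sub hi12 (hα' g.1), integral_sub hi1 hi2, integral_const_mul (α z), h0, mul_zero,
      sub_zero]
  have h0 : ∫ w, f.1 w = 0 := f.2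
  have e : ∀ z, f.1 z * ((1 / 2) * U.1 z - ∫ w, g.1 w * α w) =
      (1 / 2) * (f.1 z * U.1 z) - (∫ w, g.1 w * α w) * f.1 z := fun z => by ring
  rw [confForm_toDist_eq_integral φ f g hU, kernelPairing_cocycle, f.1.integral_mul_congr h1]
  simp only [e]
  rw [integral_sub ((f.1.integrable_mul_harm U).const_mul _) (f.1.integrable.const_mul _),
    integral_const_mul, integral_const_mul, h0]
  push_cast
  field_simp
  ring

end ConfDisk

namespace ConfDisk

open Set Metric MeasureTheory Filter

/-! ### The image of the Batalin–Vilkovisky operator -/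

theorem greenForm_lap_left (h : Test) (f : Test₀) : greenForm (lap h) f = ∫ z, f.1 z * h z := by
  rw [greenForm_symm, greenForm_lap]

/-- The operator `x ↦ -x · Δ h + ∑ᵢ (∫ xᵢ h) x₁ ⋯ x̂ᵢ ⋯ xₙ` on `P(C_c^∞(𝔻)₀)`. -/
noncomputable def bvOp (h : Test) (x : SymmetricAlgebra ℂ Test₀) : SymmetricAlgebra ℂ Test₀ :=
  -(x * SymmetricAlgebra.ι ℂ Test₀ (lap h)) + symDeriv (greenForm (lap h)) x

theorem bvOp_prod_ι (h : Test) (n : ℕ) (f : Fin n → Test₀) :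
    bvOp h (∏ i, SymmetricAlgebra.ι ℂ Test₀ (f i)) =
      -((∏ i, SymmetricAlgebra.ι ℂ Test₀ (f i)) * SymmetricAlgebra.ι ℂ Test₀ (lap h)) +
        ∑ i, (∫ z, (f i).1 z * h z) • ∏ k with k ≠ i, SymmetricAlgebra.ι ℂ Test₀ (f k) := by
  rw [bvOp, symDeriv_prod_ι]
  simp only [greenForm_lap_left]

theorem bvOp_mem (h : Test) (x : SymmetricAlgebra ℂ Test₀) : bvOp h x ∈ bvImage := by
  induction mem_span_prod_ι x using Submodule.span_induction with
  | mem y hy =>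
    obtain ⟨n, f, rfl⟩ := hy
    exact Submodule.subset_span ⟨n, f, h, bvOp_prod_ι h n f⟩
  | zero => simp [bvOp]
  | add x y _ _ hx hy =>
    have : bvOp h (x + y) = bvOp h x + bvOp h y := by simp only [bvOp, map_add]; ring
    rw [this]
    exact add_mem hx hy
  | smul c x _ hx =>
    have : bvOp h (c • x) = c • bvOp h x := by
      simp only [bvOp, map_smul, smul_add, smul_neg, smul_mul_assoc]
    rw [this]
    exact bvImage.smul_mem c hx

theorem bvImage_induction {p : SymmetricAlgebra ℂ Test₀ → Prop} (bv : ∀ h x, p (bvOp h x)) (zero : p 0)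
    (add : ∀ x y, p x → p y → p (x + y)) (smul : ∀ (c : ℂ) x, p x → p (c • x))
    {y : SymmetricAlgebra ℂ Test₀} (hy : y ∈ bvImage) : p y := by
  induction hy using Submodule.span_induction with
  | mem y hy =>
    obtain ⟨n, f, h, rfl⟩ := hy
    rw [← bvOp_prod_ι]
    exact bv _ _
  | zero => exact zero
  | add x y _ _ hx hy => exact add x y hx hy
  | smul c x _ hx => exact smul c x hx

/-- Commuting `exp(∂_G)` past `Δh` creates the derivation `∂_G(Δh, ·)`, which is exactly the
contraction term of the operator with opposite sign. -/
theorem wick_bvOp (h : Test) (x : SymmetricAlgebra ℂ Test₀) :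
    wick greenForm greenForm_symm (bvOp h x) =
      -(SymmetricAlgebra.ι ℂ Test₀ (lap h) * wick greenForm greenForm_symm x) := by
  rw [bvOp, mul_comm x, map_add, map_neg, wick_ι_mul, symDeriv_wick]
  ring

theorem toDist_comp_distSection : toDist ∘ₗ distSection = LinearMap.id := exists_toDist_section.choose_spec

/-- The map `P(τ) ∘ exp(∂_G) : P(C_c^∞(𝔻)₀) → P(H'(𝔻)₀)`. -/
noncomputable def greenMap : SymmetricAlgebra ℂ Test₀ →ₗ[ℂ] PH₀ :=
  (symMap toDist).toLinearMap ∘ₗ wick greenForm greenForm_symm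

theorem greenMap_apply (x : SymmetricAlgebra ℂ Test₀) :
    greenMap x = symMap toDist (wick greenForm greenForm_symm x) := rfl

theorem greenMap_surjective : Function.Surjective greenMap := by
  intro y
  obtain ⟨x, rfl⟩ := symMap_surjective toDist distSection toDist_comp_distSection y
  obtain ⟨z, rfl⟩ := (wickEquiv greenForm greenForm_symm).surjective x
  exact ⟨z, rfl⟩

/-- After conjugation by `exp(∂_G)` the relations span the ideal generated by the Laplacians, and
this is the kernel of `symMap toDist` by `ker_symMap` and `ker_toDist`. -/
theorem bvImage_eq_ker : bvImage = LinearMap.ker greenMap := by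
  apply le_antisymm
  · intro y hy
    refine bvImage_induction (p := fun y => y ∈ LinearMap.ker greenMap) (fun h x => ?_) (zero_mem _)
      (fun x y hx hy => add_mem hx hy) (fun c x hx => Submodule.smul_mem _ c hx) hy
    rw [LinearMap.mem_ker, greenMap_apply, wick_bvOp, map_neg, map_mul, symMap_ι, toDist_lap, map_zero,
      zero_mul, neg_zero]
  · intro x hx
    have key : ∀ y ∈ Submodule.span ℂ {y | ∃ (z : SymmetricAlgebra ℂ Test₀) (f : Test₀), toDist f = 0 ∧
        y = z * SymmetricAlgebra.ι ℂ Test₀ f}, (wickEquiv greenForm greenForm_symm).symm y ∈ bvImage := by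
      intro y hy
      induction hy using Submodule.span_induction with
      | mem y hy =>
        obtain ⟨z, f, hf, rfl⟩ := hy
        rw [← LinearMap.mem_ker, ker_toDist] at hf
        obtain ⟨h, rfl⟩ := hf
        -- `wick_bvOp` read backwards: the preimage of `z · Δh` is the operator of `h` applied to
        -- the preimage of `z`, up to sign.
        have : (wickEquiv greenForm greenForm_symm).symm (z * SymmetricAlgebra.ι ℂ Test₀ (lap h)) =
            -bvOp h ((wickEquiv greenForm greenForm_symm).symm z) := by
          rw [LinearEquiv.symm_apply_eq, map_neg, wickEquiv_apply, wick_bvOp, ← wickEquiv_apply,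
            LinearEquiv.apply_symm_apply, neg_neg, mul_comm]
        rw [this]
        exact neg_mem (bvOp_mem _ _)
      | zero => rw [map_zero]; exact zero_mem _
      | add x y _ _ hx hy => rw [map_add]; exact add_mem hx hy
      | smul c x _ hx => rw [map_smul]; exact bvImage.smul_mem c hx
    have := key _ (ker_symMap toDist distSection toDist_comp_distSection _ hx)
    rwa [← wickEquiv_apply, LinearEquiv.symm_apply_apply] at this

/-- The isomorphism `Ψ : F_CL(𝔻)₀ ≃ P(H'(𝔻)₀)`. -/
noncomputable def greenIso : FCL₀ ≃ₗ[ℂ] PH₀ :=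
  (Submodule.quotEquivOfEq _ _ bvImage_eq_ker).trans (greenMap.quotKerEquivOfSurjective greenMap_surjective)

theorem greenIso_mkQ (x : SymmetricAlgebra ℂ Test₀) : greenIso (bvImage.mkQ x) = greenMap x := rfl

theorem isGreenIso_greenIso : IsGreenIso greenIso := fun _ => rfl

/-! ### The algebra structure on the observables -/

theorem symMap_push₀_bvOp (φ : DiscEmb) {h h' : Test} (e : φ.push₀ (lap h) = lap h')
    (x : SymmetricAlgebra ℂ Test₀) : symMap φ.push₀ (bvOp h x) = bvOp h' (symMap φ.push₀ x) := by
  have h1 : greenForm (lap h') ∘ₗ φ.push₀ = greenForm (lap h) := by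
    ext g
    rw [← e]
    exact greenForm_push₀_lap φ h g
  rw [bvOp, bvOp, map_add, map_neg, map_mul, symMap_ι, e, symDeriv_symMap, h1]

theorem symDeriv_prod_eq_zero {M ι : Type*} [AddCommGroup M] [Module ℂ M] (l : M →ₗ[ℂ] ℂ) (s : Finset ι)
    (x : ι → SymmetricAlgebra ℂ M) (h : ∀ i ∈ s, symDeriv l (x i) = 0) :
    symDeriv l (∏ i ∈ s, x i) = 0 := by
  classical
  induction s using Finset.induction_on with
  | empty => simp
  | insert i s hi ih =>
    rw [Finset.prod_insert hi, symDeriv_mul, h i (Finset.mem_insert_self _ _), zero_mul,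
      ih fun j hj => h j (Finset.mem_insert_of_mem hj), mul_zero, add_zero]

/-- Locality: contraction with `Δh` only sees where `h` lives, so it annihilates anything supported
in a disc on which `h` vanishes. -/
theorem symDeriv_greenForm_lap_symMap_push₀ (ψ : DiscEmb) (h : Test) (h0 : ∀ w ∈ disc, h (ψ w) = 0)
    (x : SymmetricAlgebra ℂ Test₀) : symDeriv (greenForm (lap h)) (symMap ψ.push₀ x) = 0 := by
  have h1 : greenForm (lap h) ∘ₗ ψ.push₀ = 0 := by
    ext g
    rw [LinearMap.comp_apply, greenForm_lap_left, push₀_coe, integral_push_mul,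
      g.1.integral_mul_congr (v := fun _ => 0) h0]
    simp
  rw [symDeriv_symMap, h1, symDeriv_zero, LinearMap.zero_apply, map_zero]

/-- The product `(F₁, …, Fₙ) ↦ [W_{φ₁}(F₁) ⋯ W_{φₙ}(Fₙ)]`. -/
noncomputable def obsProd {n : ℕ} (φ : CE n) :
    MultilinearMap ℂ (fun _ : Fin n => SymmetricAlgebra ℂ Test₀) FCL₀ :=
  bvImage.mkQ.compMultilinearMap
    ((MultilinearMap.mkPiAlgebra ℂ (Fin n) (SymmetricAlgebra ℂ Test₀)).compLinearMap
      fun i => (symMap (φ.emb i).push₀).toLinearMap)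

theorem obsProd_apply {n : ℕ} (φ : CE n) (F : Fin n → SymmetricAlgebra ℂ Test₀) :
    obsProd φ F = bvImage.mkQ (∏ i, symMap (φ.emb i).push₀ (F i)) := rfl

theorem obsProd_update_eq_zero {n : ℕ} (φ : CE n) (i : Fin n) (F : Fin n → SymmetricAlgebra ℂ Test₀)
    {y : SymmetricAlgebra ℂ Test₀} (hy : y ∈ bvImage) : obsProd φ (Function.update F i y) = 0 := by
  refine bvImage_induction (p := fun y => obsProd φ (Function.update F i y) = 0) (fun h x => ?_)
    ((obsProd φ).map_update_zero F i) (fun x y hx hy => ?_) (fun c x hx => ?_) hy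
  · obtain ⟨h', e, -, h0⟩ := exists_push₀_lap (φ.emb i) h
    rw [obsProd_apply, ← Finset.mul_prod_erase _ _ (Finset.mem_univ i), Function.update_self,
      symMap_push₀_bvOp _ e]
    set P := ∏ j ∈ Finset.univ.erase i, symMap (φ.emb j).push₀ (Function.update F i (bvOp h x) j) with hP
    have hP0 : symDeriv (greenForm (lap h')) P = 0 := by
      refine symDeriv_prod_eq_zero _ _ _ fun j hj =>
        symDeriv_greenForm_lap_symMap_push₀ _ _ (fun w hw => h0 _ fun hx => ?_) _
      exact Set.disjoint_left.1 (φ.disjoint' (Finset.ne_of_mem_erase hj)) ⟨w, hw, rfl⟩ hx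
    -- The contraction kills the factors from the other discs, so multiplication by them preserves
    -- relations; this is where disjointness of the images enters.
    have h2 : bvOp h' (symMap (φ.emb i).push₀ x) * P = bvOp h' (symMap (φ.emb i).push₀ x * P) := by
      rw [bvOp, bvOp, symDeriv_mul, hP0]
      ring
    rw [h2, Submodule.mkQ_apply, Submodule.Quotient.mk_eq_zero]
    exact bvOp_mem _ _
  · rw [MultilinearMap.map_update_add, hx, hy, add_zero]
  · rw [MultilinearMap.map_update_smul, hx, smul_zero]

theorem exists_mkQ_section : ∃ s : FCL₀ →ₗ[ℂ] SymmetricAlgebra ℂ Test₀, bvImage.mkQ ∘ₗ s = LinearMap.id := by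
  have : Module.Free ℂ FCL₀ := Module.Free.of_divisionRing ℂ FCL₀
  have : Module.Projective ℂ FCL₀ := inferInstance
  exact LinearMap.exists_rightInverse_of_surjective bvImage.mkQ bvImage.range_mkQ

/-- The induced product on `F_CL(𝔻)₀`. -/
noncomputable def obsMul {n : ℕ} (φ : CE n) : MultilinearMap ℂ (fun _ : Fin n => FCL₀) FCL₀ :=
  (obsProd φ).compLinearMap fun _ => exists_mkQ_section.choose

theorem obsMul_mkQ {n : ℕ} (φ : CE n) (F : Fin n → SymmetricAlgebra ℂ Test₀) :
    obsMul φ (fun i => bvImage.mkQ (F i)) = bvImage.mkQ (∏ i, symMap (φ.emb i).push₀ (F i)) := by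
  rw [← obsProd_apply, obsMul, MultilinearMap.compLinearMap_apply]
  refine MultilinearMap.congr_of_sub_mem (obsProd φ) bvImage
    (fun i x y hy => obsProd_update_eq_zero φ i x hy) _ _ fun i => ?_
  exact (Submodule.Quotient.eq bvImage).1
    (LinearMap.congr_fun exists_mkQ_section.choose_spec (bvImage.mkQ (F i)))

theorem push₀_id : DiscEmb.id.push₀ = LinearMap.id := by
  ext f x
  change DiscEmb.id.pushFun f.1 x = f.1 x
  by_cases hx : x ∈ disc
  · have h1 : DiscEmb.id x = x := indicator_of_mem hx fun z => z
    have h2 : deriv DiscEmb.id x = 1 := by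
      have h : DiscEmb.id =ᶠ[𝓝 x] fun z : ℂ => z := indicator_disc_eventuallyEq (fun z => z) hx
      rw [h.deriv_eq]
      simp
    have h3 := DiscEmb.id.pushFun_apply f.1 hx
    rw [h1, h2] at h3
    simpa using h3
  · rw [f.1.eq_zero_of_notMem hx]
    refine push_eq_zero DiscEmb.id f.1 ?_
    rintro ⟨z, hz, rfl⟩
    exact hx (DiscEmb.id.mapsTo' hz)

theorem push₀_comp (φ ψ : DiscEmb) : (φ.comp ψ).push₀ = φ.push₀ ∘ₗ ψ.push₀ := by
  ext f x
  change (φ.comp ψ).push f.1 x = φ.push (ψ.push f.1) x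
  by_cases hx : x ∈ φ '' disc
  · obtain ⟨y, hy, rfl⟩ := hx
    have h1 : φ.push (ψ.push f.1) (φ y) = (((‖deriv φ y‖ ^ 2)⁻¹ : ℝ) : ℂ) * ψ.push f.1 y :=
      φ.pushFun_apply _ hy
    rw [h1]
    by_cases hy' : y ∈ ψ '' disc
    · obtain ⟨z, hz, rfl⟩ := hy'
      have h2 : ψ.push f.1 (ψ z) = (((‖deriv ψ z‖ ^ 2)⁻¹ : ℝ) : ℂ) * f.1 z := ψ.pushFun_apply _ hz
      have h3 : (φ.comp ψ).push f.1 (φ.comp ψ z) = (((‖deriv (φ.comp ψ) z‖ ^ 2)⁻¹ : ℝ) : ℂ) * f.1 z :=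
        (φ.comp ψ).pushFun_apply _ hz
      have h4 : deriv (φ.comp ψ) z = deriv φ (ψ z) * deriv ψ z := by
        have h : (φ.comp ψ : ℂ → ℂ) =ᶠ[𝓝 z] φ ∘ ψ := indicator_disc_eventuallyEq _ hz
        rw [h.deriv_eq, deriv_comp z (φ.analyticAt hy).differentiableAt (ψ.analyticAt hz).differentiableAt]
      rw [DiscEmb.comp_apply _ _ hz] at h3
      rw [h3, h2, h4, norm_mul, mul_pow, mul_inv]
      push_cast; ring
    · rw [push_eq_zero ψ f.1 hy', mul_zero]
      refine push_eq_zero _ f.1 ?_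
      rintro ⟨z, hz, h⟩
      rw [DiscEmb.comp_apply _ _ hz] at h
      exact hy' ⟨z, hz, φ.injOn' (ψ.mapsTo' hz) hy h⟩
  · rw [push_eq_zero φ _ hx]
    refine push_eq_zero _ f.1 ?_
    rintro ⟨z, hz, h⟩
    rw [DiscEmb.comp_apply _ _ hz] at h
    exact hx ⟨ψ z, ψ.mapsTo' hz, h⟩

theorem exists_lift {ι : Type*} (x : ι → FCL₀) : ∃ F : ι → SymmetricAlgebra ℂ Test₀,
    x = fun i => bvImage.mkQ (F i) := by
  choose F hF using fun i => bvImage.mkQ_surjective (x i)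
  exact ⟨F, funext fun i => (hF i).symm⟩

theorem CE.comp_emb {n : ℕ} (φ : CE n) {k : Fin n → ℕ} (ψ : ∀ i, CE (k i)) (i : Fin n) (l : Fin (k i)) :
    (φ.comp ψ).emb (finSigmaFinEquiv ⟨i, l⟩) = (φ.emb i).comp ((ψ i).emb l) := by
  change (fun q : (i : Fin n) × Fin (k i) => (φ.emb q.1).comp ((ψ q.1).emb q.2))
    (finSigmaFinEquiv.symm (finSigmaFinEquiv ⟨i, l⟩)) = _
  rw [Equiv.symm_apply_apply]

/-- The `CE₂`-algebra `F_CL(𝔻)₀`. -/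
noncomputable def obsAlgebra : CEAlgebra FCL₀ where
  ρ φ := obsMul φ
  map_id x := by
    obtain ⟨F, rfl⟩ := exists_lift x
    rw [obsMul_mkQ]
    simp [CE.ofEmb, push₀_id, symMap_id]
  map_comp φ k ψ x := by
    obtain ⟨F, rfl⟩ := exists_lift x
    rw [obsMul_mkQ]
    simp only [obsMul_mkQ]
    congr 1
    simp only [map_prod, symMap_comp, ← push₀_comp]
    rw [← finSigmaFinEquiv.prod_comp, Fintype.prod_sigma]
    simp only [CE.comp_emb]
  map_perm φ σ x := by
    obtain ⟨F, rfl⟩ := exists_lift x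
    rw [obsMul_mkQ (φ.perm σ) fun i => F (σ i), obsMul_mkQ φ F]
    exact congrArg _ (Equiv.prod_comp σ fun i => symMap (φ.emb i).push₀ (F i))

theorem isObservableAlgebra_obsAlgebra : IsObservableAlgebra obsAlgebra := fun φ F => obsMul_mkQ φ F

/-! ### The normalized structure -/

/-- The number `(4π)^{1/2} i`. -/
noncomputable def normConst : ℂ := (Real.sqrt (4 * Real.pi) : ℂ) * Complex.I

/-- Each contraction removes two generators, so the normalization rescales bilinear forms by this
square. -/
theorem normConst_sq : normConst * normConst = -4 * Real.pi := by
  have h : ((Real.sqrt (4 * Real.pi) : ℝ) : ℂ) * (Real.sqrt (4 * Real.pi) : ℝ) = 4 * Real.pi := by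
    rw [← Complex.ofReal_mul, Real.mul_self_sqrt (by positivity)]
    push_cast; ring
  calc normConst * normConst = ((Real.sqrt (4 * Real.pi) : ℝ) : ℂ) * (Real.sqrt (4 * Real.pi) : ℝ) *
        (Complex.I * Complex.I) := by rw [normConst]; ring
    _ = -4 * Real.pi := by rw [h, Complex.I_mul_I]; ring

theorem normConst_ne_zero : normConst ≠ 0 := fun h => by
  have h1 := normConst_sq
  rw [h, mul_zero, eq_comm] at h1
  have hpi : (Real.pi : ℂ) ≠ 0 := by exact_mod_cast Real.pi_ne_zero
  simp [hpi] at h1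

theorem normalization_apply (x : PH₀) :
    normalization x = symMap (normConst • (LinearMap.id : HarmDual₀ →ₗ[ℂ] HarmDual₀)) x := rfl

theorem normalization_ι (T : HarmDual₀) : normalization (SymmetricAlgebra.ι ℂ HarmDual₀ T) =
    normConst • SymmetricAlgebra.ι ℂ HarmDual₀ T := by
  rw [normalization_apply, symMap_ι, LinearMap.smul_apply, map_smul, LinearMap.id_apply]

/-- The normalization as a linear equivalence. -/
noncomputable def normEquiv : PH₀ ≃ₗ[ℂ] PH₀ :=
  LinearEquiv.ofLinearMap normalization.toLinearMap (symMap (normConst⁻¹ • LinearMap.id)).toLinearMap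
    (LinearMap.ext fun x => by
      change normalization (symMap _ x) = x
      rw [normalization_apply, symMap_comp]
      convert symMap_id x
      ext1 T
      simp [smul_smul, normConst_ne_zero])
    (LinearMap.ext fun x => by
      change symMap _ (normalization x) = x
      rw [normalization_apply, symMap_comp]
      convert symMap_id x
      ext1 T
      simp [smul_smul, normConst_ne_zero])

/-- The normalized algebra `(P(H'(𝔻)₀), ρ^{NH})`. -/
noncomputable def normAlgebra : CEAlgebra PH₀ := obsAlgebra.transport (greenIso.trans normEquiv.symm)

theorem normalization_normAlgebra {n : ℕ} (φ : CE n) (y : Fin n → PH₀) :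
    normalization (normAlgebra.ρ φ y) =
      greenIso (obsAlgebra.ρ φ fun i => greenIso.symm (normalization (y i))) :=
  normEquiv.apply_symm_apply _

theorem isNormalizedTransport_normAlgebra : IsNormalizedTransport obsAlgebra greenIso normAlgebra :=
  fun φ y => normalization_normAlgebra φ y

/-- Reduces computations with the transported structure to representatives in `P(C_c^∞(𝔻)₀)`,
without inverting `greenIso`. -/
theorem normalization_normAlgebra_of_eq {n : ℕ} (φ : CE n) (y : Fin n → PH₀)
    (F : Fin n → SymmetricAlgebra ℂ Test₀) (h : ∀ i, greenMap (F i) = normalization (y i)) :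
    normalization (normAlgebra.ρ φ y) = greenMap (∏ i, symMap (φ.emb i).push₀ (F i)) := by
  have h1 : (fun i => greenIso.symm (normalization (y i))) = fun i => bvImage.mkQ (F i) :=
    funext fun i => by rw [LinearEquiv.symm_apply_eq, greenIso_mkQ, h]
  rw [normalization_normAlgebra, h1, isObservableAlgebra_obsAlgebra, greenIso_mkQ]

/-- The pairing `∂_φ` before normalization. -/
noncomputable def confForm' (φ : DiscEmb) : LinearMap.BilinForm ℂ HarmDual₀ :=
  (-4 * Real.pi : ℂ)⁻¹ • confForm φ

theorem confForm'_apply (φ : DiscEmb) (S T : HarmDual₀) :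
    confForm' φ S T = (-4 * Real.pi : ℂ)⁻¹ * confForm φ S T := rfl

theorem confForm'_symm (φ : DiscEmb) (S T : HarmDual₀) : confForm' φ S T = confForm' φ T S := by
  rw [confForm'_apply, confForm'_apply, confForm_symm]

theorem confForm'_toDist (φ : DiscEmb) (f g : Test₀) : confForm' φ (toDist f) (toDist g) =
    greenForm (φ.push₀ f) (φ.push₀ g) - greenForm f g := by
  have hpi : (Real.pi : ℂ) ≠ 0 := by exact_mod_cast Real.pi_ne_zero
  rw [confForm'_apply, confForm_toDist]
  field_simp

/-- By naturality, `exp(∂_G)` after `W_φ` is `W_φ` after the exponential of the pulled-back form.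
That form is `∂_G` plus the unnormalized `∂_φ`, so its exponential factors, and the second factor
descends to distributions. -/
theorem greenMap_symMap_push₀ (φ : DiscEmb) (X : SymmetricAlgebra ℂ Test₀) :
    greenMap (symMap φ.push₀ X) =
      symMap φ.act (wick (confForm' φ) (confForm'_symm φ) (greenMap X)) := by
  let G' : LinearMap.BilinForm ℂ Test₀ := greenForm.compl₁₂ φ.push₀ φ.push₀
  let E : LinearMap.BilinForm ℂ Test₀ := (confForm' φ).compl₁₂ toDist toDist
  have hG' : ∀ f g, G' f g = G' g f := fun f g => greenForm_symm _ _
  have hE : ∀ f g, E f g = E g f := fun f g => confForm'_symm φ _ _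
  have hsum : E + greenForm = G' := LinearMap.ext₂ fun f g => by
    change confForm' φ (toDist f) (toDist g) + greenForm f g = greenForm (φ.push₀ f) (φ.push₀ g)
    rw [confForm'_toDist, sub_add_cancel]
  have h3 : toDist ∘ₗ φ.push₀ = φ.act ∘ₗ toDist := LinearMap.ext fun f => toDist_push₀ φ f
  have h1 : greenMap (symMap φ.push₀ X) = symMap toDist (symMap φ.push₀ (wick G' hG' X)) :=
    congrArg (symMap toDist) (wick_symMap φ.push₀ G' hG' greenForm greenForm_symm (fun _ _ => rfl) X)
  have h2 : wick G' hG' X = wick E hE (wick greenForm greenForm_symm X) :=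
    (wick_wick E greenForm G' hE greenForm_symm hG' hsum X).symm
  have h4 : symMap toDist (wick E hE (wick greenForm greenForm_symm X)) =
      wick (confForm' φ) (confForm'_symm φ) (greenMap X) :=
    (wick_symMap toDist E hE (confForm' φ) (confForm'_symm φ) (fun _ _ => rfl) _).symm
  rw [h1, symMap_comp, h3, ← symMap_comp, h2, h4]

/-- Passing the normalization through the exponential multiplies the form by `-4π`, which accounts
for the factor in the definition of `confForm`. -/
theorem wick_confForm'_normalization (φ : DiscEmb) (F : PH₀) :
    wick (confForm' φ) (confForm'_symm φ) (normalization F) =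
      normalization (wick (confForm φ) (confForm_symm φ) F) := by
  have hpi : (Real.pi : ℂ) ≠ 0 := by exact_mod_cast Real.pi_ne_zero
  refine wick_symMap (normConst • LinearMap.id) (confForm φ) (confForm_symm φ) (confForm' φ)
    (confForm'_symm φ) (fun S T => ?_) F
  rw [LinearMap.smul_apply, LinearMap.smul_apply, LinearMap.id_apply, LinearMap.id_apply, map_smul,
    map_smul, LinearMap.smul_apply, smul_smul, normConst_sq, confForm'_apply, smul_eq_mul]
  field_simp

theorem symMap_normalization (L : HarmDual₀ →ₗ[ℂ] HarmDual₀) (F : PH₀) :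
    symMap L (normalization F) = normalization (symMap L F) := by
  have h : (normConst • (LinearMap.id : HarmDual₀ →ₗ[ℂ] HarmDual₀)) ∘ₗ L =
      L ∘ₗ (normConst • (LinearMap.id : HarmDual₀ →ₗ[ℂ] HarmDual₀)) :=
    LinearMap.ext fun T => (map_smul L normConst T).symm
  rw [normalization_apply, normalization_apply, symMap_comp, symMap_comp, h]

theorem normAlgebra_ofEmb (φ : DiscEmb) (F : PH₀) : normAlgebra.ρ (CE.ofEmb φ) ![F] =
    symMap φ.act (wick (confForm φ) (confForm_symm φ) F) := by
  obtain ⟨X, hX⟩ := greenMap_surjective (normalization F)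
  apply normEquiv.injective
  have h1 : normalization (normAlgebra.ρ (CE.ofEmb φ) ![F]) =
      greenMap (∏ i, symMap ((CE.ofEmb φ).emb i).push₀ (![X] i)) :=
    normalization_normAlgebra_of_eq _ _ ![X] fun i => by
      rw [Subsingleton.elim i 0]
      exact hX
  have h2 : (∏ i, symMap ((CE.ofEmb φ).emb i).push₀ (![X] i)) = symMap φ.push₀ X :=
    Fin.prod_univ_one _
  refine h1.trans ?_
  rw [h2, greenMap_symMap_push₀ φ X, hX, wick_confForm'_normalization φ F]
  exact symMap_normalization φ.act _

theorem greenMap_smul_ι {h : Test₀} {T : HarmDual₀} (hT : toDist h = T) :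
    greenMap (normConst • SymmetricAlgebra.ι ℂ Test₀ h) =
      normalization (SymmetricAlgebra.ι ℂ HarmDual₀ T) := by
  rw [map_smul, greenMap_apply, wick_ι, symMap_ι, normalization_ι, hT]

theorem greenMap_ι_mul_ι {f g : Test₀} {S T : HarmDual₀} (hf : toDist f = S) (hg : toDist g = T) :
    greenMap (SymmetricAlgebra.ι ℂ Test₀ f * SymmetricAlgebra.ι ℂ Test₀ g) =
      SymmetricAlgebra.ι ℂ HarmDual₀ S * SymmetricAlgebra.ι ℂ HarmDual₀ T +
        algebraMap ℂ PH₀ (greenForm f g) := by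
  subst hf hg
  rw [greenMap_apply, wick_mul_ι, map_add, map_mul, symMap_ι, symMap_ι, AlgHom.commutes]

theorem symMap_smul_id_ι_mul_ι_add {M : Type*} [AddCommMonoid M] [Module ℂ M] (S T : M) (c d k : ℂ)
    {v v' : ℂ} (hv : (k * k) * v = v') : symMap (k • (LinearMap.id : M →ₗ[ℂ] M)) ((c * d) • (SymmetricAlgebra.ι ℂ M S * SymmetricAlgebra.ι ℂ M T) +
      algebraMap ℂ _ v') = (k * k) • (SymmetricAlgebra.ι ℂ M (c • S) *
        SymmetricAlgebra.ι ℂ M (d • T) + algebraMap ℂ _ v) := by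
  subst hv
  rw [map_add, map_smul, map_mul, symMap_ι, symMap_ι, AlgHom.commutes, LinearMap.smul_apply,
    LinearMap.smul_apply, LinearMap.id_apply, LinearMap.id_apply, map_smul, map_smul, map_smul, map_smul,
    smul_mul_smul_comm, smul_mul_smul_comm, smul_add, smul_comm, map_mul, ← Algebra.smul_def]

/-- Linear elements are unaffected by Wick ordering, so the only contraction is the Green pairing
between the two discs, computed in `greenForm_push₀_of_disjoint`. -/
theorem normAlgebra_dzDelta (φ : CE 2) (a b : disc) :
    normAlgebra.ρ φ ![SymmetricAlgebra.ι ℂ HarmDual₀ (dzDelta 0 a),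
        SymmetricAlgebra.ι ℂ HarmDual₀ (dzDelta 0 b)] =
      (deriv (φ.emb 0) a * deriv (φ.emb 1) b) •
          (SymmetricAlgebra.ι ℂ HarmDual₀ (dzDelta 0 ((φ.emb 0).map a)) *
            SymmetricAlgebra.ι ℂ HarmDual₀ (dzDelta 0 ((φ.emb 1).map b))) +
        algebraMap ℂ PH₀ (deriv (φ.emb 0) a * deriv (φ.emb 1) b / (φ.emb 0 a - φ.emb 1 b) ^ 2) := by
  obtain ⟨f, hf⟩ := toDist_surjective (dzDelta 0 a)
  obtain ⟨g, hg⟩ := toDist_surjective (dzDelta 0 b)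
  apply normEquiv.injective
  have h0 : normalization (normAlgebra.ρ φ ![SymmetricAlgebra.ι ℂ HarmDual₀ (dzDelta 0 a),
      SymmetricAlgebra.ι ℂ HarmDual₀ (dzDelta 0 b)]) =
      greenMap (∏ i, symMap (φ.emb i).push₀ (![normConst • SymmetricAlgebra.ι ℂ Test₀ f,
        normConst • SymmetricAlgebra.ι ℂ Test₀ g] i)) := by
    refine normalization_normAlgebra_of_eq _ _ _ ?_
    rw [Fin.forall_fin_two]
    exact ⟨greenMap_smul_ι hf, greenMap_smul_ι hg⟩
  have h1 : (∏ i, symMap (φ.emb i).push₀ (![normConst • SymmetricAlgebra.ι ℂ Test₀ f,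
      normConst • SymmetricAlgebra.ι ℂ Test₀ g] i)) = (normConst * normConst) •
      (SymmetricAlgebra.ι ℂ Test₀ ((φ.emb 0).push₀ f) *
        SymmetricAlgebra.ι ℂ Test₀ ((φ.emb 1).push₀ g)) := by
    refine (Fin.prod_univ_two _).trans ?_
    change symMap _ (normConst • _) * symMap _ (normConst • _) = _
    rw [map_smul, map_smul, symMap_ι, symMap_ι, smul_mul_smul_comm]
  have h2 := greenForm_push₀_of_disjoint (φ.emb 0) (φ.emb 1) (φ.disjoint' (by decide)) a b hf hg
  rw [← normConst_sq] at h2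
  have e1 : toDist ((φ.emb 0).push₀ f) = deriv (φ.emb 0) a • dzDelta 0 ((φ.emb 0).map a) := by
    rw [toDist_push₀, hf, act_dzDelta]
  have e2 : toDist ((φ.emb 1).push₀ g) = deriv (φ.emb 1) b • dzDelta 0 ((φ.emb 1).map b) := by
    rw [toDist_push₀, hg, act_dzDelta]
  refine h0.trans ?_
  rw [h1, greenMap.map_smul, greenMap_ι_mul_ι e1 e2]
  exact (symMap_smul_id_ι_mul_ι_add _ _ _ _ normConst h2).symm

end ConfDisk

/-! ### The main theorem -/

theorem mainTheorem9 :
    -- (1): the expansion of the elements of `H'(𝔻)₀`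
    ((∀ a b : ℕ → ℂ, GrowthCondition a b ↔ ∃ T : HarmDual₀, HasExpansion T a b) ∧
      ∀ T : HarmDual₀, ∃! p : (ℕ → ℂ) × (ℕ → ℂ),
        GrowthCondition p.1 p.2 ∧ HasExpansion T p.1 p.2) ∧
    -- the identification `C_c^∞(𝔻)₀ / Δ C_c^∞(𝔻) = H'(𝔻)₀`, compatible with `W_φ`
    (Function.Surjective toDist ∧ LinearMap.ker toDist = LinearMap.range lap) ∧
    (∀ (φ : DiscEmb) (f : Test₀), toDist (φ.push₀ f) = φ.act (toDist f)) ∧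
    -- the algebra `F_CL(𝔻)₀`, the isomorphism `Ψ_G`, the normalized algebra `(P(H'(𝔻)₀), ρ^{NH})`,
    -- and the normalized pairings `∂_φ = (-4π) (-(2π)⁻¹ ∂_{H_φ})` on `H'(𝔻)₀`
    ∃ (Q : CEAlgebra FCL₀) (Ψ : FCL₀ ≃ₗ[ℂ] PH₀) (A : CEAlgebra PH₀)
      (D : DiscEmb → LinearMap.BilinForm ℂ HarmDual₀) (hD : ∀ φ S T, D φ S T = D φ T S),
      IsObservableAlgebra Q ∧ IsGreenIso Ψ ∧ IsNormalizedTransport Q Ψ A ∧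
      (∀ (φ : DiscEmb) (f g : Test₀), D φ (toDist f) (toDist g) =
        (-4 * Real.pi) * (-(2 * Real.pi)⁻¹ * kernelPairing (cocycle φ) f g)) ∧
      -- (2)
      (∀ φ : DiscEmb,
        (∀ a : disc, symMap φ.act (SymmetricAlgebra.ι ℂ HarmDual₀ (dzDelta 0 a)) =
          deriv φ a • SymmetricAlgebra.ι ℂ HarmDual₀ (dzDelta 0 (φ.map a))) ∧
        (∀ a b : disc, a ≠ b → D φ (dzDelta 0 a) (dzDelta 0 b) =
          deriv φ a * deriv φ b / (φ a - φ b) ^ 2 - 1 / ((a : ℂ) - b) ^ 2) ∧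
        (∀ a b : disc, a ≠ b → D φ (dzbarDelta 0 a) (dzbarDelta 0 b) =
          conj (deriv φ a * deriv φ b / (φ a - φ b) ^ 2) - 1 / (conj (a : ℂ) - conj (b : ℂ)) ^ 2) ∧
        (∀ a : disc, Filter.Tendsto (fun p : ℂ × ℂ =>
            deriv φ p.1 * deriv φ p.2 / (φ p.1 - φ p.2) ^ 2 - 1 / (p.1 - p.2) ^ 2)
          (𝓝[{p | p.1 ≠ p.2}] ((a : ℂ), (a : ℂ))) (𝓝 (D φ (dzDelta 0 a) (dzDelta 0 a)))) ∧
        (∀ a : disc, Filter.Tendsto (fun p : ℂ × ℂ =>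
            conj (deriv φ p.1 * deriv φ p.2 / (φ p.1 - φ p.2) ^ 2) -
              1 / (conj p.1 - conj p.2) ^ 2)
          (𝓝[{p | p.1 ≠ p.2}] ((a : ℂ), (a : ℂ))) (𝓝 (D φ (dzbarDelta 0 a) (dzbarDelta 0 a)))) ∧
        (∀ (a b : disc) (n m : ℕ), D φ (dzDelta n a) (dzbarDelta m b) = 0) ∧
        ∀ F : PH₀, A.ρ (CE.ofEmb φ) ![F] =
          symMap φ.act (expOp (contraction (D φ) (hD φ)) F)) ∧
      -- (3)
      ∀ (φ : CE 2) (a b : disc),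
        A.ρ φ ![SymmetricAlgebra.ι ℂ HarmDual₀ (dzDelta 0 a),
            SymmetricAlgebra.ι ℂ HarmDual₀ (dzDelta 0 b)] =
          (deriv (φ.emb 0) a * deriv (φ.emb 1) b) •
              (SymmetricAlgebra.ι ℂ HarmDual₀ (dzDelta 0 ((φ.emb 0).map a)) *
                SymmetricAlgebra.ι ℂ HarmDual₀ (dzDelta 0 ((φ.emb 1).map b))) +
            algebraMap ℂ PH₀ (deriv (φ.emb 0) a * deriv (φ.emb 1) b /
              (φ.emb 0 a - φ.emb 1 b) ^ 2) := by
  refine ⟨⟨growthCondition_iff_exists_hasExpansion, existsUnique_expansion⟩,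
    ⟨toDist_surjective, ker_toDist⟩, toDist_push₀, obsAlgebra, greenIso, normAlgebra, confForm,
    confForm_symm, isObservableAlgebra_obsAlgebra, isGreenIso_greenIso,
    isNormalizedTransport_normAlgebra, confForm_toDist_eq_kernelPairing, fun φ => ⟨fun a => ?_,
      fun a b hab => ?_, fun a b hab => ?_, fun a => ?_, fun a => ?_, confForm_dzDelta_dzbarDelta φ,
      normAlgebra_ofEmb φ⟩, normAlgebra_dzDelta⟩
  · rw [symMap_ι, act_dzDelta, map_smul]
  · rw [confForm_dzDelta, φ.deriv_slopeLogDeriv b.2 a.2 fun h => hab (Subtype.ext h)]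
  · rw [confForm_dzbarDelta, φ.deriv_slopeLogDeriv b.2 a.2 fun h => hab (Subtype.ext h)]
    simp
  · rw [confForm_dzDelta]
    exact φ.tendsto_slopeLogDeriv a
  · rw [confForm_dzbarDelta]
    refine ((Complex.continuous_conj.tendsto _).comp (φ.tendsto_slopeLogDeriv a)).congr fun p => ?_
    simp
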